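/- **Conventions.** Amalgamated free products $G_1*_HG_2$ in the definition of $\mathcal A$ are non-fictitious, i.e. $G_1\neq H\neq G_2$. For a group $G_1$, a subgroup $H\le G_1$ and an isomorphism $\varphi:H\to H'$ onto a subgroup $H'\le G_1$, the HNN-extension is $HNN(G_1,H,t)=\langle G_1,t\mid tht^{-1}=\varphi(h),\ h\in H\rangle$. A finitely generated group is one-ended if its Cayley graph with respect to a finite generating set has exactly one end. $\widehat G$ denotes the profinite completion of $G$. A graph of groups is reduced if, for every edge that is not a loop, the edge group is a proper subgroup of both adjacent vertex groups. A group $G$ is accessible if there is a number $n(G)$ such that every finite connected reduced graph of groups $(\mathcal G,\Gamma)$ with finite edge groups and $G\cong\pi_1(\mathcal G,\Gamma)$ satisfies $|V(\Gamma)|+|E(\Gamma)|\le n(G)$. A profinite graph is a profinite space $\Gamma$ with a closed non-empty subset $V(\Gamma)$ of vertices and continuous maps $d_0,d_1:\Gamma\to V(\Gamma)$ that restrict to the identity on $V(\Gamma)$; its edges are the elements of $\Gamma\setminus V(\Gamma)$. Put $E^*(\Gamma)=\Gamma/V(\Gamma)$, pointed by the class $*$ of $V(\Gamma)$. The profinite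 graph $\Gamma$ is a profinite tree if the sequence of free profinite $\widehat{\mathbb Z}$-modules $$0\to[[\widehat{\mathbb Z}(E^*(\Gamma),*)]]\xrightarrow{d}[[\widehat{\mathbb Z}V(\Gamma)]]\xrightarrow{\varepsilon}\widehat{\mathbb Z}\to0,\qquad d(\bar e)=d_1(e)-d_0(e),\quad \varepsilon(v)=1,$$ is exact. Let $\mathcal A$ be the class (the largest one satisfying this description) of all finitely generated residually finite accessible groups $G$ such that 1. if $G\cong G_1*_HG_2$ with $H$ finite, then $G_1,G_2\in\mathcal A$; if $G\cong HNN(G_1,H,t)$ with $H$ finite, then $G_1\in\mathcal A$; 2. if $G$ is one-ended, then every continuous action of $\widehat G$ on a profinite tree with finite edge stabilizers fixes a vertex. **Proposition.** If $G_1,G_2\in\mathcal A$ and $H$ is a finite group embedded in both $G_1$ and $G_2$, then $G_1*_HG_2\in\mathcal A$. If $G_1\in\mathcal A$ and $H\le G_1$ is a finite subgroup, then every HNN-extension $HNN(G_1,H,t)$ (for any isomorphism of $H$ onto a subgroup of $G_1$) is in $\mathcal A$. -/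

import Mathlib

universe u

namespace FiniteSplitting

/-! ### Ends of groups -/

/-- A group is one-ended if it is finitely generated and its Cayley graph with respect to a finite
generating set has exactly one end. -/
def OneEnded (G : Type u) [Group G] : Prop :=
  ∃ S : Finset G, Subgroup.closure (S : Set G) = ⊤ ∧
    ∃! e, e ∈ (SimpleGraph.mulCayley (S : Set G)).end

/-! ### Graphs of groups and accessibility -/

/-- A graph of groups: a graph with vertex set `V`, edge set `E` and incidence maps `d₀`, `d₁`,
a group for every vertex and every edge, and monomorphisms `bd₀ e`, `bd₁ e` from the group of an
edge `e` to the groups of its end points. -/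
structure GraphOfGroups where
  V : Type
  E : Type
  d₀ : E → V
  d₁ : E → V
  vertexGroup : V → Type u
  edgeGroup : E → Type u
  [vertexGroupGroup : ∀ v, Group (vertexGroup v)]
  [edgeGroupGroup : ∀ e, Group (edgeGroup e)]
  bd₀ : ∀ e, edgeGroup e →* vertexGroup (d₀ e)
  bd₁ : ∀ e, edgeGroup e →* vertexGroup (d₁ e)
  bd₀_injective : ∀ e, Function.Injective (bd₀ e)
  bd₁_injective : ∀ e, Function.Injective (bd₁ e)

attribute [instance] GraphOfGroups.vertexGroupGroup GraphOfGroups.edgeGroupGroup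

namespace GraphOfGroups

variable (𝒢 : GraphOfGroups.{u})

/-- Two vertices are joined by an (undirected) edge path with all edges in `D`. -/
def Joined (D : Set 𝒢.E) : 𝒢.V → 𝒢.V → Prop :=
  Relation.EqvGen fun v w => ∃ e ∈ D, 𝒢.d₀ e = v ∧ 𝒢.d₁ e = w

/-- The edge set `D` is a maximal subtree: together with all the vertices it forms a connected
graph without circuits, i.e. a connected graph in which every edge is a bridge. -/
def IsMaximalSubtree (D : Set 𝒢.E) : Prop :=
  Nonempty 𝒢.V ∧ (∀ v w, 𝒢.Joined D v w) ∧
    ∀ e ∈ D, ¬ 𝒢.Joined (D \ {e}) (𝒢.d₀ e) (𝒢.d₁ e)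

/-- For an edge that is not a loop, the edge group is a proper subgroup of both vertex groups. -/
def IsReduced : Prop :=
  ∀ e, 𝒢.d₀ e ≠ 𝒢.d₁ e →
    ¬ Function.Surjective (𝒢.bd₀ e) ∧ ¬ Function.Surjective (𝒢.bd₁ e)

/-- The free product of all the vertex groups and the free group on the letters `t_e`. -/
abbrev FreeProd : Type u :=
  Monoid.Coprod (Monoid.CoprodI 𝒢.vertexGroup) (FreeGroup 𝒢.E)

/-- An element of a vertex group, as an element of the free product. -/
def vert (v : 𝒢.V) : 𝒢.vertexGroup v →* 𝒢.FreeProd :=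
  Monoid.Coprod.inl.comp Monoid.CoprodI.of

/-- The letter `t_e`. -/
def letter (e : 𝒢.E) : 𝒢.FreeProd := Monoid.Coprod.inr (FreeGroup.of e)

/-- The relators of the fundamental group: `t_e = 1` for `e ∈ D`, and
`bd₀ g = t_e (bd₁ g) t_e⁻¹` for `g` in the edge group of `e`. -/
def relators (D : Set 𝒢.E) : Set 𝒢.FreeProd :=
  {x | ∃ e ∈ D, x = 𝒢.letter e} ∪
  {x | ∃ (e : 𝒢.E) (g : 𝒢.edgeGroup e), x = 𝒢.vert _ (𝒢.bd₀ e g) *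
    (𝒢.letter e * 𝒢.vert _ (𝒢.bd₁ e g) * (𝒢.letter e)⁻¹)⁻¹}

/-- The fundamental group of a graph of groups with respect to a maximal subtree `D`. -/
abbrev FundamentalGroup (D : Set 𝒢.E) : Type u :=
  𝒢.FreeProd ⧸ Subgroup.normalClosure (𝒢.relators D)

end GraphOfGroups

/-- A group `G` is accessible if there is a bound `n` on the size (number of vertices and edges) of
all finite connected reduced graphs of groups with finite edge groups and fundamental group `G`. -/
def Accessible (G : Type u) [Group G] : Prop :=
  ∃ n : ℕ, ∀ (𝒢 : GraphOfGroups.{u}) (D : Set 𝒢.E), Finite 𝒢.V → Finite 𝒢.E →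
    𝒢.IsMaximalSubtree D → 𝒢.IsReduced → (∀ e, Finite (𝒢.edgeGroup e)) →
    Nonempty (G ≃* 𝒢.FundamentalGroup D) → Nat.card 𝒢.V + Nat.card 𝒢.E ≤ n

/-! ### Free profinite modules over the profinite integers -/

/-- The ring of profinite integers, the inverse limit of the rings `ZMod n`. -/
def zHat : Subring (∀ n : ℕ+, ZMod n) where
  carrier := {x | ∀ (m n : ℕ+) (h : (m : ℕ) ∣ n), ZMod.castHom h (ZMod m) (x n) = x m}
  mul_mem' hx hy m n h := by simp only [Pi.mul_apply, map_mul, hx m n h, hy m n h]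
  one_mem' m n h := by simp only [Pi.one_apply, map_one]
  add_mem' hx hy m n h := by simp only [Pi.add_apply, map_add, hx m n h, hy m n h]
  zero_mem' m n h := by simp only [Pi.zero_apply, map_zero]
  neg_mem' hx m n h := by simp only [Pi.neg_apply, map_neg, hx m n h]

/-- The ring of profinite integers. -/
abbrev ZHat : Type := zHat

section FreeModules

variable (X : Type u) [TopologicalSpace X] [CompactSpace X]

/-- The free profinite module on the profinite space `X`: the inverse limit, over all the finite
quotient spaces `Q` of `X`, of the free modules on `Q`. -/
def FreeModule : Submodule ZHat (∀ Q : DiscreteQuotient X, Q → ZHat) where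
  carrier := {c | ∀ (Q Q' : DiscreteQuotient X) (h : Q ≤ Q') (y : Q'),
    c Q' y = ∑ᶠ x ∈ DiscreteQuotient.ofLE h ⁻¹' {y}, c Q x}
  add_mem' {a b} ha hb Q Q' h y := by
    simp only [Pi.add_apply, ha Q Q' h y, hb Q Q' h y]
    exact (finsum_mem_add_distrib (Set.toFinite _)).symm
  zero_mem' Q Q' h y := by simp
  smul_mem' r a ha Q Q' h y := by
    simp only [Pi.smul_apply, smul_eq_mul, ha Q Q' h y]
    exact mul_finsum_mem' _ _ (Set.toFinite _)

/-- The free profinite module on the pointed profinite space `(X, p)`: the inverse limit, over all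
the finite quotient spaces `Q` of `X`, of the free modules on the pointed sets `(Q, p)`; the
coefficient of the base point is `0`, and the part of a combination that is mapped to the base
point is mapped to `0`. -/
def PointedFreeModule (p : X) : Submodule ZHat (∀ Q : DiscreteQuotient X, Q → ZHat) where
  carrier := {c | (∀ Q : DiscreteQuotient X, c Q (Q.proj p) = 0) ∧
    ∀ (Q Q' : DiscreteQuotient X) (h : Q ≤ Q') (y : Q'), y ≠ Q'.proj p →
      c Q' y = ∑ᶠ x ∈ DiscreteQuotient.ofLE h ⁻¹' {y}, c Q x}
  add_mem' {a b} ha hb := by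
    refine ⟨fun Q => by simp [ha.1 Q, hb.1 Q], fun Q Q' h y hy => ?_⟩
    simp only [Pi.add_apply, ha.2 Q Q' h y hy, hb.2 Q Q' h y hy]
    exact (finsum_mem_add_distrib (Set.toFinite _)).symm
  zero_mem' := ⟨fun Q => rfl, fun Q Q' h y _ => by simp⟩
  smul_mem' r a ha := by
    refine ⟨fun Q => by simp [ha.1 Q], fun Q Q' h y hy => ?_⟩
    simp only [Pi.smul_apply, smul_eq_mul, ha.2 Q Q' h y hy]
    exact mul_finsum_mem' _ _ (Set.toFinite _)

/-- The augmentation `ε`, with `ε x = 1` for every `x` in `X`: the sum of the coefficients. -/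
noncomputable def augmentation : FreeModule X →ₗ[ZHat] ZHat where
  toFun c := ∑ᶠ y : (⊤ : DiscreteQuotient X), c.1 ⊤ y
  map_add' _ _ := finsum_add_distrib (Set.toFinite _) (Set.toFinite _)
  map_smul' _ _ := (mul_finsum' _ _ (Set.toFinite _)).symm

variable {X}

/-- The value at `c` of the continuous linear extension of a locally constant function `f` on the
pointed space `X` (with value `0` at the base point) to the free profinite module: the sum of
`c_r f(r)` over a finite quotient space through which `f` factors. -/
noncomputable def extend (f : LocallyConstant X ZHat) :
    (∀ Q : DiscreteQuotient X, Q → ZHat) →ₗ[ZHat] ZHat where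
  toFun c := ∑ᶠ r : f.discreteQuotient, c f.discreteQuotient r * f.lift r
  map_add' a b := by
    simp only [Pi.add_apply, add_mul]
    exact finsum_add_distrib (Set.toFinite _) (Set.toFinite _)
  map_smul' r a := by
    simp only [Pi.smul_apply, smul_eq_mul, mul_assoc, RingHom.id_apply]
    exact (mul_finsum' _ _ (Set.toFinite _)).symm

theorem extend_eq {p : X} (f : LocallyConstant X ZHat) (hf : f p = 0)
    {c : ∀ Q : DiscreteQuotient X, Q → ZHat} (hc : c ∈ PointedFreeModule X p)
    (R : DiscreteQuotient X) (hR : R ≤ f.discreteQuotient) :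
    extend f c = ∑ᶠ r : R, c R r * f.lift (DiscreteQuotient.ofLE hR r) := by
  classical
  have := Fintype.ofFinite R
  have := Fintype.ofFinite f.discreteQuotient
  change ∑ᶠ r : f.discreteQuotient, c f.discreteQuotient r * f.lift r = _
  rw [finsum_eq_sum_of_fintype, finsum_eq_sum_of_fintype,
    ← Finset.sum_fiberwise Finset.univ (DiscreteQuotient.ofLE hR)]
  refine Finset.sum_congr rfl fun y _ => ?_
  by_cases hy : y = f.discreteQuotient.proj p
  · have h0 : f.lift y = 0 := by rw [hy]; exact hf
    rw [h0, mul_zero]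
    refine (Finset.sum_eq_zero fun x hx => ?_).symm
    rw [(Finset.mem_filter.1 hx).2, h0, mul_zero]
  · rw [hc.2 R _ hR y hy, finsum_mem_eq_finite_toFinset_sum _ (Set.toFinite _), Finset.sum_mul]
    refine Finset.sum_congr (by ext x; simp) fun x hx => ?_
    have hx' : DiscreteQuotient.ofLE hR x = y := by simpa using hx
    rw [hx']

theorem extend_add {p : X} (f g : LocallyConstant X ZHat) (hf : f p = 0) (hg : g p = 0)
    {c : ∀ Q : DiscreteQuotient X, Q → ZHat} (hc : c ∈ PointedFreeModule X p) :
    extend (f + g) c = extend f c + extend g c := by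
  let R := f.discreteQuotient ⊓ g.discreteQuotient
  have hfR : R ≤ f.discreteQuotient := inf_le_left
  have hgR : R ≤ g.discreteQuotient := inf_le_right
  have hR : R ≤ (f + g).discreteQuotient := fun x y h =>
    congrArg₂ (· + ·) (hfR h) (hgR h)
  rw [extend_eq f hf hc R hfR, extend_eq g hg hc R hgR,
    extend_eq (f + g) (by simp [hf, hg]) hc R hR,
    ← finsum_add_distrib (Set.toFinite _) (Set.toFinite _)]
  refine finsum_congr fun r => ?_
  obtain ⟨x, rfl⟩ := R.proj_surjective r
  rw [← mul_add]
  rfl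

theorem extend_zero (c : ∀ Q : DiscreteQuotient X, Q → ZHat) :
    extend (0 : LocallyConstant X ZHat) c = 0 := by
  refine (finsum_congr fun r => ?_).trans finsum_zero
  obtain ⟨x, rfl⟩ := DiscreteQuotient.proj_surjective _ r
  exact mul_zero _

theorem extend_sum {p : X} {ι : Type*} (s : Finset ι) (f : ι → LocallyConstant X ZHat)
    (hf : ∀ i, f i p = 0) {c : ∀ Q : DiscreteQuotient X, Q → ZHat}
    (hc : c ∈ PointedFreeModule X p) :
    extend (∑ i ∈ s, f i) c = ∑ i ∈ s, extend (f i) c := by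
  classical
  have hs (s : Finset ι) : (∑ i ∈ s, f i) p = 0 := by
    induction s using Finset.induction_on with
    | empty => rfl
    | insert a s ha ih => rw [Finset.sum_insert ha, LocallyConstant.add_apply, hf, ih, add_zero]
  induction s using Finset.induction_on with
  | empty => simp [extend_zero]
  | insert a s ha ih =>
    rw [Finset.sum_insert ha, Finset.sum_insert ha, extend_add _ _ (hf a) (hs s) hc, ih]

end FreeModules

/-! ### Profinite trees -/

/-- The structure of a profinite graph on a profinite space `T`. The edges are the elements of `T`
that are not vertices. -/
structure ProfiniteGraph (T : Type u) [TopologicalSpace T] where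
  /-- the set of vertices -/
  V : Set T
  isClosed_V : IsClosed V
  nonempty_V : V.Nonempty
  d₀ : T → V
  d₁ : T → V
  continuous_d₀ : Continuous d₀
  continuous_d₁ : Continuous d₁
  d₀_vertex : ∀ v : V, d₀ v = v
  d₁_vertex : ∀ v : V, d₁ v = v

namespace ProfiniteGraph

variable {T : Type u} [TopologicalSpace T] (Γ : ProfiniteGraph T)

/-- The equivalence relation on `T` that identifies all the vertices. -/
def vertexSetoid : Setoid T where
  r x y := x = y ∨ (x ∈ Γ.V ∧ y ∈ Γ.V)
  iseqv := by
    refine ⟨fun x => Or.inl rfl, ?_, ?_⟩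
    · rintro x y (h | h)
      · exact Or.inl h.symm
      · exact Or.inr h.symm
    · rintro x y z (rfl | h) (rfl | h')
      · exact Or.inl rfl
      · exact Or.inr h'
      · exact Or.inr h
      · exact Or.inr ⟨h.1, h'.2⟩

/-- The quotient space of `T` modulo the subspace of vertices. -/
abbrev EStar : Type u := Quotient Γ.vertexSetoid

/-- The base point of the quotient space, the class of the vertices. -/
noncomputable def base : Γ.EStar := Quotient.mk _ Γ.nonempty_V.some

/-- For a locally constant function `f` on the vertices, the function `e ↦ f (d₁ e) - f (d₀ e)`
on the quotient space. -/
def coboundary (f : LocallyConstant Γ.V ZHat) : LocallyConstant Γ.EStar ZHat where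
  toFun := Quotient.lift (fun e => f (Γ.d₁ e) - f (Γ.d₀ e)) (by
    rintro x y (rfl | ⟨hx, hy⟩)
    · rfl
    · rw [Γ.d₀_vertex ⟨x, hx⟩, Γ.d₁_vertex ⟨x, hx⟩, Γ.d₀_vertex ⟨y, hy⟩, Γ.d₁_vertex ⟨y, hy⟩,
        sub_self, sub_self])
  isLocallyConstant := fun s => by
    rw [isOpen_coinduced]
    exact ((f.isLocallyConstant.comp_continuous Γ.continuous_d₁).sub
      (f.isLocallyConstant.comp_continuous Γ.continuous_d₀)) s

theorem coboundary_base (f : LocallyConstant Γ.V ZHat) : Γ.coboundary f Γ.base = 0 := by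
  change f (Γ.d₁ Γ.nonempty_V.some) - f (Γ.d₀ Γ.nonempty_V.some) = 0
  rw [Γ.d₀_vertex ⟨_, Γ.nonempty_V.some_mem⟩, Γ.d₁_vertex ⟨_, Γ.nonempty_V.some_mem⟩, sub_self]

theorem coboundary_add (f g : LocallyConstant Γ.V ZHat) :
    Γ.coboundary (f + g) = Γ.coboundary f + Γ.coboundary g := by
  ext x : 1
  induction x using Quotient.inductionOn with
  | h x => exact add_sub_add_comm _ _ _ _

theorem coboundary_zero : Γ.coboundary 0 = 0 := by
  have h := Γ.coboundary_add 0 0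
  rwa [add_zero, left_eq_add] at h

theorem coboundary_sum {ι : Type*} (s : Finset ι) (f : ι → LocallyConstant Γ.V ZHat) :
    Γ.coboundary (∑ i ∈ s, f i) = ∑ i ∈ s, Γ.coboundary (f i) := by
  classical
  induction s using Finset.induction_on with
  | empty => simp [coboundary_zero]
  | insert a s ha ih => rw [Finset.sum_insert ha, Finset.sum_insert ha, coboundary_add, ih]

variable [CompactSpace T]

instance : CompactSpace Γ.V := isCompact_iff_compactSpace.1 Γ.isClosed_V.isCompact

/-- The free profinite module on the pointed profinite space of edges. -/
noncomputable abbrev EdgeModule : Submodule ZHat (∀ Q : DiscreteQuotient Γ.EStar, Q → ZHat) :=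
  PointedFreeModule Γ.EStar Γ.base

/-- The free profinite module on the profinite space of vertices. -/
abbrev VertexModule : Submodule ZHat (∀ Q : DiscreteQuotient Γ.V, Q → ZHat) :=
  FreeModule Γ.V

theorem boundary_mem (c : Γ.EdgeModule) :
    (fun (Q : DiscreteQuotient Γ.V) (y : Q) =>
      extend (Γ.coboundary (LocallyConstant.charFn ZHat (Q.isClopen_preimage {y}))) c.1) ∈
      FreeModule Γ.V := by
  classical
  intro Q Q' h y
  rw [finsum_mem_eq_finite_toFinset_sum _ (Set.toFinite _),
    ← extend_sum _ _ (fun _ => Γ.coboundary_base _) c.2, ← Γ.coboundary_sum]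
  have key : LocallyConstant.charFn ZHat (Q'.isClopen_preimage {y}) =
      ∑ x ∈ (Set.toFinite (DiscreteQuotient.ofLE h ⁻¹' {y})).toFinset,
        LocallyConstant.charFn ZHat (Q.isClopen_preimage {x}) := by
    ext v : 1
    rw [← LocallyConstant.coeFnAddMonoidHom_apply (∑ x ∈ _, _), map_sum, Finset.sum_apply]
    simp only [LocallyConstant.coeFnAddMonoidHom_apply, LocallyConstant.coe_charFn,
      Set.indicator_apply, Set.mem_preimage, Set.mem_singleton_iff, Pi.one_apply]
    rw [Finset.sum_ite_eq]
    simp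
  exact congrArg (fun g => extend (Γ.coboundary g) c.1) key

/-- The boundary map `d`, with `d e = d₁ e - d₀ e` for every edge `e`: for a finite quotient space
`Q` of the space of vertices and `y` in `Q`, the coefficient of `d e` at `y` is
`[d₁ e ∈ y] - [d₀ e ∈ y]`, and this is extended continuously and linearly. -/
noncomputable def boundary : Γ.EdgeModule →ₗ[ZHat] Γ.VertexModule where
  toFun c := ⟨fun Q y =>
    extend (Γ.coboundary (LocallyConstant.charFn ZHat (Q.isClopen_preimage {y}))) c.1,
    Γ.boundary_mem c⟩
  map_add' a b := Subtype.ext (funext fun _ => funext fun _ => (extend _).map_add a.1 b.1)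
  map_smul' r a := Subtype.ext (funext fun _ => funext fun _ => (extend _).map_smul r a.1)

/-- A profinite graph is a profinite tree if the sequence
`0 → EdgeModule → VertexModule → ZHat → 0` is exact. -/
def IsTree : Prop :=
  Function.Injective Γ.boundary ∧ Function.Exact Γ.boundary (augmentation Γ.V) ∧
    Function.Surjective (augmentation Γ.V)

end ProfiniteGraph

/-- A topological group `P` is an OE-group (in the profinite sense) if, whenever it acts
continuously on a profinite tree with finite edge stabilizers, it fixes a vertex. -/
def ProfiniteOE (P : Type u) [Group P] [TopologicalSpace P] : Prop :=
  ∀ (T : Type u) [TopologicalSpace T] [CompactSpace T] [T2Space T] [TotallyDisconnectedSpace T]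
    [MulAction P T] [ContinuousSMul P T] (Γ : ProfiniteGraph T), Γ.IsTree →
    (∀ (g : P) (x : T), (Γ.d₀ (g • x) : T) = g • (Γ.d₀ x : T)) →
    (∀ (g : P) (x : T), (Γ.d₁ (g • x) : T) = g • (Γ.d₁ x : T)) →
    (∀ e, e ∉ Γ.V → Finite (MulAction.stabilizer P e)) →
    ∃ v ∈ Γ.V, ∀ g : P, g • v = v

/-! ### The class of groups -/

/-- The defining condition of the class `𝒜`, for a group `G` and a class `C` in the place of `𝒜`:
`G` is finitely generated, residually finite and accessible; if `G` is a (non-fictitious)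
amalgamated free product or an HNN-extension over a finite group then the factors, respectively the
base group, are in `C`; if `G` is one-ended, then its profinite completion has a global fixed point
whenever it acts on a profinite tree with finite edge stabilizers. -/
structure Condition (C : ∀ (G : Type u) [Group G], Prop) (G : Type u) [Group G] : Prop where
  fg : Group.FG G
  residuallyFinite : Group.ResiduallyFinite G
  accessible : Accessible G
  amalgam : ∀ (K : Fin 2 → Type u) [∀ i, Group (K i)] (H : Type u) [Group H] [Finite H]
    (φ : ∀ i, H →* K i), (∀ i, Function.Injective (φ i)) → (∀ i, ¬ Function.Surjective (φ i)) →
    Nonempty (G ≃* Monoid.PushoutI φ) → ∀ i, C (K i)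
  hnn : ∀ (K : Type u) [Group K] (A B : Subgroup K) (φ : A ≃* B), Finite A →
    Nonempty (G ≃* HNNExtension K A B φ) → C K
  oneEnded : OneEnded G →
    ProfiniteOE (ProfiniteGrp.ProfiniteCompletion.completion (GrpCat.of G))

/-- The class `𝒜`: the largest class of groups all of whose members satisfy the defining condition
with respect to the class itself. -/
def ClassA (G : Type u) [Group G] : Prop :=
  ∃ C : ∀ (G : Type u) [Group G], Prop,
    (∀ (G : Type u) [Group G], C G → Condition C G) ∧ C G

/-- The class `𝒜` satisfies its self-referential description. -/
theorem classA_iff (G : Type u) [Group G] : ClassA G ↔ Condition ClassA G := by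
  have mono {C D : ∀ (G : Type u) [Group G], Prop} (h : ∀ (G : Type u) [Group G], C G → D G)
      (G : Type u) [Group G] (hG : Condition C G) : Condition D G :=
    { hG with
      amalgam := fun K _ H _ _ φ h₁ h₂ e i => h _ (hG.amalgam K H φ h₁ h₂ e i)
      hnn := fun K _ A B φ h₁ e => h _ (hG.hnn K A B φ h₁ e) }
  have key (G : Type u) [Group G] (h : ClassA G) : Condition ClassA G := by
    obtain ⟨C, hC, hG⟩ := h
    exact mono (fun K _ hK => ⟨C, hC, hK⟩) G (hC G hG)
  exact ⟨key G, fun h => ⟨Condition ClassA, fun K _ hK => mono key K hK, h⟩⟩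

end FiniteSplitting

/-! `ClassA` is a greatest fixed point, so membership is proved by coinduction: it suffices to find
a class that contains the given groups and satisfies `Condition` relative to itself. That class is
`ActsOnTree`: groups acting on a tree, preserving edge orientation, with finitely many edge orbits,
finite edge stabilizers, and vertex stabilizers that are finite or isomorphic to members of
`ClassA`. The Bass–Serre trees of an amalgam and of an HNN-extension put these groups in it. Finite
stabilizers are admitted because they arise from fictitious splittings and when members are cut
further.

Bass–Serre theory is obtained without normal forms. A locally injective map from a connected graph
to a tree is injective on vertices (`IsTree.injective_of_locally_injective`); this yields the
presentation of a group acting on a tree (`Transversal.universal`). Conversely, the coset graph of a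
group with the universal property is a tree, because an affine action produces for each edge a
function that jumps only there (`Splitting.isTree`).

Stability under splitting: let G act on A as required and on another tree T with finite edge
stabilizers, and let H be the stabilizer of a vertex v of T. Then H is finitely generated, so it has
a cofinite subtree in A, with vertex stabilizers H ∩ G_w. Each of these is the stabilizer of v in
G_w acting on T. Hence it is enough that `FiniteOrA` passes to vertex stabilizers. This follows by
collapsing all edge orbits but one, reading off an amalgam or HNN-extension, and inducting.

One-endedness: a one-ended group acting cofinitely with finite edge stabilizers fixes a vertex
(`GTree.Cofinite.not_oneEnded`), so it is itself a vertex stabilizer, and the profinite condition is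
inherited.

Residual finiteness: elements fixing a vertex are detected by finite permutation representations
glued from finite quotients of the vertex groups. For the others, a parity argument on edge
crossings gives a finite-index subgroup that avoids them.

Accessibility: reduced graphs of groups correspond to reduced trees T. Blow up the vertices of A by
T and reduce the fibres over A; the result has a number of vertex orbits bounded by the
accessibility of the vertex groups, and its vertex groups are elliptic in T. Blowing up T in turn by
this tree and reducing gives a tree of bounded size that controls T (`GTree.Cofinite.exists_bound`).
A finite generating set bounds the number of loops in all the quotient graphs. -/

namespace FiniteSplitting

/-! ### Trees as graphs with oriented edges -/

section Trees

variable {V E : Type*} (d₀ d₁ : E → V)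

/-- Two vertices are joined by an undirected edge path with all edges in `D`. -/
def Link (D : Set E) : V → V → Prop :=
  Relation.EqvGen fun v w => ∃ e ∈ D, d₀ e = v ∧ d₁ e = w

/-- A tree: a connected non-empty graph all of whose edges are bridges. -/
structure IsTree : Prop where
  nonempty : Nonempty V
  connected : ∀ v w, Link d₀ d₁ Set.univ v w
  bridge : ∀ e, ¬ Link d₀ d₁ {e}ᶜ (d₀ e) (d₁ e)

/-- The edge `e` joins `x` and `y`. -/
def Inc (e : E) (x y : V) : Prop := (d₀ e = x ∧ d₁ e = y) ∨ (d₀ e = y ∧ d₁ e = x)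

/-- The side of the edge `e` that contains its terminal vertex. -/
def Side (e : E) (v : V) : Prop := Link d₀ d₁ {e}ᶜ (d₁ e) v

/-- The edges that separate two vertices. -/
def Sep (x y : V) : Set E := {e | ¬ (Side d₀ d₁ e x ↔ Side d₀ d₁ e y)}

/-- The number of edges that separate two vertices. -/
noncomputable def tdist (x y : V) : ℕ := (Sep d₀ d₁ x y).ncard

variable {d₀ d₁}

namespace Link

variable {D D' : Set E} {x y z : V}

theorem refl (x : V) : Link d₀ d₁ D x x := Relation.EqvGen.refl x

theorem symm (h : Link d₀ d₁ D x y) : Link d₀ d₁ D y x := Relation.EqvGen.symm _ _ h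

theorem trans (h : Link d₀ d₁ D x y) (h' : Link d₀ d₁ D y z) : Link d₀ d₁ D x z :=
  Relation.EqvGen.trans _ _ _ h h'

theorem edge {e : E} (he : e ∈ D) : Link d₀ d₁ D (d₀ e) (d₁ e) :=
  Relation.EqvGen.rel _ _ ⟨e, he, rfl, rfl⟩

theorem of_inc {e : E} (he : e ∈ D) (h : Inc d₀ d₁ e x y) : Link d₀ d₁ D x y := by
  rcases h with ⟨rfl, rfl⟩ | ⟨rfl, rfl⟩
  · exact edge he
  · exact (edge he).symm

/-- A relation that is an equivalence and contains the edges contains `Link`. -/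
theorem lift {r : V → V → Prop} (hr : Equivalence r) (he : ∀ e ∈ D, r (d₀ e) (d₁ e))
    (h : Link d₀ d₁ D x y) : r x y := by
  induction h with
  | rel x y h => obtain ⟨e, heD, rfl, rfl⟩ := h; exact he e heD
  | refl x => exact hr.refl x
  | symm x y _ ih => exact hr.symm ih
  | trans x y z _ _ h₁ h₂ => exact hr.trans h₁ h₂

/-- A property that is invariant along the edges propagates along paths. -/
theorem propagate {P : V → Prop} (hP : ∀ e ∈ D, (P (d₀ e) ↔ P (d₁ e)))
    (h : Link d₀ d₁ D x y) : P x ↔ P y :=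
  lift (r := fun a b => P a ↔ P b) ⟨fun _ => Iff.rfl, Iff.symm, Iff.trans⟩ hP h

theorem map {V' E' : Type*} {d₀' d₁' : E' → V'} {D' : Set E'} (f : V → V')
    (he : ∀ e ∈ D, Link d₀' d₁' D' (f (d₀ e)) (f (d₁ e))) (h : Link d₀ d₁ D x y) :
    Link d₀' d₁' D' (f x) (f y) :=
  lift (r := fun a b => Link d₀' d₁' D' (f a) (f b))
    ⟨fun _ => refl _, fun h => h.symm, fun h h' => h.trans h'⟩ he h

theorem mono (hD : D ⊆ D') (h : Link d₀ d₁ D x y) : Link d₀ d₁ D' x y :=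
  h.map id fun _ he => edge (hD he)

end Link

theorem Inc.symm {e : E} {x y : V} (h : Inc d₀ d₁ e x y) : Inc d₀ d₁ e y x := Or.symm h

theorem inc_self (e : E) : Inc d₀ d₁ e (d₀ e) (d₁ e) := Or.inl ⟨rfl, rfl⟩

theorem side_d₁ (e : E) : Side d₀ d₁ e (d₁ e) := Link.refl _

theorem side_congr {e f : E} (h : f ≠ e) : Side d₀ d₁ e (d₀ f) ↔ Side d₀ d₁ e (d₁ f) :=
  ⟨fun h' => h'.trans (Link.edge h), fun h' => h'.trans (Link.edge h).symm⟩

theorem mem_sep {e : E} {x y : V} :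
    e ∈ Sep d₀ d₁ x y ↔ ¬ (Side d₀ d₁ e x ↔ Side d₀ d₁ e y) := Iff.rfl

theorem sep_self (x : V) : Sep d₀ d₁ x x = ∅ := by ext; simp [mem_sep]

theorem sep_comm (x y : V) : Sep d₀ d₁ x y = Sep d₀ d₁ y x := by
  ext e; rw [mem_sep, mem_sep, not_iff_not]; exact Iff.comm

theorem sep_subset_union (x y z : V) : Sep d₀ d₁ x z ⊆ Sep d₀ d₁ x y ∪ Sep d₀ d₁ y z := by
  intro e h
  simp only [Set.mem_union, mem_sep] at *
  tauto

theorem Link.sep_subset {D : Set E} {x y : V} (h : Link d₀ d₁ D x y) : Sep d₀ d₁ x y ⊆ D := by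
  intro e he
  by_contra hD
  exact he (h.propagate fun f hf => side_congr fun hfe => hD (hfe ▸ hf))

namespace IsTree

variable (hT : IsTree d₀ d₁)
include hT

theorem not_side_d₀ (e : E) : ¬ Side d₀ d₁ e (d₀ e) := fun h => hT.bridge e h.symm

theorem sep_edge (e : E) : Sep d₀ d₁ (d₀ e) (d₁ e) = {e} := by
  ext f
  rw [mem_sep, Set.mem_singleton_iff]
  by_cases h : f = e
  · subst h; simp [hT.not_side_d₀, side_d₁]
  · simp [h, side_congr (d₀ := d₀) (d₁ := d₁) (Ne.symm h)]

theorem sep_inc {e : E} {x y : V} (h : Inc d₀ d₁ e x y) : Sep d₀ d₁ x y = {e} := by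
  rcases h with ⟨rfl, rfl⟩ | ⟨rfl, rfl⟩
  · exact hT.sep_edge e
  · rw [sep_comm]; exact hT.sep_edge e

theorem inc_ne {e : E} {x y : V} (h : Inc d₀ d₁ e x y) : x ≠ y := by
  rintro rfl
  have := hT.sep_inc h
  rw [sep_self] at this
  exact absurd this.symm (Set.singleton_ne_empty e)

theorem inc_right_unique {e : E} {x y z : V} (h : Inc d₀ d₁ e x y) (h' : Inc d₀ d₁ e x z) :
    y = z := by
  have := hT.inc_ne (inc_self e)
  rcases h with ⟨rfl, rfl⟩ | ⟨rfl, rfl⟩ <;> rcases h' with ⟨h₁, h₂⟩ | ⟨h₁, h₂⟩ <;>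
    first | exact h₂ | exact h₁ | exact absurd h₁ this | exact absurd h₂.symm this

/-- Separation is disagreement of truth values, hence additive modulo 2, so crossing `e` toggles
exactly `e`. -/
theorem mem_sep_step {e f : E} {x x' : V} (h : Inc d₀ d₁ e x x') (y : V) :
    f ∈ Sep d₀ d₁ x' y ↔ ¬ (f ∈ Sep d₀ d₁ x y ↔ f = e) := by
  have : f ∈ Sep d₀ d₁ x x' ↔ f = e := by rw [hT.sep_inc h]; rfl
  rw [← this]
  simp only [mem_sep]
  tauto

theorem sep_finite (x y : V) : (Sep d₀ d₁ x y).Finite := by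
  refine ((hT.connected x y).propagate (P := fun y => (Sep d₀ d₁ x y).Finite) ?_).1
    (by rw [sep_self]; exact Set.finite_empty)
  intro e _
  constructor
  · exact fun h => (h.union ((Set.finite_singleton e).subset (hT.sep_edge e).subset)).subset
      (sep_subset_union _ _ _)
  · refine fun h => (h.union (Set.Finite.subset (Set.finite_singleton e) ?_)).subset
      (sep_subset_union _ (d₁ e) _)
    rw [sep_comm]; exact (hT.sep_edge e).subset

/-- The first edge on the way from `x` to another vertex `y`. -/
theorem exists_step {x y : V} (hxy : x ≠ y) :
    ∃ e x', Inc d₀ d₁ e x x' ∧ e ∈ Sep d₀ d₁ x y := by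
  -- The property is carried along a path of targets. If the chosen edge differs from the crossed
  -- edge it still separates; if it is the crossed edge, the target has returned to `x`.
  have key {P : V → Prop} (hP : P = fun y => x = y ∨ ∃ e x', Inc d₀ d₁ e x x' ∧
      e ∈ Sep d₀ d₁ x y) {f : E} {y y' : V} (hf : Inc d₀ d₁ f y y') (h : P y) : P y' := by
    subst hP
    rcases h with rfl | ⟨e, x', he, hs⟩
    · exact Or.inr ⟨f, y', hf, by rw [hT.sep_inc hf]; rfl⟩
    by_cases hef : e = f
    · left
      subst hef
      have h1 : e ∉ Sep d₀ d₁ x y' := by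
        rw [sep_comm, hT.mem_sep_step hf, sep_comm]; simp [hs]
      by_contra hne
      have : x' = y' := by
        have hx : e ∉ Sep d₀ d₁ y x' := by
          rw [sep_comm, hT.mem_sep_step he]; simp [hs]
        rcases he with ⟨rfl, rfl⟩ | ⟨rfl, rfl⟩ <;> rcases hf with ⟨rfl, rfl⟩ | ⟨rfl, rfl⟩
        · rfl
        · exact absurd rfl hne
        · exact absurd rfl hne
        · rfl
      subst this
      rw [hT.sep_inc he] at h1
      exact h1 rfl
    · refine Or.inr ⟨e, x', he, ?_⟩
      rw [sep_comm, hT.mem_sep_step hf, sep_comm]; simp [hs, hef]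
  have := ((hT.connected x y).propagate (P := fun y => x = y ∨ ∃ e x', Inc d₀ d₁ e x x' ∧
      e ∈ Sep d₀ d₁ x y) fun f _ => ⟨key rfl (inc_self f), key rfl (inc_self f).symm⟩).1
      (Or.inl rfl)
  exact this.resolve_left hxy

theorem eq_of_sep_eq_empty {x y : V} (h : Sep d₀ d₁ x y = ∅) : x = y := by
  by_contra hne
  obtain ⟨e, -, -, he⟩ := hT.exists_step hne
  rw [h] at he
  exact he

theorem tdist_eq_zero {x y : V} : tdist d₀ d₁ x y = 0 ↔ x = y := by
  rw [tdist, Set.ncard_eq_zero (hT.sep_finite x y)]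
  exact ⟨hT.eq_of_sep_eq_empty, fun h => h ▸ sep_self x⟩

theorem sep_step {e : E} {x x' y : V} (h : Inc d₀ d₁ e x x') (he : e ∈ Sep d₀ d₁ x y) :
    Sep d₀ d₁ x' y = Sep d₀ d₁ x y \ {e} := by
  ext f
  rw [hT.mem_sep_step h, Set.mem_sdiff, Set.mem_singleton_iff]
  by_cases hf : f = e
  · subst hf; simp [he]
  · simp [hf]

theorem sep_step_of_notMem {e : E} {x x' y : V} (h : Inc d₀ d₁ e x x')
    (he : e ∉ Sep d₀ d₁ x y) : Sep d₀ d₁ x' y = insert e (Sep d₀ d₁ x y) := by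
  ext f
  rw [hT.mem_sep_step h, Set.mem_insert_iff]
  by_cases hf : f = e
  · subst hf; simp [he]
  · simp [hf]

theorem tdist_step {e : E} {x x' y : V} (h : Inc d₀ d₁ e x x') (he : e ∈ Sep d₀ d₁ x y) :
    tdist d₀ d₁ x' y + 1 = tdist d₀ d₁ x y := by
  rw [tdist, hT.sep_step h he, tdist, Set.ncard_sdiff_singleton_add_one he (hT.sep_finite x y)]

theorem tdist_step_of_notMem {e : E} {x x' y : V} (h : Inc d₀ d₁ e x x')
    (he : e ∉ Sep d₀ d₁ x y) : tdist d₀ d₁ x' y = tdist d₀ d₁ x y + 1 := by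
  rw [tdist, hT.sep_step_of_notMem h he, tdist, Set.ncard_insert_of_notMem he (hT.sep_finite x y)]

theorem link_sep (x y : V) : Link d₀ d₁ (Sep d₀ d₁ x y) x y := by
  induction hn : tdist d₀ d₁ x y generalizing x with
  | zero => rw [hT.tdist_eq_zero.1 hn]; exact Link.refl y
  | succ n ih =>
    have hne : x ≠ y := fun h => by rw [hT.tdist_eq_zero.2 h] at hn; cases hn
    obtain ⟨e, x', hx, he⟩ := hT.exists_step hne
    refine (Link.of_inc he hx).trans ((ih x' ?_).mono ?_)
    · have := hT.tdist_step hx he; omega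
    · rw [hT.sep_step hx he]; exact Set.sdiff_subset

/-- At `y` there is only one edge that leads to `x`. -/
theorem step_unique {e e' : E} {x y a b : V} (h : Inc d₀ d₁ e y a) (h' : Inc d₀ d₁ e' y b)
    (he : e ∈ Sep d₀ d₁ x y) (he' : e' ∈ Sep d₀ d₁ x y) : e = e' := by
  -- Uniqueness is carried along a path of `x` starting at `y`, where nothing separates. An edge at
  -- `y` begins to separate only when `x` leaves `y` through it, and then it is the only separating
  -- edge.
  have key {f : E} {x x' : V} (hf : Inc d₀ d₁ f x x')
      (ih : e ∈ Sep d₀ d₁ x y → e' ∈ Sep d₀ d₁ x y → e = e') :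
      e ∈ Sep d₀ d₁ x' y → e' ∈ Sep d₀ d₁ x' y → e = e' := by
    intro h1 h2
    rw [hT.mem_sep_step hf] at h1 h2
    have hxy {g c} (hg : Inc d₀ d₁ g y c) (hgf : g = f) (hs : g ∉ Sep d₀ d₁ x y) : x = y := by
      subst hgf
      rcases hg with ⟨rfl, rfl⟩ | ⟨rfl, rfl⟩ <;> rcases hf with ⟨rfl, rfl⟩ | ⟨rfl, rfl⟩
      · rfl
      · exact absurd (by rw [sep_comm, hT.sep_edge]; rfl) hs
      · exact absurd (by rw [hT.sep_edge]; rfl) hs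
      · rfl
    by_cases h3 : e = f
    · by_cases h4 : e' = f
      · rw [h3, h4]
      · have hx := hxy h h3 (by simpa [h3] using h1)
        subst hx
        rw [sep_self] at h2
        simp [h4] at h2
    · by_cases h4 : e' = f
      · have hx := hxy h' h4 (by simpa [h4] using h2)
        subst hx
        rw [sep_self] at h1
        simp [h3] at h1
      · exact ih (by simpa [h3] using h1) (by simpa [h4] using h2)
  refine ((hT.connected y x).propagate (P := fun x => e ∈ Sep d₀ d₁ x y → e' ∈ Sep d₀ d₁ x y →
    e = e') fun f _ =>
    Iff.intro (key (inc_self f)) (key (inc_self f).symm)).1 ?_ he he'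
  rw [sep_self]
  exact fun h => h.elim

omit hT in
theorem link_side {e : E} {x z : V} (h : Link d₀ d₁ {e}ᶜ x z) :
    Link d₀ d₁ {f | f ≠ e ∧ (Side d₀ d₁ e (d₀ f) ↔ Side d₀ d₁ e x)} x z := by
  have hs {w} (h : Link d₀ d₁ {f | f ≠ e ∧ (Side d₀ d₁ e (d₀ f) ↔ Side d₀ d₁ e x)} x w) :
      Side d₀ d₁ e x ↔ Side d₀ d₁ e w := h.propagate fun f hf => side_congr hf.1
  refine (h.propagate (P := fun w =>
    Link d₀ d₁ {f | f ≠ e ∧ (Side d₀ d₁ e (d₀ f) ↔ Side d₀ d₁ e x)} x w) fun f hf => ?_).1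
    (Link.refl _)
  constructor
  · intro h
    refine h.trans (Link.edge ?_)
    exact ⟨hf, (hs h).symm⟩
  · intro h
    refine h.trans (Link.symm (Link.edge ?_))
    exact ⟨hf, (side_congr hf).trans (hs h).symm⟩

theorem link_of_side_iff {e : E} {x y : V} (h : Side d₀ d₁ e x ↔ Side d₀ d₁ e y) :
    Link d₀ d₁ {e}ᶜ x y :=
  (hT.link_sep x y).mono fun f hf => by rintro rfl; exact hf h

/-- If `e` is on the way from `x` to `y` and `z` is its end point on the side of `x`, then
`z` is between `x` and `y`. -/
theorem sep_subset_of_mem {e : E} {x y z z' : V} (he : e ∈ Sep d₀ d₁ x y)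
    (hz : Inc d₀ d₁ e z z') (hx : e ∉ Sep d₀ d₁ x z) :
    Sep d₀ d₁ x z ⊆ Sep d₀ d₁ x y \ {e} := by
  intro f hf
  have hfe : f ≠ e := by rintro rfl; exact hx hf
  refine ⟨?_, hfe⟩
  by_contra hfy
  have hzz' : f ∉ Sep d₀ d₁ z z' := by rw [hT.sep_inc hz]; exact hfe
  have hez : e ∈ Sep d₀ d₁ z z' := by rw [hT.sep_inc hz]; rfl
  rw [mem_sep] at he hez
  rw [mem_sep, not_not] at hx hfy hzz'
  -- If `f` did not separate `x` from `y`, it would separate `x` from `z` and also `z'` from `y`.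
  -- The first puts `f` on the near side of `e`, the second on the far side.
  have h1 := (link_side (hT.link_of_side_iff hx)).sep_subset hf
  have h2 : f ∈ Sep d₀ d₁ z' y := by rw [mem_sep] at hf ⊢; grind
  have h3 := (link_side (hT.link_of_side_iff (e := e) (x := z') (y := y) (by grind))).sep_subset h2
  have h4 := h1.2
  have h5 := h3.2
  grind

/-- A locally injective map from a connected graph to a tree is injective. -/
theorem injective_of_locally_injective {V' E' : Type*} {d₀' d₁' : E' → V'} (fV : V' → V)
    (fE : E' → E) (h₀ : ∀ e, fV (d₀' e) = d₀ (fE e)) (h₁ : ∀ e, fV (d₁' e) = d₁ (fE e))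
    (i₀ : ∀ e e', fE e = fE e' → d₀' e = d₀' e' → e = e')
    (i₁ : ∀ e e', fE e = fE e' → d₁' e = d₁' e' → e = e') {D : Set E'} {a b : V'}
    (hab : Link d₀' d₁' D a b) (h : fV a = fV b) : a = b := by
  have hinc {e x y} (hi : Inc d₀' d₁' e x y) : Inc d₀ d₁ (fE e) (fV x) (fV y) := by
    rcases hi with ⟨rfl, rfl⟩ | ⟨rfl, rfl⟩
    · exact Or.inl ⟨(h₀ e).symm, (h₁ e).symm⟩
    · exact Or.inr ⟨(h₀ e).symm, (h₁ e).symm⟩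
  -- `Q n b`: a walk of length `n` leads from `a` to `b`, and its image moves away from `fV a` at
  -- every step. If the next edge moves back, `step_unique` and local injectivity make it the last
  -- edge of the walk, so the walk just shortens.
  let Q : ℕ → V' → Prop := fun n => Nat.rec (fun b => a = b) (fun _ q b => ∃ e c, q c ∧
      Inc d₀' d₁' e c b ∧ fE e ∉ Sep d₀ d₁ (fV a) (fV c)) n
  have key {f x y} (hf : Inc d₀' d₁' f x y) : (∃ n, Q n x) → ∃ n, Q n y := by
    rintro ⟨n, hn⟩
    by_cases hs : fE f ∈ Sep d₀ d₁ (fV a) (fV x)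
    · cases n with
      | zero =>
        have : a = x := hn
        subst this
        rw [sep_self] at hs
        exact hs.elim
      | succ n =>
        obtain ⟨e, c, hc, hi, hns⟩ := hn
        have h1 : fE e ∈ Sep d₀ d₁ (fV a) (fV x) := by
          rw [sep_comm, hT.mem_sep_step (hinc hi), sep_comm]; simp [hns]
        have h2 := hT.step_unique (hinc hi).symm (hinc hf) h1 hs
        have h3 : e = f := by
          have hne := hT.inc_ne (hinc hf)
          rcases hi with ⟨rfl, rfl⟩ | ⟨rfl, rfl⟩ <;> rcases hf with ⟨h4, rfl⟩ | ⟨rfl, h4⟩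
          · exact absurd (by rw [h₁, h₁, h2]) hne
          · exact i₁ _ _ h2 h4.symm
          · exact i₀ _ _ h2 h4.symm
          · exact absurd (by rw [h₀, h₀, h2]) hne
        subst h3
        refine ⟨n, ?_⟩
        convert! hc
        have hne := hT.inc_ne (hinc hf)
        rcases hi with ⟨h5, h6⟩ | ⟨h5, h6⟩ <;> rcases hf with ⟨h7, h8⟩ | ⟨h7, h8⟩
        · exact absurd (by rw [← h6, h8]) hne
        · rw [← h5, ← h7]
        · rw [← h6, ← h8]
        · exact absurd (by rw [← h5, h7]) hne
    · exact ⟨n + 1, f, x, hn, hf, hs⟩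
  obtain ⟨n, hn⟩ := (hab.propagate (P := fun b => ∃ n, Q n b) fun f _ =>
    ⟨key (inc_self f), key (inc_self f).symm⟩).1 ⟨0, rfl⟩
  cases n with
  | zero => exact hn
  | succ n =>
    obtain ⟨e, c, hc, hi, hns⟩ := hn
    have h1 : fE e ∈ Sep d₀ d₁ (fV a) (fV b) := by
      rw [sep_comm, hT.mem_sep_step (hinc hi), sep_comm]; simp [hns]
    rw [h, sep_self] at h1
    exact h1.elim

/-- On a tree every function on the edges is the coboundary of a function on the vertices. -/
theorem exists_potential {M : Type*} [Group M] (s : E → M) :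
    ∃ γ : V → M, ∀ e, γ (d₁ e) = γ (d₀ e) * s e := by
  obtain ⟨v₀⟩ := hT.nonempty
  -- This is the covering graph with fibre `M` twisted by `s`. Its projection is locally injective,
  -- so the component of `(v₀, 1)` meets each fibre once and is the graph of the potential.
  let d₀' : E × M → V × M := fun e => (d₀ e.1, e.2)
  let d₁' : E × M → V × M := fun e => (d₁ e.1, e.2 * s e.1)
  have hex (v : V) : ∃ m, Link d₀' d₁' Set.univ (v₀, 1) (v, m) := by
    refine ((hT.connected v₀ v).propagate
      (P := fun v => ∃ m, Link d₀' d₁' Set.univ (v₀, 1) (v, m)) fun e _ => ⟨?_, ?_⟩).1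
      ⟨1, Link.refl _⟩
    · rintro ⟨m, hm⟩
      exact ⟨m * s e, hm.trans (Link.edge (e := (e, m)) trivial)⟩
    · rintro ⟨m, hm⟩
      refine ⟨m * (s e)⁻¹, hm.trans ?_⟩
      have := (Link.edge (d₀ := d₀') (d₁ := d₁') (e := (e, m * (s e)⁻¹)) (Set.mem_univ _)).symm
      simpa [d₀', d₁'] using this
  choose γ hγ using hex
  refine ⟨γ, fun e => ?_⟩
  have h := (hγ (d₁ e)).symm.trans ((hγ (d₀ e)).trans
    (Link.edge (d₀ := d₀') (d₁ := d₁') (e := (e, γ (d₀ e))) (Set.mem_univ _)))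
  have := hT.injective_of_locally_injective (d₀' := d₀') (d₁' := d₁') Prod.fst Prod.fst
    (fun _ => rfl) (fun _ => rfl)
    (fun e e' h h' => Prod.ext h (congrArg Prod.snd h' :))
    (fun e e' h h' => Prod.ext h (by
      have := congrArg Prod.snd h'
      simp only [d₁', h] at this
      exact mul_right_cancel this)) h rfl
  exact congrArg Prod.snd this

end IsTree

/-- A connected graph is a tree if every edge can be separated by an integral function. -/
theorem isTree_of_height {A : Type*} [Nonempty V] (hc : ∀ v w, Link d₀ d₁ Set.univ v w)
    (h : ∀ e, ∃ φ : V → A, φ (d₀ e) ≠ φ (d₁ e) ∧ ∀ f ≠ e, φ (d₀ f) = φ (d₁ f)) :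
    IsTree d₀ d₁ where
  nonempty := inferInstance
  connected := hc
  bridge e hl := by
    obtain ⟨φ, h₁, h₂⟩ := h e
    exact h₁ (hl.lift (r := fun a b => φ a = φ b) ⟨fun _ => rfl, Eq.symm, Eq.trans⟩ h₂)

end Trees

end FiniteSplitting

namespace FiniteSplitting

/-! ### Groups acting on trees -/

/-- A tree with an action of `G` that preserves the orientation of the edges. -/
structure GTree (G : Type u) [Group G] where
  V : Type u
  E : Type u
  [actV : MulAction G V]
  [actE : MulAction G E]
  d₀ : E → V
  d₁ : E → V
  smul_d₀ : ∀ (g : G) (e : E), d₀ (g • e) = g • d₀ e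
  smul_d₁ : ∀ (g : G) (e : E), d₁ (g • e) = g • d₁ e
  isTree : IsTree d₀ d₁

attribute [instance] GTree.actV GTree.actE

namespace IsTree

variable {V E : Type*} {d₀ d₁ : E → V} (hT : IsTree d₀ d₁)
include hT

theorem edge_unique {e e' : E} {x y : V} (h : Inc d₀ d₁ e x y) (h' : Inc d₀ d₁ e' x y) :
    e = e' := by
  have := (hT.sep_inc h).symm.trans (hT.sep_inc h')
  exact Set.singleton_injective this

theorem sep_disjoint {e : E} {x z y o : V} (h : Inc d₀ d₁ e x z) (hy : e ∈ Sep d₀ d₁ x y)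
    (ho : e ∉ Sep d₀ d₁ x o) : Disjoint (Sep d₀ d₁ x y) (Sep d₀ d₁ x o) := by
  rw [Set.disjoint_left]
  intro f hf hf'
  have h1 : e ∈ Sep d₀ d₁ o y := by simp only [mem_sep] at *; grind
  have h2 := hT.sep_subset_of_mem h1 h (by rwa [sep_comm]) (by rwa [sep_comm] : f ∈ Sep d₀ d₁ o x)
  have h3 := h2.1
  simp only [mem_sep] at *
  grind

omit hT in
theorem sep_eq_union {x y o : V} (h : Disjoint (Sep d₀ d₁ x y) (Sep d₀ d₁ x o)) :
    Sep d₀ d₁ y o = Sep d₀ d₁ x y ∪ Sep d₀ d₁ x o := by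
  ext f
  have := fun h' => Set.disjoint_left.1 h (show f ∈ Sep d₀ d₁ x y from h')
  simp only [mem_sep, Set.mem_union] at *
  grind

theorem tdist_add {e : E} {x z y o : V} (h : Inc d₀ d₁ e x z) (hy : e ∈ Sep d₀ d₁ x y)
    (ho : e ∉ Sep d₀ d₁ x o) : tdist d₀ d₁ y o = tdist d₀ d₁ x y + tdist d₀ d₁ x o := by
  have hd := hT.sep_disjoint h hy ho
  rw [tdist, sep_eq_union hd, Set.ncard_union_eq hd (hT.sep_finite _ _) (hT.sep_finite _ _)]
  rfl

theorem inc_of_tdist_eq_one {x y : V} (h : tdist d₀ d₁ x y = 1) : ∃ e, Inc d₀ d₁ e x y := by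
  have hne : x ≠ y := fun hxy => by rw [hT.tdist_eq_zero.2 hxy] at h; cases h
  obtain ⟨e, z, hz, he⟩ := hT.exists_step hne
  have := hT.tdist_step hz he
  rw [hT.tdist_eq_zero.1 (by omega : tdist d₀ d₁ z y = 0)] at hz
  exact ⟨e, hz⟩

end IsTree

namespace GTree

variable {G : Type u} [Group G] (T : GTree G)

theorem smul_inc {e : T.E} {x y : T.V} (g : G) (h : Inc T.d₀ T.d₁ e x y) : Inc T.d₀ T.d₁ (g • e) (g • x) (g • y) := by
  rcases h with ⟨rfl, rfl⟩ | ⟨rfl, rfl⟩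
  · exact Or.inl ⟨T.smul_d₀ g e, T.smul_d₁ g e⟩
  · exact Or.inr ⟨T.smul_d₀ g e, T.smul_d₁ g e⟩

theorem smul_link {D D' : Set T.E} (g : G) (hD : ∀ e ∈ D, g • e ∈ D') {x y : T.V}
    (h : Link T.d₀ T.d₁ D x y) : Link T.d₀ T.d₁ D' (g • x) (g • y) :=
  h.map (g • ·) fun e he => Link.of_inc (hD e he) (T.smul_inc g (inc_self e))

theorem smul_side {e : T.E} {x : T.V} (g : G) :
    Side T.d₀ T.d₁ (g • e) (g • x) ↔ Side T.d₀ T.d₁ e x := by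
  have key {e : T.E} {x : T.V} (g : G) (h : Side T.d₀ T.d₁ e x) :
      Side T.d₀ T.d₁ (g • e) (g • x) := by
    rw [Side, T.smul_d₁]
    exact T.smul_link g (D := {e}ᶜ) (D' := {g • e}ᶜ) (fun f hf h' => hf (smul_left_cancel g h')) h
  exact ⟨fun h => by simpa using key g⁻¹ h, key g⟩

theorem smul_mem_sep {e : T.E} {x y : T.V} (g : G) :
    g • e ∈ Sep T.d₀ T.d₁ (g • x) (g • y) ↔ e ∈ Sep T.d₀ T.d₁ x y := by
  rw [mem_sep, mem_sep, T.smul_side, T.smul_side]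

theorem sep_smul (g : G) (x y : T.V) : Sep T.d₀ T.d₁ (g • x) (g • y) = (g • ·) '' Sep T.d₀ T.d₁ x y := by
  ext e
  constructor
  · intro h
    exact ⟨g⁻¹ • e, by rw [← T.smul_mem_sep g]; simpa using h, by simp⟩
  · rintro ⟨e, h, rfl⟩
    exact (T.smul_mem_sep g).2 h

theorem dist_smul (g : G) (x y : T.V) : tdist T.d₀ T.d₁ (g • x) (g • y) = tdist T.d₀ T.d₁ x y := by
  rw [tdist, T.sep_smul, Set.ncard_image_of_injective _ (MulAction.injective g), tdist]

/-- The first edge of a geodesic is unique, so an element fixing both ends fixes that edge and hence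
the next vertex; then induct on the distance. -/
theorem smul_eq_of_mem_sep {g : G} {x y : T.V} (hx : g • x = x) (hy : g • y = y) {e : T.E}
    (he : e ∈ Sep T.d₀ T.d₁ x y) : g • e = e := by
  induction hn : tdist T.d₀ T.d₁ x y generalizing x with
  | zero =>
    rw [T.isTree.tdist_eq_zero.1 hn, sep_self] at he
    exact he.elim
  | succ n ih =>
    have hne : x ≠ y := fun h => by rw [T.isTree.tdist_eq_zero.2 h] at hn; cases hn
    obtain ⟨f, z, hz, hf⟩ := T.isTree.exists_step hne
    have h1 : g • f = f := by
      have h2 := T.smul_inc g hz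
      have h3 := (T.smul_mem_sep g).2 hf
      rw [hx] at h2 h3
      rw [hy] at h3
      exact T.isTree.step_unique h2 hz (by rwa [sep_comm]) (by rwa [sep_comm])
    by_cases hfe : e = f
    · rw [hfe, h1]
    · refine ih (x := z) ?_ ?_ ?_
      · have h2 := T.smul_inc g hz
        rw [h1, hx] at h2
        exact T.isTree.inc_right_unique h2 hz
      · rw [T.isTree.sep_step hz hf]; exact ⟨he, hfe⟩
      · have := T.isTree.tdist_step hz hf; omega

theorem exists_edge_fixed {P : Set G} {x y : T.V} (hxy : x ≠ y) (hx : ∀ g ∈ P, g • x = x)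
    (hy : ∀ g ∈ P, g • y = y) :
    ∃ e z, Inc T.d₀ T.d₁ e x z ∧ e ∈ Sep T.d₀ T.d₁ x y ∧ ∀ g ∈ P, g • e = e := by
  obtain ⟨e, z, hz, he⟩ := T.isTree.exists_step hxy
  exact ⟨e, z, hz, he, fun g hg => T.smul_eq_of_mem_sep (hx g hg) (hy g hg) he⟩

theorem smul_d₀_of_smul {g : G} {e : T.E} (h : g • e = e) : g • T.d₀ e = T.d₀ e := by
  rw [← T.smul_d₀, h]

theorem smul_d₁_of_smul {g : G} {e : T.E} (h : g • e = e) : g • T.d₁ e = T.d₁ e := by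
  rw [← T.smul_d₁, h]

theorem smul_of_inc {g : G} {e : T.E} {x y : T.V} (hi : Inc T.d₀ T.d₁ e x y) (h : g • e = e) :
    g • x = x := by
  rcases hi with ⟨rfl, rfl⟩ | ⟨rfl, rfl⟩
  · exact T.smul_d₀_of_smul h
  · exact T.smul_d₁_of_smul h

/-- A finite group acting on a tree fixes a vertex. -/
theorem exists_fixed_of_finite [Finite G] : ∃ x : T.V, ∀ g : G, g • x = x := by
  have := T.isTree.nonempty
  obtain ⟨o⟩ := T.isTree.nonempty
  have := Fintype.ofFinite G
  -- The eccentricity with respect to the orbit of `o`. Any two distinct vertices minimizing it are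
  -- adjacent: one step from one toward the other cannot approach the orbit point farthest from the
  -- new vertex.
  let ecc : T.V → ℕ := fun x => Finset.univ.sup fun g : G => tdist T.d₀ T.d₁ x (g • o)
  have hle (x : T.V) (g : G) : tdist T.d₀ T.d₁ x (g • o) ≤ ecc x :=
    Finset.le_sup (f := fun g : G => tdist T.d₀ T.d₁ x (g • o)) (Finset.mem_univ g)
  obtain ⟨x, hx⟩ : ∃ x, ∀ y, ecc x ≤ ecc y :=
    ⟨_, fun y => Function.argmin_le ecc y⟩
  have hinv (g : G) (x : T.V) : ecc (g • x) = ecc x := by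
    have key (g : G) (x : T.V) : ecc (g • x) ≤ ecc x := by
      refine Finset.sup_le fun h _ => ?_
      have := hle x (g⁻¹ * h)
      rwa [← T.dist_smul g, smul_smul, mul_inv_cancel_left] at this
    exact le_antisymm (key g x) (by simpa using key g⁻¹ (g • x))
  have hadj {a b : T.V} (ha : ∀ y, ecc a ≤ ecc y) (hb : ∀ y, ecc b ≤ ecc y) (hab : a ≠ b) :
      ∃ e, Inc T.d₀ T.d₁ e a b := by
    obtain ⟨e, z, hz, he⟩ := T.isTree.exists_step hab
    obtain ⟨g, -, hg⟩ := Finset.exists_mem_eq_sup (Finset.univ : Finset G) ⟨1, Finset.mem_univ 1⟩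
      fun g : G => tdist T.d₀ T.d₁ z (g • o)
    have h1 : ecc a ≤ tdist T.d₀ T.d₁ z (g • o) := (ha z).trans_eq hg
    by_cases hs : e ∈ Sep T.d₀ T.d₁ a (g • o)
    · have h2 := T.isTree.tdist_step hz hs
      have h3 := hle a g
      omega
    · have h2 := T.isTree.tdist_step_of_notMem hz hs
      have h3 := T.isTree.tdist_add hz he hs
      have h4 := hle b g
      have h5 := hb a
      have h6 : tdist T.d₀ T.d₁ a b ≠ 0 := fun h => hab (T.isTree.tdist_eq_zero.1 h)
      exact T.isTree.inc_of_tdist_eq_one (by omega)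
  have hmin (g : G) (y : T.V) : ecc (g • x) ≤ ecc y := by rw [hinv]; exact hx y
  refine ⟨x, fun h => ?_⟩
  by_contra hne
  obtain ⟨e, he⟩ := hadj hx (hmin h) (Ne.symm hne)
  -- If `h` moved the centre `x`, then either `h` would invert an edge, against preservation of
  -- orientation, or `x`, `h • x`, `h • h • x` would form a triangle.
  by_cases h2 : h • h • x = x
  · have h3 := T.smul_inc h he
    rw [h2] at h3
    have h4 := T.isTree.edge_unique h3.symm he
    rcases he with ⟨h5, -⟩ | ⟨h5, -⟩
    · exact hne (by rw [← h5, ← T.smul_d₀, h4])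
    · have := T.smul_d₀ h e
      rw [h4, h5, h2] at this
      exact hne this
  · have h3 := T.smul_inc h he
    obtain ⟨f, hf⟩ := hadj hx (by simpa [smul_smul] using hmin (h * h)) (Ne.symm h2)
    have h4 := T.isTree.sep_inc he
    have h5 := T.isTree.sep_inc h3
    have h6 := T.isTree.sep_inc hf
    have key (k : T.E) : k = f ↔ ¬ (k = e ↔ k = h • e) := by
      rw [← Set.mem_singleton_iff, ← Set.mem_singleton_iff (b := e),
        ← Set.mem_singleton_iff (b := h • e), ← h4, ← h5, ← h6]
      simp only [mem_sep]
      grind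
    have k1 := key f
    have k2 := key e
    have k3 := key (h • e)
    grind

/-- The restriction of the action along a homomorphism. -/
def comap {H : Type u} [Group H] (φ : H →* G) : GTree H where
  V := T.V
  E := T.E
  actV := MulAction.compHom T.V φ
  actE := MulAction.compHom T.E φ
  d₀ := T.d₀
  d₁ := T.d₁
  smul_d₀ h e := T.smul_d₀ (φ h) e
  smul_d₁ h e := T.smul_d₁ (φ h) e
  isTree := T.isTree

/-- The restriction of the action to a subgroup. -/
abbrev res (H : Subgroup G) : GTree H := T.comap H.subtype

/-- All the edge stabilizers are finite. -/
def FiniteEdges : Prop := ∀ e : T.E, Finite (MulAction.stabilizer G e)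

/-- There are finitely many orbits of edges. -/
def Cofinite : Prop := Finite (MulAction.orbitRel.Quotient G T.E)

theorem exists_fixed_of_finite_subgroup (H : Subgroup G) [Finite H] :
    ∃ x : T.V, ∀ g ∈ H, g • x = x := by
  obtain ⟨x, hx⟩ := (T.res H).exists_fixed_of_finite
  exact ⟨x, fun g hg => hx ⟨g, hg⟩⟩

theorem FiniteEdges.res {T : GTree G} (h : T.FiniteEdges) (H : Subgroup G) :
    (T.res H).FiniteEdges := fun e => by
  have := h e
  refine Finite.of_injective (β := MulAction.stabilizer G (show T.E from e))
    (fun g => ⟨g.1.1, g.2⟩) fun a b h => ?_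
  exact Subtype.ext (Subtype.ext (congrArg (fun x => x.1) h :))

/-- Every vertex of a tree with more than one vertex is the end point of an edge. -/
theorem exists_inc {x y : T.V} (h : x ≠ y) : ∃ e z, Inc T.d₀ T.d₁ e x z := by
  obtain ⟨e, z, hz, -⟩ := T.isTree.exists_step h
  exact ⟨e, z, hz⟩

theorem Cofinite.vertices {T : GTree G} (h : T.Cofinite) :
    Finite (MulAction.orbitRel.Quotient G T.V) := by
  obtain ⟨o⟩ := T.isTree.nonempty
  have : Finite (MulAction.orbitRel.Quotient G T.E) := h
  let f : Option (MulAction.orbitRel.Quotient G T.E × Bool) → MulAction.orbitRel.Quotient G T.V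
    | none => Quotient.mk _ o
    | some (q, true) => Quotient.map T.d₀ (by
        rintro _ b ⟨g, rfl⟩; exact ⟨g, (T.smul_d₀ g b).symm⟩) q
    | some (q, false) => Quotient.map T.d₁ (by
        rintro _ b ⟨g, rfl⟩; exact ⟨g, (T.smul_d₁ g b).symm⟩) q
  refine Finite.of_surjective f fun q => ?_
  induction q using Quotient.inductionOn with
  | h x =>
    by_cases hx : x = o
    · exact ⟨none, by rw [hx]⟩
    · obtain ⟨e, z, ⟨rfl, -⟩ | ⟨-, rfl⟩⟩ := T.exists_inc hx
      · exact ⟨some (Quotient.mk _ e, true), rfl⟩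
      · exact ⟨some (Quotient.mk _ e, false), rfl⟩

/-! ### Invariant subtrees -/

section Component

variable (D : Set T.E) (hD : ∀ (g : G), ∀ e ∈ D, g • e ∈ D) (x : T.V)
  (hx : ∀ g : G, Link T.d₀ T.d₁ D x (g • x))

/-- The component of the vertex `x` in the graph with an invariant set `D` of edges, if it is
invariant. -/
def component : GTree G where
  V := ({ carrier := {y | Link T.d₀ T.d₁ D x y}
          smul_mem' := fun g _ hy => (hx g).trans (T.smul_link g (hD g) hy) } : SubMulAction G T.V)
  E := ({ carrier := {e | e ∈ D ∧ Link T.d₀ T.d₁ D x (T.d₀ e)}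
          smul_mem' := fun g e he => ⟨hD g e he.1, by
            rw [T.smul_d₀]; exact (hx g).trans (T.smul_link g (hD g) he.2)⟩ } : SubMulAction G T.E)
  d₀ e := ⟨T.d₀ e.1, e.2.2⟩
  d₁ e := ⟨T.d₁ e.1, e.2.2.trans (Link.edge e.2.1)⟩
  smul_d₀ g e := Subtype.ext (T.smul_d₀ g e.1)
  smul_d₁ g e := Subtype.ext (T.smul_d₁ g e.1)
  isTree := by
    refine ⟨⟨⟨x, Link.refl x⟩⟩, ?_, ?_⟩
    · rintro ⟨v, hv⟩ ⟨w, hw⟩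
      have key (w : T.V) (hw : Link T.d₀ T.d₁ D x w) : ∀ hx', Link (V := {y // Link T.d₀ T.d₁ D x y})
          (E := {e // e ∈ D ∧ Link T.d₀ T.d₁ D x (T.d₀ e)}) (fun e => ⟨T.d₀ e.1, e.2.2⟩)
          (fun e => ⟨T.d₁ e.1, e.2.2.trans (Link.edge e.2.1)⟩) Set.univ ⟨x, hx'⟩ ⟨w, hw⟩ := by
        intro hx'
        refine ((hw.propagate (P := fun w => ∃ h : Link T.d₀ T.d₁ D x w,
          Link (V := {y // Link T.d₀ T.d₁ D x y})
            (E := {e // e ∈ D ∧ Link T.d₀ T.d₁ D x (T.d₀ e)}) (fun e => ⟨T.d₀ e.1, e.2.2⟩)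
            (fun e => ⟨T.d₁ e.1, e.2.2.trans (Link.edge e.2.1)⟩) Set.univ ⟨x, hx'⟩ ⟨w, h⟩)
          fun e he => ⟨?_, ?_⟩).1 ⟨Link.refl x, Link.refl _⟩).2
        · rintro ⟨h, h'⟩
          exact ⟨h.trans (Link.edge he), h'.trans (Link.of_inc (e := ⟨e, he, h⟩) trivial
            (Or.inl ⟨rfl, rfl⟩))⟩
        · rintro ⟨h, h'⟩
          exact ⟨h.trans (Link.edge he).symm, h'.trans (Link.of_inc
            (e := ⟨e, he, h.trans (Link.edge he).symm⟩) trivial (Or.inr ⟨rfl, rfl⟩))⟩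
      exact (key v hv (Link.refl x)).symm.trans (key w hw _)
    · intro e h
      refine T.isTree.bridge e.1 (h.map (d₀' := T.d₀) (d₁' := T.d₁) (D' := {e.1}ᶜ)
        (fun y => y.1) fun f hf => ?_)
      have hfe : f.1 ∈ ({e.1}ᶜ : Set T.E) := fun h => hf (Subtype.ext h)
      exact Link.edge hfe

theorem component_stab_V {D hD x hx} (y : (T.component D hD x hx).V) :
    MulAction.stabilizer G y = MulAction.stabilizer G y.1 := by
  ext g
  simp only [MulAction.mem_stabilizer_iff]
  exact ⟨fun h => congrArg Subtype.val h, fun h => Subtype.ext h⟩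

theorem component_stab_E {D hD x hx} (y : (T.component D hD x hx).E) :
    MulAction.stabilizer G y = MulAction.stabilizer G y.1 := by
  ext g
  simp only [MulAction.mem_stabilizer_iff]
  exact ⟨fun h => congrArg Subtype.val h, fun h => Subtype.ext h⟩

/-- The orbit in the whole tree of an edge orbit of a component. -/
def componentOrbit {D hD x hx} (q : MulAction.orbitRel.Quotient G (T.component D hD x hx).E) :
    MulAction.orbitRel.Quotient G T.E :=
  Quotient.map (fun e => e.1) (by
    rintro _ b ⟨g, rfl⟩; exact ⟨g, rfl⟩) q

theorem componentOrbit_injective {D hD x hx} :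
    Function.Injective (T.componentOrbit (D := D) (hD := hD) (x := x) (hx := hx)) := by
  intro a b
  induction a using Quotient.inductionOn
  induction b using Quotient.inductionOn
  intro h
  obtain ⟨g, hg⟩ := Quotient.exact h
  exact Quotient.sound ⟨g, Subtype.ext hg⟩

end Component

theorem FiniteEdges.component {T : GTree G} (h : T.FiniteEdges) {D hD x hx} :
    (T.component D hD x hx).FiniteEdges := fun e => by
  rw [component_stab_E]; exact h e.1

/-- A finitely generated group that acts on a tree has an invariant subtree with finitely many
orbits of edges that contains a given vertex. -/
theorem exists_component_cofinite [Group.FG G] (x : T.V) :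
    ∃ D hD hx, (T.component D hD x hx).Cofinite := by
  obtain ⟨S, hS⟩ := Group.fg_def.1 ‹Group.FG G›
  -- The translates of the geodesics from `x` to `s • x`, for `s` a generator, already link the
  -- whole orbit of `x`.
  let F : Set T.E := ⋃ s ∈ S, Sep T.d₀ T.d₁ x (s • x)
  have hF : F.Finite := S.finite_toSet.biUnion fun s _ => T.isTree.sep_finite _ _
  let D : Set T.E := {e | ∃ (g : G), ∃ f ∈ F, g • f = e}
  have hD : ∀ (g : G), ∀ e ∈ D, g • e ∈ D := by
    rintro g _ ⟨h, f, hf, rfl⟩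
    exact ⟨g * h, f, hf, mul_smul _ _ _⟩
  have hx (g : G) : Link T.d₀ T.d₁ D x (g • x) := by
    have hg : g ∈ Subgroup.closure (S : Set G) := hS ▸ Subgroup.mem_top g
    induction hg using Subgroup.closure_induction with
    | mem s hs =>
      refine (T.isTree.link_sep x (s • x)).mono fun e he => ⟨1, e, ?_, one_smul _ _⟩
      exact Set.mem_biUnion (show s ∈ S from hs) he
    | one => rw [one_smul]; exact Link.refl x
    | mul a b _ _ ha hb => rw [mul_smul]; exact ha.trans (T.smul_link a (hD a) hb)
    | inv a _ ha => simpa using (T.smul_link a⁻¹ (hD a⁻¹) ha).symm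
  refine ⟨D, hD, hx, ?_⟩
  have hfin : Finite ((Quotient.mk (MulAction.orbitRel G T.E)) '' F) := (hF.image _).to_subtype
  refine Finite.of_injective (β := (Quotient.mk (MulAction.orbitRel G T.E)) '' F)
    (fun q => ⟨T.componentOrbit q, ?_⟩) fun a b h =>
      T.componentOrbit_injective (congrArg Subtype.val h)
  induction q using Quotient.inductionOn with
  | h e =>
    obtain ⟨e, ⟨g, f, hf, rfl⟩, _⟩ := e
    exact ⟨f, hf, Quotient.sound ⟨g⁻¹, by simp⟩⟩

/-! ### Collapsing orbits of edges -/

section Collapse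

variable (D : Set T.E) (hD : ∀ (g : G), ∀ e ∈ D, g • e ∈ D)

/-- The relation on the vertices generated by the edges outside `D`. -/
def collapseSetoid : Setoid T.V where
  r := Link T.d₀ T.d₁ Dᶜ
  iseqv := ⟨fun _ => Link.refl _, Link.symm, Link.trans⟩

theorem smul_mem_compl {D : Set T.E} (hD : ∀ (g : G), ∀ e ∈ D, g • e ∈ D) (g : G) :
    ∀ e ∈ Dᶜ, g • e ∈ Dᶜ := fun e he h => he (by simpa using hD g⁻¹ _ h)

/-- The tree that arises by collapsing all the edges outside an invariant set `D`. -/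
def collapse : GTree G where
  V := Quotient (T.collapseSetoid D)
  E := ({ carrier := D, smul_mem' := fun g _ he => hD g _ he } : SubMulAction G T.E)
  actV :=
    { smul := fun g => Quotient.map (g • ·) fun _ _ h => T.smul_link g (T.smul_mem_compl hD g) h
      one_smul := fun q => by
        induction q using Quotient.inductionOn
        exact congrArg (Quotient.mk _) (one_smul _ _)
      mul_smul := fun g h q => by
        induction q using Quotient.inductionOn
        exact congrArg (Quotient.mk _) (mul_smul _ _ _) }
  d₀ e := Quotient.mk _ (T.d₀ e.1)
  d₁ e := Quotient.mk _ (T.d₁ e.1)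
  smul_d₀ g e := congrArg (Quotient.mk _) (T.smul_d₀ g e.1)
  smul_d₁ g e := congrArg (Quotient.mk _) (T.smul_d₁ g e.1)
  isTree := by
    have := T.isTree.nonempty.map (Quotient.mk (T.collapseSetoid D))
    -- The side of a surviving edge is constant on the collapsed pieces, since they avoid that edge.
    refine isTree_of_height (A := Prop) ?_ fun e =>
      ⟨Quotient.lift (Side T.d₀ T.d₁ e.1) fun a b h => propext ?_, ?_, fun f hf => ?_⟩
    · intro v w
      induction v using Quotient.inductionOn
      induction w using Quotient.inductionOn
      refine (T.isTree.connected _ _).map (Quotient.mk (T.collapseSetoid D)) fun e _ => ?_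
      by_cases he : e ∈ D
      · exact Link.of_inc (e := ⟨e, he⟩) trivial (Or.inl ⟨rfl, rfl⟩)
      · rw [show Quotient.mk (T.collapseSetoid D) (T.d₀ e) = Quotient.mk _ (T.d₁ e) from
          Quotient.sound (Link.edge he)]
        exact Link.refl _
    · refine Link.propagate (D := Dᶜ) (fun f hf => side_congr ?_) h
      rintro rfl
      exact hf e.2
    · change Side T.d₀ T.d₁ e.1 (T.d₀ e.1) ≠ Side T.d₀ T.d₁ e.1 (T.d₁ e.1)
      intro h
      exact T.isTree.not_side_d₀ e.1 (h ▸ side_d₁ e.1)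
    · exact propext (side_congr fun h => hf (Subtype.ext h))

/-- The vertex of the collapsed tree given by a vertex. -/
def toCollapse (x : T.V) : (T.collapse D hD).V := Quotient.mk _ x

variable {D hD}

theorem toCollapse_surjective : Function.Surjective (T.toCollapse D hD) := Quotient.mk_surjective

theorem smul_toCollapse (g : G) (x : T.V) : g • T.toCollapse D hD x = T.toCollapse D hD (g • x) :=
  rfl

theorem toCollapse_eq {x y : T.V} :
    T.toCollapse D hD x = T.toCollapse D hD y ↔ Link T.d₀ T.d₁ Dᶜ x y :=
  ⟨fun h => Quotient.exact h, fun h => Quotient.sound h⟩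

theorem collapse_stab_E (y : (T.collapse D hD).E) :
    MulAction.stabilizer G y = MulAction.stabilizer G y.1 := by
  ext g
  simp only [MulAction.mem_stabilizer_iff]
  exact ⟨fun h => congrArg Subtype.val h, fun h => Subtype.ext h⟩

/-- The orbit in the whole tree of an edge orbit of the collapsed tree. -/
def collapseOrbit (q : MulAction.orbitRel.Quotient G (T.collapse D hD).E) :
    MulAction.orbitRel.Quotient G T.E :=
  Quotient.map (fun e => e.1) (by
    rintro _ b ⟨g, rfl⟩; exact ⟨g, rfl⟩) q

theorem collapseOrbit_injective :
    Function.Injective (T.collapseOrbit (D := D) (hD := hD)) := by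
  intro a b
  induction a using Quotient.inductionOn
  induction b using Quotient.inductionOn
  intro h
  obtain ⟨g, hg⟩ := Quotient.exact h
  exact Quotient.sound ⟨g, Subtype.ext hg⟩

theorem FiniteEdges.collapse {T : GTree G} {D : Set T.E} {hD : ∀ (g : G), ∀ e ∈ D, g • e ∈ D} (h : T.FiniteEdges) :
    (T.collapse D hD).FiniteEdges := fun e => by
  rw [collapse_stab_E]; exact h e.1

end Collapse

end GTree

end FiniteSplitting

namespace FiniteSplitting

/-! ### Splittings of groups and their trees -/

/-- Subgroups and elements of a group that present it in the manner of a graph of groups. -/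
structure Splitting (π : Type u) [Group π] where
  I : Type
  J : Type
  o : J → I
  t : J → I
  P : I → Subgroup π
  Q : J → Subgroup π
  τ : J → π
  D : Set J
  le_P : ∀ j, Q j ≤ P (o j)
  conj_mem : ∀ j, ∀ q ∈ Q j, (τ j)⁻¹ * q * τ j ∈ P (t j)
  τ_eq_one : ∀ j ∈ D, τ j = 1
  tree : IsTree (fun j : D => o j) (fun j : D => t j)
  closure_eq : Subgroup.closure ((⋃ i, (P i : Set π)) ∪ Set.range τ) = ⊤

theorem link_subtype_iff {V E : Type*} {d₀ d₁ : E → V} {D : Set E} {D' : Set D} {x y : V} :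
    Link (fun e : D => d₀ e) (fun e : D => d₁ e) D' x y ↔ Link d₀ d₁ (Subtype.val '' D') x y := by
  constructor
  · exact fun h => h.map id fun e he => Link.edge (d₀ := d₀) (d₁ := d₁) ⟨e, he, rfl⟩
  · refine fun h => h.map id ?_
    rintro _ ⟨e, he, rfl⟩
    exact Link.edge (d₀ := fun e : D => d₀ e) (d₁ := fun e : D => d₁ e) he

theorem GraphOfGroups.IsMaximalSubtree.isTree {𝒢 : GraphOfGroups.{u}} {D : Set 𝒢.E}
    (h : 𝒢.IsMaximalSubtree D) : IsTree (fun j : D => 𝒢.d₀ j) (fun j : D => 𝒢.d₁ j) where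
  nonempty := h.1
  connected v w := by
    rw [link_subtype_iff]
    rw [Set.image_univ, Subtype.range_coe_subtype]
    exact h.2.1 v w
  bridge e hl := by
    rw [link_subtype_iff] at hl
    refine h.2.2 e e.2 (Link.mono ?_ hl)
    rintro _ ⟨f, hf, rfl⟩
    exact ⟨f.2, fun h => hf (Subtype.ext h)⟩

theorem GraphOfGroups.isMaximalSubtree_of_isTree {𝒢 : GraphOfGroups.{u}} {D : Set 𝒢.E}
    (h : IsTree (fun j : D => 𝒢.d₀ j) (fun j : D => 𝒢.d₁ j)) : 𝒢.IsMaximalSubtree D := by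
  refine ⟨h.nonempty, fun v w => ?_, fun e he hl => h.bridge ⟨e, he⟩ ?_⟩
  · have := link_subtype_iff.1 (h.connected v w)
    rw [Set.image_univ, Subtype.range_coe_subtype] at this
    exact this
  · rw [link_subtype_iff]
    refine Link.mono ?_ hl
    rintro f ⟨hf, hfe⟩
    exact ⟨⟨f, hf⟩, fun h => hfe (congrArg Subtype.val h), rfl⟩

namespace Splitting

variable {π : Type u} [Group π] (S : Splitting π)

/-- The vertices of the graph of a splitting. -/
def V : Type u := Σ i, π ⧸ S.P i

/-- The edges of the graph of a splitting. -/
def E : Type u := Σ j, π ⧸ S.Q j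

/-- The coset of an element, as a vertex. -/
def vtx (i : S.I) (g : π) : S.V := ⟨i, (g : π ⧸ S.P i)⟩

/-- The coset of an element, as an edge. -/
def edg (j : S.J) (g : π) : S.E := ⟨j, (g : π ⧸ S.Q j)⟩

instance : MulAction π S.V where
  smul g v := ⟨v.1, g • v.2⟩
  one_smul v := congrArg (Sigma.mk v.1) (one_smul π v.2)
  mul_smul g h v := congrArg (Sigma.mk v.1) (mul_smul g h v.2)

instance : MulAction π S.E where
  smul g v := ⟨v.1, g • v.2⟩
  one_smul v := congrArg (Sigma.mk v.1) (one_smul π v.2)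
  mul_smul g h v := congrArg (Sigma.mk v.1) (mul_smul g h v.2)

theorem smul_vtx (g h : π) (i : S.I) : g • S.vtx i h = S.vtx i (g * h) := rfl

theorem smul_edg (g h : π) (j : S.J) : g • S.edg j h = S.edg j (g * h) := rfl

theorem exists_vtx (v : S.V) : ∃ i g, v = S.vtx i g := by
  obtain ⟨i, v⟩ := v
  induction v using QuotientGroup.induction_on with
  | H g => exact ⟨i, g, rfl⟩

theorem exists_edg (e : S.E) : ∃ j g, e = S.edg j g := by
  obtain ⟨j, e⟩ := e
  induction e using QuotientGroup.induction_on with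
  | H g => exact ⟨j, g, rfl⟩

theorem vtx_eq {i i' : S.I} {g g' : π} :
    S.vtx i g = S.vtx i' g' ↔ i = i' ∧ g⁻¹ * g' ∈ S.P i := by
  constructor
  · intro h
    obtain rfl : i = i' := congrArg Sigma.fst h
    exact ⟨rfl, QuotientGroup.eq.1 (eq_of_heq (Sigma.mk.inj h).2)⟩
  · rintro ⟨rfl, h⟩
    exact congrArg (Sigma.mk i) (QuotientGroup.eq.2 h)

theorem edg_eq {i i' : S.J} {g g' : π} :
    S.edg i g = S.edg i' g' ↔ i = i' ∧ g⁻¹ * g' ∈ S.Q i := by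
  constructor
  · intro h
    obtain rfl : i = i' := congrArg Sigma.fst h
    exact ⟨rfl, QuotientGroup.eq.1 (eq_of_heq (Sigma.mk.inj h).2)⟩
  · rintro ⟨rfl, h⟩
    exact congrArg (Sigma.mk i) (QuotientGroup.eq.2 h)

theorem smul_vtx_one (i : S.I) (g : π) : g • S.vtx i 1 = S.vtx i 1 ↔ g ∈ S.P i := by
  rw [smul_vtx, vtx_eq]; simp

theorem smul_edg_one (i : S.J) (g : π) : g • S.edg i 1 = S.edg i 1 ↔ g ∈ S.Q i := by
  rw [smul_edg, edg_eq]; simp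

/-- The initial vertex of an edge. -/
def d₀ (e : S.E) : S.V :=
  ⟨S.o e.1, Quotient.map' id (fun g h hgh => by
    rw [QuotientGroup.leftRel_apply] at *; exact S.le_P _ hgh) e.2⟩

/-- The terminal vertex of an edge. -/
def d₁ (e : S.E) : S.V :=
  ⟨S.t e.1, Quotient.map' (· * S.τ e.1) (fun g h hgh => by
    rw [QuotientGroup.leftRel_apply] at *
    have := S.conj_mem _ _ hgh
    convert this using 1
    group) e.2⟩

theorem d₀_edg (j : S.J) (g : π) : S.d₀ (S.edg j g) = S.vtx (S.o j) g := rfl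

theorem d₁_edg (j : S.J) (g : π) : S.d₁ (S.edg j g) = S.vtx (S.t j) (g * S.τ j) := rfl

theorem smul_d₀ (g : π) (e : S.E) : S.d₀ (g • e) = g • S.d₀ e := by
  obtain ⟨j, h, rfl⟩ := S.exists_edg e
  rfl

theorem smul_d₁ (g : π) (e : S.E) : S.d₁ (g • e) = g • S.d₁ e := by
  obtain ⟨j, h, rfl⟩ := S.exists_edg e
  rw [smul_edg, d₁_edg, d₁_edg, smul_vtx, mul_assoc]

theorem smul_link (g : π) {v w : S.V} (h : Link S.d₀ S.d₁ Set.univ v w) :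
    Link S.d₀ S.d₁ Set.univ (g • v) (g • w) :=
  h.map (g • ·) fun e _ => by
    rw [← smul_d₀, ← smul_d₁]; exact Link.edge trivial

theorem link_one (i i' : S.I) (g : π) : Link S.d₀ S.d₁ Set.univ (S.vtx i g) (S.vtx i' g) := by
  refine (S.tree.connected i i').map (fun i => S.vtx i g) fun j _ => ?_
  have h : Link S.d₀ S.d₁ Set.univ _ _ := Link.edge (e := S.edg j g) (Set.mem_univ _)
  rwa [d₀_edg, d₁_edg, S.τ_eq_one j j.2, mul_one] at h

theorem connected (v w : S.V) : Link S.d₀ S.d₁ Set.univ v w := by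
  obtain ⟨i₀⟩ := S.tree.nonempty
  have key (g : π) : Link S.d₀ S.d₁ Set.univ (S.vtx i₀ 1) (S.vtx i₀ g) := by
    have hg : g ∈ Subgroup.closure ((⋃ i, (S.P i : Set π)) ∪ Set.range S.τ) :=
      S.closure_eq ▸ Subgroup.mem_top g
    induction hg using Subgroup.closure_induction with
    | mem g hg =>
      rcases hg with hg | ⟨j, rfl⟩
      · obtain ⟨i, hi⟩ := Set.mem_iUnion.1 hg
        have h : S.vtx i 1 = S.vtx i g := by rw [vtx_eq]; simpa using hi
        exact (S.link_one i₀ i 1).trans (h ▸ S.link_one i i₀ g)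
      · have h : Link S.d₀ S.d₁ Set.univ _ _ := Link.edge (e := S.edg j 1) (Set.mem_univ _)
        rw [d₀_edg, d₁_edg, one_mul] at h
        exact (S.link_one _ _ _).trans (h.trans (S.link_one _ _ _))
    | one => exact Link.refl _
    | mul a b _ _ ha hb =>
      have := S.smul_link a hb
      rw [smul_vtx, smul_vtx, mul_one] at this
      exact ha.trans this
    | inv a _ ha =>
      have := S.smul_link a⁻¹ ha
      rw [smul_vtx, smul_vtx, mul_one, inv_mul_cancel] at this
      exact this.symm
  obtain ⟨i, g, rfl⟩ := S.exists_vtx v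
  obtain ⟨i', g', rfl⟩ := S.exists_vtx w
  exact ((S.link_one i i₀ g).trans (key g).symm).trans ((key g').trans (S.link_one i₀ i' g'))

/-- The universal property: homomorphisms out of the group are given by compatible families. -/
def Universal : Prop :=
  ∀ (M : Type u) [Group M] (f : ∀ i, S.P i →* M) (s : S.J → M), (∀ j ∈ S.D, s j = 1) →
    (∀ j q (hq : q ∈ S.Q j), f (S.o j) ⟨q, S.le_P j hq⟩ * s j =
      s j * f (S.t j) ⟨_, S.conj_mem j q hq⟩) →
    ∃ R : π →* M, (∀ i (p : S.P i), R p = f i p) ∧ ∀ j, R (S.τ j) = s j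

/-! ### Affine permutations of integer-valued functions -/

section Affine

/-- The affine permutation with linear part `g` that maps `a` to `b`. -/
def aff {X : Type*} [MulAction π X] (g : π) (a b : X → ℤ) : Equiv.Perm (X → ℤ) where
  toFun m := fun e => m (g⁻¹ • e) - a (g⁻¹ • e) + b e
  invFun m := fun e => m (g • e) - b (g • e) + a e
  left_inv m := by ext e; simp
  right_inv m := by ext e; simp

variable {X : Type*} [MulAction π X]

theorem aff_apply (g : π) (a b m : X → ℤ) (e : X) :
    aff g a b m e = m (g⁻¹ • e) - a (g⁻¹ • e) + b e := rfl

theorem aff_self (g : π) (a b : X → ℤ) : aff g a b a = b := by ext e; simp [aff_apply]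

theorem aff_mul (g h : π) (a b c : X → ℤ) : aff g b c * aff h a b = aff (g * h) a c := by
  ext m e
  simp [aff_apply, mul_smul]

/-- The action of the group by affine permutations that fix `a`. -/
def affHom (a : X → ℤ) : π →* Equiv.Perm (X → ℤ) where
  toFun g := aff g a a
  map_one' := by ext m e; simp [aff_apply]
  map_mul' g h := (aff_mul g h a a a).symm

/-- An affine permutation is determined by its linear part and one value. -/
theorem aff_eq {g : π} {a b a' b' : X → ℤ} (h : aff g a b a' = b') : aff g a b = aff g a' b' := by
  subst h
  ext m e
  simp only [aff_apply]
  ring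

end Affine

/-- The universal property gives an affine action on the functions `S.E → ℤ` in which `P i` fixes `δ
i` and `τ j` sends `δ (t j)` to `δ (o j) + x j`. Transporting the `δ i` equivariantly gives a map
`Δ` on vertices whose increment across an edge is the indicator of that edge. The coordinate of `Δ`
at `e` changes only across `e`, so `e` is a bridge. -/
theorem isTree (h : S.Universal) : IsTree S.d₀ S.d₁ := by
  classical
  obtain ⟨i₀⟩ := S.tree.nonempty
  let x (j : S.J) : S.E → ℤ := Pi.single (S.edg j 1) 1
  -- Solving `δ (t j) = δ (o j) + x j` along the maximal subtree makes the images of the letters `τ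
  -- j` with `j ∈ D` trivial, as the universal property demands.
  obtain ⟨γ, hγ⟩ := S.tree.exists_potential (fun j => Multiplicative.ofAdd (x j))
  let δ : S.I → S.E → ℤ := fun i => (γ i).toAdd
  have hδ (j : S.J) (hj : j ∈ S.D) : δ (S.t j) = δ (S.o j) + x j :=
    congrArg Multiplicative.toAdd (hγ ⟨j, hj⟩)
  have hx (j : S.J) (q : π) (hq : q ∈ S.Q j) (e : S.E) : x j (q⁻¹ • e) = x j e := by
    have h1 : (q⁻¹ • e = S.edg j 1) ↔ e = S.edg j 1 := by
      rw [inv_smul_eq_iff, (S.smul_edg_one j q).2 hq]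
    simp only [x, Pi.single_apply, h1]
  obtain ⟨R, hR, hRτ⟩ := h (Equiv.Perm (S.E → ℤ)) (fun i => (affHom (δ i)).comp (S.P i).subtype)
    (fun j => aff (S.τ j) (δ (S.t j)) (δ (S.o j) + x j))
    (fun j hj => by
      rw [S.τ_eq_one j hj, ← hδ j hj]; exact map_one (affHom (π := π) (δ (S.t j))))
    (fun j q hq => by
      change aff q _ _ * _ = _ * aff _ _ _
      rw [aff_mul, aff_eq (g := q) (a := δ (S.o j)) (b := δ (S.o j)) (a' := δ (S.o j) + x j)
        (b' := δ (S.o j) + x j), aff_mul]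
      · congr 1
        change _ = S.τ j * ((S.τ j)⁻¹ * q * S.τ j)
        rw [mul_assoc, mul_inv_cancel_left]
      · ext e
        rw [aff_apply, Pi.add_apply, Pi.add_apply, hx j q hq e]
        ring)
  have hlin (g : π) : ∀ (m m' : S.E → ℤ) (e : S.E), R g (m + m') e = R g m e + m' (g⁻¹ • e) := by
    have hg : g ∈ Subgroup.closure ((⋃ i, (S.P i : Set π)) ∪ Set.range S.τ) :=
      S.closure_eq ▸ Subgroup.mem_top g
    induction hg using Subgroup.closure_induction with
    | mem g hg =>
      intro m m' e
      rcases hg with hg | ⟨j, rfl⟩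
      · obtain ⟨i, hi⟩ := Set.mem_iUnion.1 hg
        rw [hR i ⟨g, hi⟩]
        change aff g _ _ _ e = aff g _ _ _ e + _
        simp only [aff_apply, Pi.add_apply]
        ring
      · rw [hRτ]
        simp only [aff_apply, Pi.add_apply]
        ring
    | one => simp
    | mul a b _ _ ha hb =>
      intro m m' e
      have h1 : R b (m + m') = R b m + fun e => m' (b⁻¹ • e) := funext fun e => hb m m' e
      rw [map_mul, Equiv.Perm.mul_apply, h1, ha, Equiv.Perm.mul_apply, mul_inv_rev, mul_smul]
    | inv a _ ha =>
      intro m m' e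
      have h1 : R a⁻¹ (m + m') = R a⁻¹ m + fun e => m' (a • e) := by
        apply (R a).injective
        rw [← Equiv.Perm.mul_apply, ← map_mul, mul_inv_cancel, map_one, Equiv.Perm.one_apply]
        ext e
        rw [ha, ← Equiv.Perm.mul_apply, ← map_mul, mul_inv_cancel, map_one, Equiv.Perm.one_apply,
          smul_inv_smul, Pi.add_apply]
      rw [h1, inv_inv, Pi.add_apply]
  let Δ : S.V → S.E → ℤ := fun v => Quotient.liftOn' v.2 (fun g => R g (δ v.1)) (by
    intro g g' hg
    rw [QuotientGroup.leftRel_apply] at hg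
    have h1 : R (g⁻¹ * g') (δ v.1) = δ v.1 := by
      rw [hR v.1 ⟨_, hg⟩]
      exact aff_self _ _ _
    change R g _ = R g' _
    rw [← mul_inv_cancel_left g g', map_mul, Equiv.Perm.mul_apply, h1])
  have hΔ (i : S.I) (g : π) : Δ (S.vtx i g) = R g (δ i) := rfl
  have hcob (e : S.E) : Δ (S.d₁ e) = Δ (S.d₀ e) + Pi.single e 1 := by
    obtain ⟨j, g, rfl⟩ := S.exists_edg e
    rw [d₀_edg, d₁_edg, hΔ, hΔ, map_mul, Equiv.Perm.mul_apply, hRτ, aff_self]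
    ext e
    rw [hlin, Pi.add_apply]
    congr 1
    have h1 : g⁻¹ • e = S.edg j 1 ↔ e = S.edg j g := by
      rw [inv_smul_eq_iff, smul_edg, mul_one]
    simp only [x, Pi.single_apply, h1]
  have : Nonempty S.V := ⟨S.vtx i₀ 1⟩
  refine isTree_of_height S.connected fun e => ⟨fun v => Δ v e, ?_, fun f hf => ?_⟩
  · change Δ _ e ≠ Δ _ e
    rw [hcob]; simp
  · change Δ _ e = Δ _ e
    rw [hcob]; simp [Ne.symm hf]

/-- The tree of a splitting with the universal property. -/
def toGTree (h : S.Universal) : GTree π where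
  V := S.V
  E := S.E
  d₀ := S.d₀
  d₁ := S.d₁
  smul_d₀ := S.smul_d₀
  smul_d₁ := S.smul_d₁
  isTree := S.isTree h

/-- A map of the graph of a splitting to a tree that is injective on the edges at a vertex
is injective on the cosets of a vertex group. -/
theorem mem_of_fixed {G : Type u} [Group G] (T : GTree G) (Φ : π →* G) (r : S.I → T.V)
    (ε : S.J → T.E) (h₀ : ∀ j, T.d₀ (ε j) = r (S.o j)) (h₁ : ∀ j, T.d₁ (ε j) = Φ (S.τ j) • r (S.t j))
    (hP : ∀ i, ∀ p ∈ S.P i, Φ p • r i = r i) (hQ : ∀ j, ∀ q ∈ S.Q j, Φ q • ε j = ε j)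
    (hε : ∀ j j' (g : G), g • ε j = ε j' → j = j')
    (i₀ : ∀ j, ∀ p ∈ S.P (S.o j), Φ p • ε j = ε j → p ∈ S.Q j)
    (i₁ : ∀ j g, (S.τ j)⁻¹ * g * S.τ j ∈ S.P (S.t j) → Φ g • ε j = ε j → g ∈ S.Q j)
    {i : S.I} {g : π} (hg : Φ g • r i = r i) : g ∈ S.P i := by
  let fV : S.V → T.V := fun v => Quotient.liftOn' v.2 (fun g => Φ g • r v.1) (by
    intro g g' h
    rw [QuotientGroup.leftRel_apply] at h
    rw [← mul_inv_cancel_left g g', map_mul, mul_smul, hP _ _ h])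
  let fE : S.E → T.E := fun v => Quotient.liftOn' v.2 (fun g => Φ g • ε v.1) (by
    intro g g' h
    rw [QuotientGroup.leftRel_apply] at h
    rw [← mul_inv_cancel_left g g', map_mul, mul_smul, hQ _ _ h])
  have hfV (i g) : fV (S.vtx i g) = Φ g • r i := rfl
  have hfE (j g) : fE (S.edg j g) = Φ g • ε j := rfl
  have key {j j' : S.J} {g g' : π} (h : Φ g • ε j = Φ g' • ε j') :
      j = j' ∧ Φ (g⁻¹ * g') • ε j' = ε j := by
    have h2 : Φ (g⁻¹ * g') • ε j' = ε j := by
      rw [map_mul, mul_smul, ← h, map_inv, inv_smul_smul]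
    exact ⟨(hε _ _ _ h2).symm, h2⟩
  -- The hypotheses `hε`, `i₀`, `i₁` say that the coset graph maps to `T` locally injectively. It
  -- need only be connected, so the universal property plays no role.
  have := T.isTree.injective_of_locally_injective (d₀' := S.d₀) (d₁' := S.d₁) fV fE ?_ ?_ ?_ ?_
    (S.connected (S.vtx i g) (S.vtx i 1)) (by rw [hfV, hfV, hg, map_one, one_smul])
  · rw [vtx_eq] at this
    simpa using this.2
  · intro e
    obtain ⟨j, g, rfl⟩ := S.exists_edg e
    rw [hfE, d₀_edg, hfV, T.smul_d₀, h₀]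
  · intro e
    obtain ⟨j, g, rfl⟩ := S.exists_edg e
    rw [hfE, d₁_edg, hfV, T.smul_d₁, h₁, map_mul, mul_smul]
  · intro e e' h h'
    obtain ⟨j, g, rfl⟩ := S.exists_edg e
    obtain ⟨j', g', rfl⟩ := S.exists_edg e'
    rw [hfE, hfE] at h
    obtain ⟨rfl, h2⟩ := key h
    rw [d₀_edg, d₀_edg, vtx_eq] at h'
    exact S.edg_eq.2 ⟨rfl, i₀ j _ h'.2 h2⟩
  · intro e e' h h'
    obtain ⟨j, g, rfl⟩ := S.exists_edg e
    obtain ⟨j', g', rfl⟩ := S.exists_edg e'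
    rw [hfE, hfE] at h
    obtain ⟨rfl, h2⟩ := key h
    rw [d₁_edg, d₁_edg, vtx_eq] at h'
    refine S.edg_eq.2 ⟨rfl, i₁ j _ ?_ h2⟩
    convert h'.2 using 1
    group

end Splitting

end FiniteSplitting

namespace FiniteSplitting

/-! ### Transversals and the structure of groups acting on trees -/

/-- Representatives of the orbits of a tree, with a lift of a maximal subtree of the quotient. -/
structure Transversal {G : Type u} [Group G] (T : GTree G) where
  I : Type
  J : Type
  r : I → T.V
  ε : J → T.E
  o : J → I
  t : J → I
  τ : J → G
  D : Set J
  h₀ : ∀ j, T.d₀ (ε j) = r (o j)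
  h₁ : ∀ j, T.d₁ (ε j) = τ j • r (t j)
  r_surj : ∀ x, ∃ i, ∃ g : G, g • r i = x
  r_inj : ∀ i i', ∀ g : G, g • r i = r i' → i = i'
  ε_surj : ∀ e, ∃ j, ∃ g : G, g • ε j = e
  ε_inj : ∀ j j', ∀ g : G, g • ε j = ε j' → j = j'
  τ_eq_one : ∀ j ∈ D, τ j = 1
  tree : IsTree (fun j : D => o j) (fun j : D => t j)

namespace Transversal

variable {G : Type u} [Group G] {T : GTree G} (𝒯 : Transversal T)

theorem stab_le (j : 𝒯.J) :
    MulAction.stabilizer G (𝒯.ε j) ≤ MulAction.stabilizer G (𝒯.r (𝒯.o j)) := by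
  intro q hq
  rw [MulAction.mem_stabilizer_iff] at *
  rw [← 𝒯.h₀, T.smul_d₀_of_smul hq]

theorem conj_mem (j : 𝒯.J) (q : G) (hq : q ∈ MulAction.stabilizer G (𝒯.ε j)) :
    (𝒯.τ j)⁻¹ * q * 𝒯.τ j ∈ MulAction.stabilizer G (𝒯.r (𝒯.t j)) := by
  rw [MulAction.mem_stabilizer_iff] at *
  rw [mul_smul, mul_smul, ← 𝒯.h₁, T.smul_d₁_of_smul hq, 𝒯.h₁, inv_smul_smul]

/-- Following paths from one representative, every vertex is a translate of some representative by
the generated subgroup. That subgroup contains the stabilizers of the representatives, hence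
everything. -/
theorem closure_eq : Subgroup.closure ((⋃ i, (MulAction.stabilizer G (𝒯.r i) : Set G)) ∪
    Set.range 𝒯.τ) = ⊤ := by
  set K := Subgroup.closure ((⋃ i, (MulAction.stabilizer G (𝒯.r i) : Set G)) ∪ Set.range 𝒯.τ)
  have hK (i g) (hg : g • 𝒯.r i = 𝒯.r i) : g ∈ K :=
    Subgroup.subset_closure (Or.inl (Set.mem_iUnion.2 ⟨i, hg⟩))
  have hτ (j) : 𝒯.τ j ∈ K := Subgroup.subset_closure (Or.inr ⟨j, rfl⟩)
  obtain ⟨i₀⟩ := 𝒯.tree.nonempty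
  have key (x : T.V) : ∃ k ∈ K, ∃ i, k • 𝒯.r i = x := by
    refine ((T.isTree.connected (𝒯.r i₀) x).propagate (P := fun x => ∃ k ∈ K, ∃ i, k • 𝒯.r i = x)
      fun e _ => ?_).1 ⟨1, K.one_mem, i₀, one_smul _ _⟩
    obtain ⟨j, g, rfl⟩ := 𝒯.ε_surj e
    rw [T.smul_d₀, T.smul_d₁, 𝒯.h₀, 𝒯.h₁, smul_smul]
    constructor
    · rintro ⟨k, hk, i, hi⟩
      have h1 : (k⁻¹ * g) • 𝒯.r (𝒯.o j) = 𝒯.r i := by rw [mul_smul, ← hi, inv_smul_smul]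
      obtain rfl := 𝒯.r_inj _ _ _ h1
      have h2 : g ∈ K := by simpa using K.mul_mem hk (hK _ _ h1)
      exact ⟨_, K.mul_mem h2 (hτ j), _, rfl⟩
    · rintro ⟨k, hk, i, hi⟩
      have h1 : (k⁻¹ * (g * 𝒯.τ j)) • 𝒯.r (𝒯.t j) = 𝒯.r i := by
        rw [mul_smul, ← hi, inv_smul_smul]
      obtain rfl := 𝒯.r_inj _ _ _ h1
      have h2 : g ∈ K := by
        simpa [mul_assoc] using K.mul_mem (K.mul_mem hk (hK _ _ h1)) (K.inv_mem (hτ j))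
      exact ⟨g, h2, _, rfl⟩
  rw [eq_top_iff]
  intro g _
  obtain ⟨k, hk, i, hi⟩ := key (g • 𝒯.r i₀)
  have h1 : (g⁻¹ * k) • 𝒯.r i = 𝒯.r i₀ := by rw [mul_smul, hi, inv_smul_smul]
  obtain rfl := 𝒯.r_inj _ _ _ h1
  simpa using K.mul_mem hk (K.inv_mem (hK _ _ h1))

/-- The splitting given by the stabilizers of the representatives. -/
def toSplitting : Splitting G where
  I := 𝒯.I
  J := 𝒯.J
  o := 𝒯.o
  t := 𝒯.t
  P i := MulAction.stabilizer G (𝒯.r i)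
  Q j := MulAction.stabilizer G (𝒯.ε j)
  τ := 𝒯.τ
  D := 𝒯.D
  le_P := 𝒯.stab_le
  conj_mem := 𝒯.conj_mem
  τ_eq_one := 𝒯.τ_eq_one
  tree := 𝒯.tree
  closure_eq := 𝒯.closure_eq

/-- In `G × M`, let `Γ` be generated by the graphs of the `f i` and the pairs `(τ j, s j)`.
Projection of `Γ` to `G` is bijective, so `Γ` is the graph of the wanted homomorphism. -/
theorem universal : 𝒯.toSplitting.Universal := by
  intro M _ (f : ∀ i : 𝒯.I, MulAction.stabilizer G (𝒯.r i) →* M) (s : 𝒯.J → M) hs hf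
  replace hf (j : 𝒯.J) (q : G) (hq : q ∈ MulAction.stabilizer G (𝒯.ε j)) :
      f (𝒯.o j) ⟨q, 𝒯.stab_le j hq⟩ * s j = s j * f (𝒯.t j) ⟨_, 𝒯.conj_mem j q hq⟩ := hf j q hq
  let graph (i : 𝒯.I) : Subgroup (G × M) :=
    ((MulAction.stabilizer G (𝒯.r i)).subtype.prod (f i)).range
  have hgraph (i p hp) : ((p, f i ⟨p, hp⟩) : G × M) ∈ graph i := ⟨⟨p, hp⟩, rfl⟩
  let X : Set (G × M) := (⋃ i, (graph i : Set (G × M))) ∪ Set.range fun j => (𝒯.τ j, s j)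
  let Γ := Subgroup.closure X
  have hΓ (i) : graph i ≤ Γ := fun p hp =>
    Subgroup.subset_closure (Or.inl (Set.mem_iUnion.2 ⟨i, hp⟩))
  have hτ (j) : (𝒯.τ j, s j) ∈ Γ := Subgroup.subset_closure (Or.inr ⟨j, rfl⟩)
  let Q (j : 𝒯.J) : Subgroup (G × M) := graph (𝒯.o j) ⊓ (MulAction.stabilizer G (𝒯.ε j)).prod ⊤
  have hconj (j) (q : G × M) (hq : q ∈ Q j) :
      (𝒯.τ j, s j)⁻¹ * q * (𝒯.τ j, s j) ∈ graph (𝒯.t j) := by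
    obtain ⟨⟨p, rfl⟩, hq⟩ := hq
    have h1 := hf j p.1 hq.1
    refine ⟨⟨_, 𝒯.conj_mem j p.1 hq.1⟩, Prod.ext rfl ?_⟩
    change f (𝒯.t j) _ = (s j)⁻¹ * f (𝒯.o j) p * s j
    exact (inv_mul_eq_of_eq_mul h1).symm.trans (mul_assoc _ _ _).symm
  let S : Splitting Γ :=
    { I := 𝒯.I
      J := 𝒯.J
      o := 𝒯.o
      t := 𝒯.t
      P := fun i => (graph i).subgroupOf Γ
      Q := fun j => (Q j).subgroupOf Γ
      τ := fun j => ⟨_, hτ j⟩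
      D := 𝒯.D
      le_P := fun j q hq => hq.1
      conj_mem := fun j q hq => hconj j q.1 hq
      τ_eq_one := fun j hj => Subtype.ext (Prod.ext (𝒯.τ_eq_one j hj) (hs j hj))
      tree := 𝒯.tree
      closure_eq := by
        rw [eq_top_iff, ← Subgroup.closure_closure_coe_preimage (k := X)]
        refine Subgroup.closure_mono ?_
        rintro ⟨g, hg⟩ (h | ⟨j, h⟩)
        · obtain ⟨i, hi⟩ := Set.mem_iUnion.1 h
          exact Or.inl (Set.mem_iUnion.2 ⟨i, hi⟩)
        · exact Or.inr ⟨j, Subtype.ext h⟩ }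
  let Φ : Γ →* G := (MonoidHom.fst G M).comp Γ.subtype
  obtain ⟨i₀⟩ := 𝒯.tree.nonempty
  -- An element of the kernel fixes `r i₀`, so `mem_of_fixed` puts it in the graph of `f i₀`, where
  -- the first coordinate determines the second.
  have hinj : Function.Injective Φ := by
    rw [injective_iff_map_eq_one]
    intro g hg
    have := S.mem_of_fixed T Φ 𝒯.r 𝒯.ε 𝒯.h₀ 𝒯.h₁ ?_ (fun j q hq => hq.2.1) 𝒯.ε_inj ?_ ?_
      (i := i₀) (g := g) (by rw [hg, one_smul])
    · obtain ⟨p, hp⟩ := this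
      have h1 : p = 1 := Subtype.ext ((congrArg Prod.fst hp).trans hg)
      rw [h1, map_one] at hp
      exact Subtype.ext hp.symm
    · rintro i g ⟨p, hp⟩
      have : Φ g = p.1 := (congrArg Prod.fst hp).symm
      rw [this]
      exact p.2
    · exact fun j p hp hpj => ⟨hp, hpj, trivial⟩
    · rintro j g ⟨p, hp⟩ hgj
      refine ⟨⟨⟨Φ g, 𝒯.stab_le j hgj⟩, Prod.ext rfl ?_⟩, hgj, trivial⟩
      have h1 := hf j (Φ g) hgj
      have h2 : p = ⟨_, 𝒯.conj_mem j (Φ g) hgj⟩ := Subtype.ext (congrArg Prod.fst hp)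
      have h3 : f (𝒯.t j) p = (s j)⁻¹ * g.1.2 * s j := congrArg Prod.snd hp
      refine mul_right_cancel (b := s j) (h1.trans ?_)
      refine (congrArg (fun x => s j * f (𝒯.t j) x) h2.symm).trans ?_
      change s j * f (𝒯.t j) p = g.1.2 * s j
      rw [h3]
      group
  have hsurj : Function.Surjective Φ := by
    rw [← MonoidHom.range_eq_top, eq_top_iff, ← 𝒯.closure_eq, Subgroup.closure_le]
    rintro g (hg | ⟨j, rfl⟩)
    · obtain ⟨i, hi⟩ := Set.mem_iUnion.1 hg
      exact ⟨⟨_, hΓ i (hgraph i g hi)⟩, rfl⟩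
    · exact ⟨⟨_, hτ j⟩, rfl⟩
  let F := MulEquiv.ofBijective Φ ⟨hinj, hsurj⟩
  refine ⟨((MonoidHom.snd G M).comp Γ.subtype).comp F.symm.toMonoidHom, fun i p => ?_, fun j => ?_⟩
  · have h1 : F.symm (p : G) = ⟨_, hΓ i (hgraph i p p.2)⟩ := F.symm_apply_eq.2 rfl
    change (F.symm (p : G)).1.2 = _
    rw [h1]
    rfl
  · have h1 : F.symm (𝒯.τ j) = ⟨_, hτ j⟩ := F.symm_apply_eq.2 rfl
    change (F.symm (𝒯.τ j)).1.2 = _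
    rw [h1]

end Transversal

theorem Splitting.hom_ext {π : Type u} [Group π] (S : Splitting π) {M : Type*} [Group M]
    {f g : π →* M} (h : ∀ i, ∀ p ∈ S.P i, f p = g p) (hτ : ∀ j, f (S.τ j) = g (S.τ j)) : f = g := by
  refine MonoidHom.eq_of_eqOn_dense S.closure_eq ?_
  rintro x (hx | ⟨j, rfl⟩)
  · obtain ⟨i, hi⟩ := Set.mem_iUnion.1 hx
    exact h i x hi
  · exact hτ j

/-! ### Fundamental groups of graphs of groups -/

namespace GraphOfGroups

variable (𝒢 : GraphOfGroups.{u}) (D : Set 𝒢.E)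

/-- The homomorphism of a vertex group to the fundamental group. -/
def ofVert (v : 𝒢.V) : 𝒢.vertexGroup v →* 𝒢.FundamentalGroup D :=
  (QuotientGroup.mk' _).comp (𝒢.vert v)

/-- The element of the fundamental group given by an edge. -/
def ofEdge (e : 𝒢.E) : 𝒢.FundamentalGroup D := QuotientGroup.mk' _ (𝒢.letter e)

theorem ofEdge_eq_one {e : 𝒢.E} (he : e ∈ D) : 𝒢.ofEdge D e = 1 :=
  (QuotientGroup.eq_one_iff _).2 (Subgroup.subset_normalClosure (Or.inl ⟨e, he, rfl⟩))

theorem ofVert_mul_ofEdge (e : 𝒢.E) (g : 𝒢.edgeGroup e) :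
    𝒢.ofVert D _ (𝒢.bd₀ e g) * 𝒢.ofEdge D e = 𝒢.ofEdge D e * 𝒢.ofVert D _ (𝒢.bd₁ e g) := by
  have h : (QuotientGroup.mk' (Subgroup.normalClosure (𝒢.relators D))) (𝒢.vert _ (𝒢.bd₀ e g) *
      (𝒢.letter e * 𝒢.vert _ (𝒢.bd₁ e g) * (𝒢.letter e)⁻¹)⁻¹) = 1 :=
    (QuotientGroup.eq_one_iff _).2 (Subgroup.subset_normalClosure (Or.inr ⟨e, g, rfl⟩))
  rw [map_mul, map_inv, mul_inv_eq_one, map_mul, map_mul, map_inv] at h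
  exact eq_mul_inv_iff_mul_eq.1 h

variable {M : Type*} [Group M]

/-- The universal property of the fundamental group of a graph of groups. -/
def lift (f : ∀ v, 𝒢.vertexGroup v →* M) (s : 𝒢.E → M) (hs : ∀ e ∈ D, s e = 1)
    (h : ∀ e g, f _ (𝒢.bd₀ e g) * s e = s e * f _ (𝒢.bd₁ e g)) : 𝒢.FundamentalGroup D →* M :=
  QuotientGroup.lift _ (Monoid.Coprod.lift (Monoid.CoprodI.lift f) (FreeGroup.lift s)) (by
    intro x hx
    refine Subgroup.normalClosure_le_normal (N := MonoidHom.ker _) ?_ hx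
    rintro _ (⟨e, he, rfl⟩ | ⟨e, g, rfl⟩)
    · simp [letter, MonoidHom.mem_ker, hs e he]
    · rw [SetLike.mem_coe, MonoidHom.mem_ker]
      simp only [letter, vert, map_mul, map_inv, MonoidHom.comp_apply,
        Monoid.Coprod.lift_apply_inl, Monoid.Coprod.lift_apply_inr, Monoid.CoprodI.lift_of,
        FreeGroup.lift_apply_of]
      rw [mul_inv_eq_one, eq_mul_inv_iff_mul_eq, h])

variable {f : ∀ v, 𝒢.vertexGroup v →* M} {s : 𝒢.E → M} {hs : ∀ e ∈ D, s e = 1}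
  {h : ∀ e g, f _ (𝒢.bd₀ e g) * s e = s e * f _ (𝒢.bd₁ e g)}

theorem lift_ofVert (v : 𝒢.V) (g : 𝒢.vertexGroup v) :
    𝒢.lift D f s hs h (𝒢.ofVert D v g) = f v g := by
  simp [lift, ofVert, vert]

theorem lift_ofEdge (e : 𝒢.E) : 𝒢.lift D f s hs h (𝒢.ofEdge D e) = s e := by
  simp [lift, ofEdge, letter]

theorem closure_eq_top : Subgroup.closure
    ((⋃ v, ((𝒢.ofVert D v).range : Set (𝒢.FundamentalGroup D))) ∪ Set.range (𝒢.ofEdge D)) = ⊤ := by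
  set K := Subgroup.closure
    ((⋃ v, ((𝒢.ofVert D v).range : Set (𝒢.FundamentalGroup D))) ∪ Set.range (𝒢.ofEdge D))
  rw [eq_top_iff]
  rintro x -
  obtain ⟨x, rfl⟩ := QuotientGroup.mk'_surjective _ x
  induction x using Monoid.Coprod.induction_on with
  | inl x =>
    induction x using Monoid.CoprodI.induction_on with
    | one => simp
    | of v g => exact Subgroup.subset_closure (Or.inl (Set.mem_iUnion.2 ⟨v, g, rfl⟩))
    | mul x y hx hy => rw [map_mul, map_mul]; exact K.mul_mem hx hy
  | inr x =>
    induction x using FreeGroup.induction_on with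
    | C1 => simp
    | of e => exact Subgroup.subset_closure (Or.inr ⟨e, rfl⟩)
    | inv_of e he => rw [map_inv, map_inv]; exact K.inv_mem he
    | mul x y hx hy => rw [map_mul, map_mul]; exact K.mul_mem hx hy
  | mul x y hx hy => rw [map_mul]; exact K.mul_mem hx hy

/-- Compatible homomorphisms to a group extend to the fundamental group up to conjugation. -/
theorem exists_hom_conj (hD : 𝒢.IsMaximalSubtree D) (f : ∀ v, 𝒢.vertexGroup v →* M) (s : 𝒢.E → M)
    (h : ∀ e g, f _ (𝒢.bd₀ e g) * s e = s e * f _ (𝒢.bd₁ e g)) :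
    ∃ (R : 𝒢.FundamentalGroup D →* M) (γ : 𝒢.V → M),
      ∀ v g, R (𝒢.ofVert D v g) = γ v * f v g * (γ v)⁻¹ := by
  -- Conjugating the vertex homomorphisms by a potential for `s` makes the letters of the maximal
  -- subtree trivial.
  obtain ⟨γ, hγ⟩ := hD.isTree.exists_potential (fun e => s e)
  refine ⟨𝒢.lift D (fun v => (MulAut.conj (γ v)).toMonoidHom.comp (f v))
    (fun e => γ (𝒢.d₀ e) * s e * (γ (𝒢.d₁ e))⁻¹) (fun e he => ?_) (fun e g => ?_), γ, fun v g => ?_⟩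
  · rw [hγ ⟨e, he⟩, mul_inv_cancel]
  · change γ _ * f _ (𝒢.bd₀ e g) * (γ _)⁻¹ * _ = _ * (γ _ * f _ (𝒢.bd₁ e g) * (γ _)⁻¹)
    have := h e g
    calc _ = γ (𝒢.d₀ e) * (f _ (𝒢.bd₀ e g) * s e) * (γ (𝒢.d₁ e))⁻¹ := by group
      _ = _ := by rw [this]; group
  · rw [lift_ofVert]; rfl

end GraphOfGroups

/-! ### Conjugate free permutation actions -/

section Intertwiner

variable {A Ω : Type*} [Group A]

/-- The orbit relation of a group of permutations. -/
def orbitSetoid (α : A →* Equiv.Perm Ω) : Setoid Ω where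
  r x y := ∃ a, α a y = x
  iseqv := by
    refine ⟨fun x => ⟨1, by simp⟩, ?_, ?_⟩
    · rintro x y ⟨a, rfl⟩
      exact ⟨a⁻¹, by simp⟩
    · rintro x y z ⟨a, rfl⟩ ⟨b, rfl⟩
      exact ⟨a * b, by simp⟩

/-- A free action is a product of the group with the set of orbits. -/
theorem exists_equiv_of_free (α : A →* Equiv.Perm Ω) (h : ∀ a x, α a x = x → a = 1) :
    ∃ F : A × Quotient (orbitSetoid α) ≃ Ω, ∀ a b q, F (a * b, q) = α a (F (b, q)) := by
  refine ⟨Equiv.ofBijective (fun p => α p.1 p.2.out) ⟨?_, ?_⟩, fun a b q => ?_⟩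
  · rintro ⟨a, q⟩ ⟨b, q'⟩ hab
    have hab : α a q.out = α b q'.out := hab
    have h1 : q = q' := by
      rw [← Quotient.out_eq q, ← Quotient.out_eq q']
      exact Quotient.sound ⟨a⁻¹ * b, by simp [← hab]⟩
    subst h1
    have h2 : b⁻¹ * a = 1 := h _ q.out (by simp [hab])
    rw [Prod.mk.injEq]
    exact ⟨(inv_mul_eq_one.1 h2).symm, rfl⟩
  · intro x
    obtain ⟨a, ha⟩ := Quotient.exact (Quotient.out_eq (Quotient.mk (orbitSetoid α) x)).symm
    exact ⟨(a, Quotient.mk _ x), ha⟩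
  · change α (a * b) _ = α a (α b _)
    rw [map_mul, Equiv.Perm.mul_apply]

/-- Two free actions with equally many orbits are conjugate. -/
theorem exists_intertwiner (α β : A →* Equiv.Perm Ω) (hα : ∀ a x, α a x = x → a = 1)
    (hβ : ∀ a x, β a x = x → a = 1)
    (e : Nonempty (Quotient (orbitSetoid β) ≃ Quotient (orbitSetoid α))) :
    ∃ s : Equiv.Perm Ω, ∀ a, α a * s = s * β a := by
  obtain ⟨e⟩ := e
  obtain ⟨F, hF⟩ := exists_equiv_of_free α hα
  obtain ⟨F', hF'⟩ := exists_equiv_of_free β hβ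
  refine ⟨F'.symm.trans ((Equiv.prodCongr (Equiv.refl A) e).trans F), fun a => ?_⟩
  ext x
  obtain ⟨⟨b, q⟩, rfl⟩ := F'.surjective x
  simp [← hF', ← hF]

end Intertwiner

namespace GraphOfGroups

/-- The action of a factor of a product of groups on the product by left multiplication. -/
def factorAction {I : Type*} {K : I → Type*} [∀ i, Group (K i)] [DecidableEq I] (Z : Type*) (i : I) :
    K i →* Equiv.Perm ((∀ i, K i) × Z) where
  toFun g := Equiv.prodCongr (Equiv.mulLeft (Pi.mulSingle i g)) (Equiv.refl Z)
  map_one' := by ext x <;> simp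
  map_mul' g h := by ext x <;> simp [Pi.mulSingle_mul, mul_assoc]

theorem factorAction_free {I : Type*} {K : I → Type*} [∀ i, Group (K i)] [DecidableEq I]
    (Z : Type*) (i : I) (g : K i) (x) (h : factorAction Z i g x = x) : g = 1 := by
  have h1 : Pi.mulSingle i g * x.1 = x.1 := congrArg Prod.fst h
  have h2 := congrFun h1 i
  simpa using h2

variable (𝒢 : GraphOfGroups.{u}) (D : Set 𝒢.E)

/-- The vertex groups embed in the fundamental group. -/
theorem ofVert_injective (hD : 𝒢.IsMaximalSubtree D) (v : 𝒢.V) :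
    Function.Injective (𝒢.ofVert D v) := by
  classical
  -- All vertex groups act freely on `Pr × Z` through the factor `Pr`. The infinite set `Z` has the
  -- cardinality of the whole set, so both restrictions to an edge group have equally many orbits
  -- and are conjugate. The action thus extends, up to conjugation, to the fundamental group.
  let Pr := ∀ v, 𝒢.vertexGroup v
  let Z := ℕ × Pr
  have key {A : Type u} [Group A] (α : A →* Equiv.Perm (Pr × Z))
      (hα : ∀ a x, (α a x).2 = x.2) :
      Cardinal.mk (Quotient (orbitSetoid α)) = Cardinal.mk (Pr × Z) := by
    apply le_antisymm (Cardinal.mk_le_of_surjective (f := Quotient.mk (orbitSetoid α)) Quotient.mk_surjective)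
    have h1 : Cardinal.mk (Pr × Z) = Cardinal.mk Z := by
      have h2 : Cardinal.mk Pr ≤ Cardinal.mk Z :=
        Cardinal.mk_le_of_injective (f := fun p => ((0, p) : Z)) fun a b h => congrArg Prod.snd h
      rw [← Cardinal.mul_def]
      have h3 : Cardinal.aleph0 ≤ Cardinal.mk Z := Cardinal.aleph0_le_mk Z
      exact Cardinal.mul_eq_right h3 h2 (Cardinal.mk_ne_zero Pr)
    rw [h1]
    refine Cardinal.mk_le_of_injective (f := fun z => Quotient.mk (orbitSetoid α) (1, z)) ?_
    intro z z' h
    obtain ⟨a, ha⟩ := Quotient.exact h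
    have := hα a (1, z')
    rw [ha] at this
    exact this
  have hs (e : 𝒢.E) : ∃ s : Equiv.Perm (Pr × Z), ∀ g,
      factorAction Z _ (𝒢.bd₀ e g) * s = s * factorAction Z _ (𝒢.bd₁ e g) := by
    refine exists_intertwiner ((factorAction Z _).comp (𝒢.bd₀ e))
      ((factorAction Z _).comp (𝒢.bd₁ e)) ?_ ?_ ?_
    · exact fun a x h => (map_eq_one_iff _ (𝒢.bd₀_injective e)).1 (factorAction_free Z _ _ x h)
    · exact fun a x h => (map_eq_one_iff _ (𝒢.bd₁_injective e)).1 (factorAction_free Z _ _ x h)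
    · rw [← Cardinal.eq, key, key] <;> exact fun a x => rfl
  choose s hs using hs
  obtain ⟨R, γ, hR⟩ := 𝒢.exists_hom_conj D hD (fun v => factorAction Z v) s hs
  rw [injective_iff_map_eq_one]
  intro g hg
  have h1 := hR v g
  rw [hg, map_one] at h1
  have h2 : factorAction Z v g = 1 := by
    have := congrArg (fun x => (γ v)⁻¹ * x * γ v) h1
    simpa [mul_assoc] using this.symm
  exact factorAction_free Z v g (1, (0, 1)) (by rw [h2]; rfl)

/-- The fundamental group of a graph of groups as a splitting. -/
def splitting (hD : 𝒢.IsMaximalSubtree D) : Splitting (𝒢.FundamentalGroup D) where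
  I := 𝒢.V
  J := 𝒢.E
  o := 𝒢.d₀
  t := 𝒢.d₁
  P v := (𝒢.ofVert D v).range
  Q e := ((𝒢.ofVert D _).comp (𝒢.bd₀ e)).range
  τ := 𝒢.ofEdge D
  D := D
  le_P e := by
    rintro _ ⟨g, rfl⟩
    exact ⟨_, rfl⟩
  conj_mem e := by
    rintro _ ⟨g, rfl⟩
    refine ⟨𝒢.bd₁ e g, ?_⟩
    rw [mul_assoc]
    exact (inv_mul_eq_of_eq_mul (𝒢.ofVert_mul_ofEdge D e g)).symm
  τ_eq_one e he := 𝒢.ofEdge_eq_one D he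
  tree := hD.isTree
  closure_eq := 𝒢.closure_eq_top D

theorem splitting_universal (hD : 𝒢.IsMaximalSubtree D) : (𝒢.splitting D hD).Universal := by
  intro M _ f s hs h
  refine ⟨𝒢.lift D (fun v => (f v).comp (𝒢.ofVert D v).rangeRestrict) s hs ?_, ?_, ?_⟩
  · intro e g
    have h1 := h e _ ⟨g, rfl⟩
    have h2 : (𝒢.ofVert D _).rangeRestrict (𝒢.bd₁ e g) = ⟨_, (𝒢.splitting D hD).conj_mem e _ ⟨g, rfl⟩⟩ := by
      refine Subtype.ext ?_
      change _ = (𝒢.ofEdge D e)⁻¹ * 𝒢.ofVert D _ (𝒢.bd₀ e g) * 𝒢.ofEdge D e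
      rw [mul_assoc]
      exact (inv_mul_eq_of_eq_mul (𝒢.ofVert_mul_ofEdge D e g)).symm
    exact Eq.trans h1 (congrArg (fun x => s e * f (𝒢.d₁ e) x) h2.symm)
  · rintro v ⟨_, ⟨g, rfl⟩⟩
    exact 𝒢.lift_ofVert D v g
  · exact fun e => 𝒢.lift_ofEdge D e

end GraphOfGroups

end FiniteSplitting

namespace FiniteSplitting

/-! ### Orbit representatives and the groups they present -/

namespace GTree

variable {G : Type u} [Group G]

/-- Representatives exist for trees with finitely many orbits. -/
theorem Cofinite.exists_transversal {T : GTree G} (hT : T.Cofinite) :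
    ∃ 𝒯 : Transversal T, Finite 𝒯.I ∧ Finite 𝒯.J := by
  classical
  have hV := hT.vertices
  have hE : Finite (MulAction.orbitRel.Quotient G T.E) := hT
  let B (R : Set T.V) : Set T.E := {e | T.d₀ e ∈ R ∧ T.d₁ e ∈ R}
  -- A largest connected set of pairwise inequivalent vertices is the lift of a maximal subtree; by
  -- maximality every neighbour of it is equivalent to one of its members.
  let Good (R : Set T.V) : Prop := R.Nonempty ∧ (∀ x ∈ R, ∀ y ∈ R, Link T.d₀ T.d₁ (B R) x y) ∧
    ∀ x ∈ R, ∀ y ∈ R, ∀ g : G, g • x = y → x = y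
  let m : T.V → MulAction.orbitRel.Quotient G T.V := Quotient.mk _
  have hm (R) (hR : Good R) : Set.InjOn m R := fun x hx y hy h => by
    obtain ⟨g, hg⟩ := Quotient.exact h
    exact (hR.2.2 y hy x hx g hg).symm
  have hfin (R) (hR : Good R) : R.Finite := Set.Finite.of_finite_image (Set.toFinite _) (hm R hR)
  have hbd (R) (hR : Good R) : R.ncard ≤ Nat.card (MulAction.orbitRel.Quotient G T.V) := by
    rw [← (hm R hR).ncard_image, ← Set.ncard_univ]
    exact Set.ncard_le_ncard (Set.subset_univ _)
  obtain ⟨R, hR, hmax⟩ : ∃ R, Good R ∧ ∀ R', Good R' → R'.ncard ≤ R.ncard := by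
    obtain ⟨o⟩ := T.isTree.nonempty
    have h1 : Good {o} := by
      refine ⟨⟨o, rfl⟩, ?_, ?_⟩
      · rintro _ rfl _ rfl; exact Link.refl _
      · rintro _ rfl _ rfl _ _; rfl
    let N := {k | ∃ R, Good R ∧ R.ncard = k}
    have hN : BddAbove N := ⟨_, by rintro _ ⟨R, hR, rfl⟩; exact hbd R hR⟩
    obtain ⟨R, hR, h2⟩ := Nat.sSup_mem (s := N) ⟨_, {o}, h1, rfl⟩ hN
    exact ⟨R, hR, fun R' hR' => h2 ▸ le_csSup hN ⟨R', hR', rfl⟩⟩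
  have hext (x y : T.V) (hx : x ∈ R) (e : T.E) (he : Inc T.d₀ T.d₁ e x y) :
      ∃ g : G, g • y ∈ R := by
    by_contra! hy
    have h1 : y ∉ R := by simpa using hy 1
    have hsub : B R ⊆ B (insert y R) := fun f hf => ⟨Or.inr hf.1, Or.inr hf.2⟩
    have h2 : ∀ z ∈ R, Link T.d₀ T.d₁ (B (insert y R)) z y := fun z hz =>
      ((hR.2.1 z hz x hx).mono hsub).trans (Link.of_inc (by
        rcases he with ⟨h, h'⟩ | ⟨h, h'⟩
        · exact ⟨h ▸ Or.inr hx, h' ▸ Or.inl rfl⟩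
        · exact ⟨h ▸ Or.inl rfl, h' ▸ Or.inr hx⟩) he)
    have h3 : Good (insert y R) := by
      refine ⟨⟨y, Or.inl rfl⟩, ?_, ?_⟩
      · rintro a (rfl | ha) b (rfl | hb)
        · exact Link.refl _
        · exact (h2 b hb).symm
        · exact h2 a ha
        · exact (h2 a ha).trans (h2 b hb).symm
      · rintro a (rfl | ha) b (rfl | hb) g hg
        · rfl
        · exact (hy g (hg ▸ hb)).elim
        · exact (hy g⁻¹ (by rw [← hg, inv_smul_smul]; exact ha)).elim
        · exact hR.2.2 a ha b hb g hg
    have := hmax _ h3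
    rw [Set.ncard_insert_of_notMem h1 (hfin R hR)] at this
    omega
  have hcov (x : T.V) : ∃ g : G, g • x ∈ R := by
    obtain ⟨o, ho⟩ := hR.1
    have step (x y : T.V) (e : T.E) (he : Inc T.d₀ T.d₁ e x y) (h : ∃ g : G, g • x ∈ R) :
        ∃ g : G, g • y ∈ R := by
      obtain ⟨g, hg⟩ := h
      obtain ⟨g', hg'⟩ := hext _ _ hg _ (T.smul_inc g he)
      exact ⟨g' * g, by rwa [mul_smul]⟩
    exact ((T.isTree.connected o x).propagate (P := fun x => ∃ g : G, g • x ∈ R) fun e _ =>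
      ⟨step _ _ e (inc_self e), step _ _ e (inc_self e).symm⟩).1 ⟨1, by rwa [one_smul]⟩
  have hRfin : Finite R := (hfin R hR).to_subtype
  -- The indices are taken in `Fin` because a `Transversal`, like a graph of groups, has index sets
  -- in `Type`.
  obtain ⟨n, ⟨eI⟩⟩ := Finite.exists_equiv_fin R
  obtain ⟨k, ⟨eJ⟩⟩ := Finite.exists_equiv_fin (MulAction.orbitRel.Quotient G T.E)
  let r : Fin n → T.V := fun i => eI.symm i
  have hr (i) : r i ∈ R := (eI.symm i).2
  have hr' (x) (hx : x ∈ R) : ∃ i, r i = x := ⟨eI ⟨x, hx⟩, by simp [r]⟩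
  have hr_inj : Function.Injective r := Subtype.val_injective.comp eI.symm.injective
  have hex (q : MulAction.orbitRel.Quotient G T.E) : ∃ (e : T.E) (o t : Fin n) (τ : G),
      Quotient.mk _ e = q ∧ T.d₀ e = r o ∧ T.d₁ e = τ • r t ∧
      ∀ e' ∈ B R, Quotient.mk _ e' = q → e' = e ∧ τ = 1 := by
    -- An orbit with an edge inside `R` is represented by that edge, unique because vertices of `R`
    -- are inequivalent, with letter `1`. Otherwise the initial vertex is moved into `R` and the
    -- letter carries the terminal one.
    by_cases h : ∃ e' ∈ B R, Quotient.mk _ e' = q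
    · obtain ⟨e, he, rfl⟩ := h
      obtain ⟨o, ho⟩ := hr' _ he.1
      obtain ⟨t, ht⟩ := hr' _ he.2
      refine ⟨e, o, t, 1, rfl, ho.symm, by rw [one_smul, ht], fun e' he' h => ⟨?_, rfl⟩⟩
      obtain ⟨g, rfl⟩ := Quotient.exact h
      have h1 := hR.2.2 _ he.1 _ he'.1 g (T.smul_d₀ g e).symm
      have h2 := hR.2.2 _ he.2 _ he'.2 g (T.smul_d₁ g e).symm
      exact T.isTree.edge_unique (inc_self _) (Or.inl ⟨h1, h2⟩)
    · push Not at h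
      obtain ⟨e, rfl⟩ := Quotient.exists_rep q
      obtain ⟨g, hg⟩ := hcov (T.d₀ e)
      obtain ⟨g', hg'⟩ := hcov (T.d₁ (g • e))
      obtain ⟨o, ho⟩ := hr' _ hg
      obtain ⟨t, ht⟩ := hr' _ hg'
      refine ⟨g • e, o, t, g'⁻¹, Quotient.sound ⟨g, rfl⟩, ?_, ?_, fun e' he' h' => (h e' he' h').elim⟩
      · rw [T.smul_d₀, ho]
      · rw [ht, inv_smul_smul]
  choose ε o t τ hε ho ht hB using hex
  let D : Set (Fin k) := {j | ∃ e' ∈ B R, Quotient.mk _ e' = eJ.symm j}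
  have hD (j) (hj : j ∈ D) : τ (eJ.symm j) = 1 := by
    obtain ⟨e', he', h⟩ := hj
    exact (hB _ e' he' h).2
  have hDt (j) (hj : j ∈ D) : r (t (eJ.symm j)) = T.d₁ (ε (eJ.symm j)) := by
    rw [ht, hD j hj, one_smul]
  have hεinj (q q') (g : G) (h : g • ε q = ε q') : q = q' := by
    rw [← hε q, ← hε q', ← h]
    exact Quotient.sound ⟨g⁻¹, by simp⟩
  refine ⟨{
    I := Fin n
    J := Fin k
    r := r
    ε := fun j => ε (eJ.symm j)
    o := fun j => o (eJ.symm j)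
    t := fun j => t (eJ.symm j)
    τ := fun j => τ (eJ.symm j)
    D := D
    h₀ := fun j => ho _
    h₁ := fun j => ht _
    r_surj := fun x => by
      obtain ⟨g, hg⟩ := hcov x
      obtain ⟨i, hi⟩ := hr' _ hg
      exact ⟨i, g⁻¹, by rw [hi, inv_smul_smul]⟩
    r_inj := fun i i' g h => hr_inj (hR.2.2 _ (hr i) _ (hr i') g h)
    ε_surj := fun e => by
      obtain ⟨g, hg⟩ := Quotient.exact (hε (Quotient.mk _ e))
      refine ⟨eJ (Quotient.mk _ e), g⁻¹, ?_⟩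
      rw [Equiv.symm_apply_apply, ← hg, inv_smul_smul]
    ε_inj := fun j j' g h => eJ.symm.injective (hεinj _ _ g h)
    τ_eq_one := hD
    tree := ?_ }, (inferInstance : Finite (Fin n)), (inferInstance : Finite (Fin k))⟩
  refine ⟨?_, fun v w => ?_, fun j hj => ?_⟩
  · obtain ⟨x, hx⟩ := hR.1
    exact ⟨eI ⟨x, hx⟩⟩
  · let f : T.V → Fin n := fun x => if h : x ∈ R then eI ⟨x, h⟩ else v
    have hf (i) : f (r i) = i := by simp [f, r]
    rw [← hf v, ← hf w]
    refine (hR.2.1 _ (hr v) _ (hr w)).map f fun e he => ?_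
    have hj : eJ (Quotient.mk _ e) ∈ D := ⟨e, he, by simp⟩
    have h1 := (hB _ e he rfl).1
    have h2 := hDt _ hj
    rw [Equiv.symm_apply_apply, ← h1] at h2
    have h3 := ho (Quotient.mk _ e)
    rw [← h1] at h3
    rw [h3, ← h2, hf, hf]
    exact Link.of_inc (e := (⟨_, hj⟩ : D)) trivial (Or.inl ⟨by simp, by simp⟩)
  -- A path in the index graph that avoids `j` lifts through `r` to a path in `T` that avoids `ε`.
  · refine T.isTree.bridge (ε (eJ.symm j)) ?_
    rw [ho, ← hDt j j.2]
    refine hj.map r fun j' hj' => ?_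
    rw [hDt _ j'.2, ← ho]
    refine Link.edge fun h => hj' ?_
    exact Subtype.ext (eJ.symm.injective (hεinj _ _ 1 ((one_smul _ _).trans h)))

end GTree

namespace Splitting

variable {π : Type u} [Group π] (S : Splitting π)

/-- The graph of groups of a splitting. -/
abbrev graphOfGroups : GraphOfGroups.{u} where
  V := S.I
  E := S.J
  d₀ := S.o
  d₁ := S.t
  vertexGroup i := S.P i
  edgeGroup j := S.Q j
  bd₀ j := Subgroup.inclusion (S.le_P j)
  bd₁ j :=
    { toFun := fun q => ⟨_, S.conj_mem j q q.2⟩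
      map_one' := Subtype.ext (by simp)
      map_mul' := fun a b => Subtype.ext (by simp [mul_assoc]) }
  bd₀_injective j := Subgroup.inclusion_injective _
  bd₁_injective j a b h := by
    have : (S.τ j)⁻¹ * a * S.τ j = (S.τ j)⁻¹ * b * S.τ j := congrArg Subtype.val h
    exact Subtype.ext (by simpa using this)

/-- A group with a splitting is the fundamental group of the graph of groups. -/
theorem nonempty_mulEquiv (h : S.Universal) :
    Nonempty (π ≃* S.graphOfGroups.FundamentalGroup S.D) := by
  let 𝒢 := S.graphOfGroups
  let A : 𝒢.FundamentalGroup S.D →* π := 𝒢.lift S.D (fun i => (S.P i).subtype) S.τ S.τ_eq_one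
    (fun j q => by
      change (q : π) * S.τ j = S.τ j * ((S.τ j)⁻¹ * q * S.τ j)
      rw [mul_assoc, mul_inv_cancel_left])
  have hA (i) (p : S.P i) : A (𝒢.ofVert S.D i p) = p := 𝒢.lift_ofVert S.D i p
  have hAτ (j) : A (𝒢.ofEdge S.D j) = S.τ j := 𝒢.lift_ofEdge S.D j
  obtain ⟨R, hR, hRτ⟩ := h (𝒢.FundamentalGroup S.D) (fun i => 𝒢.ofVert S.D i) (𝒢.ofEdge S.D)
    (fun j hj => 𝒢.ofEdge_eq_one S.D hj) (fun j q hq => 𝒢.ofVert_mul_ofEdge S.D j ⟨q, hq⟩)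
  refine ⟨MonoidHom.toMulEquiv R A (S.hom_ext (fun i p hp => ?_) fun j => ?_)
    (MonoidHom.eq_of_eqOn_dense (𝒢.closure_eq_top S.D) ?_)⟩
  · exact (congrArg A (hR i ⟨p, hp⟩)).trans (hA i ⟨p, hp⟩)
  · exact (congrArg A (hRτ j)).trans (hAτ j)
  · rintro x (hx | ⟨j, rfl⟩)
    · obtain ⟨i, hi⟩ := Set.mem_iUnion.1 hx
      obtain ⟨p, rfl⟩ := hi
      exact (congrArg R (hA i p)).trans (hR i p)
    · exact (congrArg R (hAτ j)).trans (hRτ j)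

end Splitting

/-- The graph with two vertices and one edge is a tree. -/
theorem isTree_segment : IsTree (fun _ : (Set.univ : Set Unit) => (0 : Fin 2))
    (fun _ : (Set.univ : Set Unit) => (1 : Fin 2)) where
  nonempty := ⟨0⟩
  connected v w := by
    have h : Link (fun _ : (Set.univ : Set Unit) => (0 : Fin 2))
      (fun _ : (Set.univ : Set Unit) => (1 : Fin 2)) Set.univ 0 1 := Link.edge (e := ⟨(), trivial⟩) trivial
    fin_cases v <;> fin_cases w
    exacts [Link.refl _, h, h.symm, Link.refl _]
  bridge e h := by
    have := h.propagate (P := fun x => x = 0) fun f hf => (hf (Subsingleton.elim f e)).elim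
    simp at this

theorem isTree_point : IsTree (fun _ : (∅ : Set Unit) => ()) (fun _ : (∅ : Set Unit) => ()) where
  nonempty := ⟨()⟩
  connected _ _ := Link.refl _
  bridge e := e.2.elim

namespace GTree

variable {G : Type u} [Group G] (T : GTree G)

theorem stab_le_ends (e : T.E) (i : Fin 2) :
    MulAction.stabilizer G e ≤ MulAction.stabilizer G (![T.d₀ e, T.d₁ e] i) := by
  intro g hg
  rw [MulAction.mem_stabilizer_iff] at *
  fin_cases i
  · exact T.smul_d₀_of_smul hg
  · exact T.smul_d₁_of_smul hg

/-- A group that acts with a segment as quotient is an amalgamated free product. -/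
theorem nonempty_mulEquiv_pushout (e : T.E) (he : ∀ e' : T.E, ∃ g : G, g • e = e')
    (hn : ∀ g : G, g • T.d₀ e ≠ T.d₁ e) :
    Nonempty (G ≃* Monoid.PushoutI fun i => Subgroup.inclusion (T.stab_le_ends e i)) := by
  let 𝒯 : Transversal T :=
    { I := Fin 2
      J := Unit
      r := ![T.d₀ e, T.d₁ e]
      ε := fun _ => e
      o := fun _ => 0
      t := fun _ => 1
      τ := fun _ => 1
      D := Set.univ
      h₀ := fun _ => rfl
      h₁ := fun _ => (one_smul _ _).symm
      r_surj := fun x => by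
        by_cases hx : x = T.d₀ e
        · exact ⟨0, 1, by rw [hx]; exact one_smul _ _⟩
        · obtain ⟨f, z, hf, -⟩ := T.isTree.exists_step hx
          obtain ⟨g, rfl⟩ := he f
          rcases hf with ⟨h, -⟩ | ⟨-, h⟩
          · exact ⟨0, g, by rw [← h, T.smul_d₀]; rfl⟩
          · exact ⟨1, g, by rw [← h, T.smul_d₁]; rfl⟩
      r_inj := fun i i' g h => by
        fin_cases i <;> fin_cases i'
        · rfl
        · exact (hn g h).elim
        · exact (hn g⁻¹ (inv_smul_eq_iff.2 h.symm)).elim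
        · rfl
      ε_surj := fun e' => ⟨(), he e'⟩
      ε_inj := fun _ _ _ _ => rfl
      τ_eq_one := fun _ _ => rfl
      tree := isTree_segment }
  let φ := fun i => Subgroup.inclusion (T.stab_le_ends e i)
  let A : Monoid.PushoutI φ →* G := Monoid.PushoutI.lift (fun i => Subgroup.subtype _)
    (Subgroup.subtype _) (fun i => rfl)
  obtain ⟨R, hR, -⟩ := 𝒯.universal (Monoid.PushoutI φ) (fun i : Fin 2 => Monoid.PushoutI.of (φ := φ) i) (fun _ => 1)
    (fun _ _ => rfl) (fun j q hq => by
      refine (mul_one _).trans (Eq.trans ?_ (one_mul _).symm)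
      refine (Monoid.PushoutI.of_apply_eq_base φ 0 ⟨q, hq⟩).trans
        ((Monoid.PushoutI.of_apply_eq_base φ 1 ⟨q, hq⟩).symm.trans (congrArg _ ?_))
      refine Subtype.ext ?_
      change q = 1⁻¹ * q * 1
      simp)
  have hA (i p) : A (Monoid.PushoutI.of i p) = p := Monoid.PushoutI.lift_of _ _ _ _
  refine ⟨MonoidHom.toMulEquiv R A (𝒯.toSplitting.hom_ext (fun i p hp => ?_) fun j => ?_)
    (Monoid.PushoutI.hom_ext_nonempty fun i => MonoidHom.ext fun p => ?_)⟩
  · exact (congrArg A (hR i ⟨p, hp⟩)).trans (hA i ⟨p, hp⟩)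
  · exact (map_one _).trans (map_one _).symm
  · exact (congrArg R (hA i p)).trans (hR i p)

/-- A group that acts with a loop as quotient is an HNN-extension. -/
theorem nonempty_mulEquiv_hnn (e : T.E) (he : ∀ e' : T.E, ∃ g : G, g • e = e')
    (τ : G) (hτ : T.d₁ e = τ • T.d₀ e) (hfin : Finite (MulAction.stabilizer G e)) :
    ∃ (A B : Subgroup (MulAction.stabilizer G (T.d₀ e))) (φ : A ≃* B), Finite A ∧
      Nonempty (G ≃* HNNExtension (MulAction.stabilizer G (T.d₀ e)) A B φ) := by
  let 𝒯 : Transversal T :=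
    { I := Unit
      J := Unit
      r := fun _ => T.d₀ e
      ε := fun _ => e
      o := fun _ => ()
      t := fun _ => ()
      τ := fun _ => τ
      D := ∅
      h₀ := fun _ => rfl
      h₁ := fun _ => hτ
      r_surj := fun x => by
        by_cases hx : x = T.d₀ e
        · exact ⟨(), 1, by rw [hx, one_smul]⟩
        · obtain ⟨f, z, hf, -⟩ := T.isTree.exists_step hx
          obtain ⟨g, rfl⟩ := he f
          rcases hf with ⟨h, -⟩ | ⟨-, h⟩
          · exact ⟨(), g, by rw [← h, T.smul_d₀]⟩
          · exact ⟨(), g * τ, by rw [← h, T.smul_d₁, hτ, mul_smul]⟩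
      r_inj := fun _ _ _ _ => rfl
      ε_surj := fun e' => ⟨(), he e'⟩
      ε_inj := fun _ _ _ _ => rfl
      τ_eq_one := fun _ h => h.elim
      tree := isTree_point }
  let P := MulAction.stabilizer G (T.d₀ e)
  let Q := MulAction.stabilizer G e
  -- In `HNNExtension` the relation is `t * a = φ a * t`. Hence the edge stabilizer is `B`, and `A`
  -- is its conjugate by `τ⁻¹`.
  let A : Subgroup P := (Q.comap (MulAut.conj τ).toMonoidHom).subgroupOf P
  let B : Subgroup P := Q.subgroupOf P
  have hA (a : A) : τ * a.1.1 * τ⁻¹ ∈ Q := a.2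
  let φ : A ≃* B :=
    { toFun := fun a => ⟨⟨τ * a.1.1 * τ⁻¹, 𝒯.stab_le () (hA a)⟩, hA a⟩
      invFun := fun b => ⟨⟨τ⁻¹ * b.1.1 * τ, 𝒯.conj_mem () b.1.1 b.2⟩, by
        change τ * (τ⁻¹ * b.1.1 * τ) * τ⁻¹ ∈ Q
        have : τ * (τ⁻¹ * b.1.1 * τ) * τ⁻¹ = b.1.1 := by group
        rw [this]
        exact b.2⟩
      left_inv := fun a => Subtype.ext (Subtype.ext (by
        change τ⁻¹ * (τ * a.1.1 * τ⁻¹) * τ = a.1.1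
        simp [mul_assoc]))
      right_inv := fun a => Subtype.ext (Subtype.ext (by
        change τ * (τ⁻¹ * a.1.1 * τ) * τ⁻¹ = a.1.1
        simp [mul_assoc]))
      map_mul' := fun a b => Subtype.ext (Subtype.ext (by
        change τ * (a.1.1 * b.1.1) * τ⁻¹ = (τ * a.1.1 * τ⁻¹) * (τ * b.1.1 * τ⁻¹)
        simp [mul_assoc])) }
  have hφ (a : A) : ((φ a : P) : G) = τ * a.1.1 * τ⁻¹ := rfl
  let F : HNNExtension P A B φ →* G := HNNExtension.lift P.subtype τ (fun a => by
    change τ * a.1.1 = (φ a : P).1 * τ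
    rw [hφ]; simp)
  obtain ⟨R, hR, hRτ⟩ := 𝒯.universal (HNNExtension P A B φ) (fun i => HNNExtension.of)
    (fun _ => HNNExtension.t)
    (fun _ h => h.elim) (fun j q hq => by
      let b : B := ⟨⟨q, 𝒯.stab_le () hq⟩, hq⟩
      exact HNNExtension.of_mul_t b)
  have hF (p) : F (HNNExtension.of p) = p := HNNExtension.lift_of _ _ _ _
  have hFt : F HNNExtension.t = τ := HNNExtension.lift_t _ _ _
  refine ⟨A, B, φ, ?_, ⟨MonoidHom.toMulEquiv R F
    (𝒯.toSplitting.hom_ext (fun i p hp => ?_) fun j => ?_) (HNNExtension.hom_ext ?_ ?_)⟩⟩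
  · refine Finite.of_injective (β := Q) (fun a => ⟨_, hA a⟩) fun a b h => ?_
    have : τ * a.1.1 * τ⁻¹ = τ * b.1.1 * τ⁻¹ := congrArg Subtype.val h
    exact Subtype.ext (Subtype.ext (by simpa using this))
  · exact (congrArg F (hR i ⟨p, hp⟩)).trans (hF ⟨p, hp⟩)
  · exact (congrArg F (hRτ j)).trans hFt
  · exact MonoidHom.ext fun p => (congrArg R (hF p)).trans (hR () p)
  · exact (congrArg R hFt).trans (hRτ ())

end GTree

/-! ### Trees of amalgamated free products and HNN-extensions -/

section Pushout

variable {K : Fin 2 → Type u} [∀ i, Group (K i)] {H : Type u} [Group H] (φ : ∀ i, H →* K i)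

/-- An amalgamated free product as a splitting. -/
def pushoutSplitting : Splitting (Monoid.PushoutI φ) where
  I := Fin 2
  J := Unit
  o := fun _ => 0
  t := fun _ => 1
  P i := (Monoid.PushoutI.of i).range
  Q _ := (Monoid.PushoutI.base φ).range
  τ _ := 1
  D := Set.univ
  le_P j := by
    rintro _ ⟨h, rfl⟩
    exact ⟨φ 0 h, Monoid.PushoutI.of_apply_eq_base φ 0 h⟩
  conj_mem j := by
    rintro _ ⟨h, rfl⟩
    exact ⟨φ 1 h, by rw [Monoid.PushoutI.of_apply_eq_base]; simp⟩
  τ_eq_one _ _ := rfl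
  tree := isTree_segment
  closure_eq := by
    rw [eq_top_iff]
    rintro x -
    induction x using Monoid.PushoutI.induction_on with
    | of i g => exact Subgroup.subset_closure (Or.inl (Set.mem_iUnion.2 ⟨i, g, rfl⟩))
    | base h =>
      rw [← Monoid.PushoutI.of_apply_eq_base φ 0]
      exact Subgroup.subset_closure (Or.inl (Set.mem_iUnion.2 ⟨0, _, rfl⟩))
    | mul x y hx hy => exact Subgroup.mul_mem _ hx hy

theorem pushoutSplitting_universal : (pushoutSplitting φ).Universal := by
  intro M _ (f : ∀ i : Fin 2, (Monoid.PushoutI.of (φ := φ) i).range →* M) s hs h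
  let f' (i : Fin 2) : K i →* M := MonoidHom.comp (f i) (Monoid.PushoutI.of (φ := φ) i).rangeRestrict
  have h1 (x : H) : f' 0 (φ 0 x) = f' 1 (φ 1 x) := by
    have h2 := h () (Monoid.PushoutI.base φ x) ⟨x, rfl⟩
    rw [hs () trivial, mul_one, one_mul] at h2
    have h3 : (Monoid.PushoutI.of (φ := φ) 0).rangeRestrict (φ 0 x) =
        ⟨Monoid.PushoutI.base φ x, (pushoutSplitting φ).le_P () ⟨x, rfl⟩⟩ :=
      Subtype.ext (Monoid.PushoutI.of_apply_eq_base φ 0 x)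
    have h4 : (Monoid.PushoutI.of (φ := φ) 1).rangeRestrict (φ 1 x) =
        ⟨_, (pushoutSplitting φ).conj_mem () (Monoid.PushoutI.base φ x) ⟨x, rfl⟩⟩ := by
      refine Subtype.ext ?_
      change Monoid.PushoutI.of (φ := φ) 1 (φ 1 x) = 1⁻¹ * _ * 1
      rw [Monoid.PushoutI.of_apply_eq_base]; simp
    exact (congrArg (f 0) h3).trans (h2.trans (congrArg (f 1) h4).symm)
  refine ⟨Monoid.PushoutI.lift f' ((f' 0).comp (φ 0)) (fun i => ?_), ?_, fun j => ?_⟩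
  · fin_cases i
    · rfl
    · exact MonoidHom.ext fun x => (h1 x).symm
  · rintro i ⟨_, ⟨g, rfl⟩⟩
    exact Monoid.PushoutI.lift_of _ _ _ _
  · rw [hs j trivial]; exact map_one _

end Pushout

section HNN

variable {K : Type u} [Group K] {A B : Subgroup K} (φ : A ≃* B)

/-- An HNN-extension as a splitting. -/
def hnnSplitting : Splitting (HNNExtension K A B φ) where
  I := Unit
  J := Unit
  o := fun _ => ()
  t := fun _ => ()
  P i := HNNExtension.of.range
  Q _ := B.map HNNExtension.of
  τ _ := HNNExtension.t
  D := ∅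
  le_P j := by
    rintro _ ⟨h, -, rfl⟩
    exact ⟨h, rfl⟩
  conj_mem j := by
    rintro _ ⟨h, hb, rfl⟩
    refine ⟨φ.symm ⟨h, hb⟩, ?_⟩
    rw [mul_assoc, eq_inv_mul_iff_mul_eq]
    exact (HNNExtension.of_mul_t ⟨h, hb⟩).symm
  τ_eq_one _ h := h.elim
  tree := isTree_point
  closure_eq := by
    rw [eq_top_iff]
    rintro x -
    induction x using HNNExtension.induction_on with
    | of g => exact Subgroup.subset_closure (Or.inl (Set.mem_iUnion.2 ⟨(), g, rfl⟩))
    | t => exact Subgroup.subset_closure (Or.inr ⟨(), rfl⟩)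
    | mul x y hx hy => exact Subgroup.mul_mem _ hx hy
    | inv x hx => exact Subgroup.inv_mem _ hx

theorem hnnSplitting_universal : (hnnSplitting φ).Universal := by
  intro M _ f s hs h
  let f' : K →* M := MonoidHom.comp (f ()) (HNNExtension.of (φ := φ)).rangeRestrict
  refine ⟨HNNExtension.lift f' (s ()) (fun a => ?_), ?_, fun j => ?_⟩
  · have h2 := h () (HNNExtension.of (φ a : K)) ⟨_, (φ a).2, rfl⟩
    refine Eq.trans ?_ h2.symm
    refine congrArg (fun x => s () * f () x) (Subtype.ext ?_)
    change HNNExtension.of (a : K) = HNNExtension.t⁻¹ * HNNExtension.of (φ a : K) * HNNExtension.t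
    rw [mul_assoc, eq_inv_mul_iff_mul_eq, HNNExtension.t_mul_of]
  · rintro i ⟨_, ⟨g, rfl⟩⟩
    exact HNNExtension.lift_of _ _ _ _
  · exact HNNExtension.lift_t _ _ _

end HNN

end FiniteSplitting

namespace FiniteSplitting

/-! ### Finite generation -/

theorem exists_finite_mem_closure {G : Type*} [Group G] {U : Set G} {g : G}
    (hg : g ∈ Subgroup.closure U) : ∃ U₀ ⊆ U, U₀.Finite ∧ g ∈ Subgroup.closure U₀ := by
  induction hg using Subgroup.closure_induction with
  | mem x hx =>
    exact ⟨{x}, Set.singleton_subset_iff.2 hx, Set.finite_singleton x,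
      Subgroup.subset_closure rfl⟩
  | one => exact ⟨∅, Set.empty_subset _, Set.finite_empty, Subgroup.one_mem _⟩
  | mul a b _ _ ha hb =>
    obtain ⟨A, hA, hA', ha⟩ := ha
    obtain ⟨B, hB, hB', hb⟩ := hb
    exact ⟨A ∪ B, Set.union_subset hA hB, hA'.union hB', Subgroup.mul_mem _
      (Subgroup.closure_mono Set.subset_union_left ha)
      (Subgroup.closure_mono Set.subset_union_right hb)⟩
  | inv a _ ha =>
    obtain ⟨A, hA, hA', ha⟩ := ha
    exact ⟨A, hA, hA', Subgroup.inv_mem _ ha⟩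

namespace GTree

variable {G : Type u} [Group G] {T : GTree G}

/-- Vertex stabilizers in a finitely generated group are finitely generated if the edge stabilizers
are finite. -/
theorem Cofinite.fg_stabilizer (hT : T.Cofinite) (hE : T.FiniteEdges) [hG : Group.FG G]
    (v : T.V) : Group.FG (MulAction.stabilizer G v) := by
  obtain ⟨𝒯, hI, hJ⟩ := hT.exists_transversal
  obtain ⟨S, hS, hSfin⟩ := Group.fg_iff.1 hG
  have h1 (s : G) := exists_finite_mem_closure (𝒯.closure_eq.symm ▸ Subgroup.mem_top s)
  choose U hU hUfin hUs using h1
  let U₀ : Set G := ⋃ s ∈ S, U s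
  have hU₀ : U₀.Finite := hSfin.biUnion fun s _ => hUfin s
  -- The finitely many elements needed to write a generating set of `G` in stabilizers and letters,
  -- together with the finite adjacent edge groups.
  let X (i : 𝒯.I) : Set G := (U₀ ∩ MulAction.stabilizer G (𝒯.r i)) ∪
    (⋃ j ∈ {j | 𝒯.o j = i}, (MulAction.stabilizer G (𝒯.ε j) : Set G)) ∪
    (⋃ j ∈ {j | 𝒯.t j = i}, (fun q => (𝒯.τ j)⁻¹ * q * 𝒯.τ j) '' (MulAction.stabilizer G (𝒯.ε j) : Set G))
  have hQ (j) : (MulAction.stabilizer G (𝒯.ε j) : Set G).Finite := by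
    have := hE (𝒯.ε j)
    exact Set.toFinite _
  have hX (i) : (X i).Finite := ((hU₀.inter_of_left _).union
    ((Set.toFinite _).biUnion fun j _ => hQ j)).union
      ((Set.toFinite _).biUnion fun j _ => (hQ j).image _)
  have hle (i) : Subgroup.closure (X i) ≤ MulAction.stabilizer G (𝒯.r i) := by
    rw [Subgroup.closure_le]
    rintro x ((hx | hx) | hx)
    · exact hx.2
    · simp only [Set.mem_iUnion] at hx
      obtain ⟨j, rfl, hx⟩ := hx
      exact 𝒯.stab_le j hx
    · simp only [Set.mem_iUnion] at hx
      obtain ⟨j, rfl, q, hq, rfl⟩ := hx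
      exact 𝒯.conj_mem j q hq
  let S' : Splitting G :=
    { I := 𝒯.I
      J := 𝒯.J
      o := 𝒯.o
      t := 𝒯.t
      P := fun i => Subgroup.closure (X i)
      Q := fun j => MulAction.stabilizer G (𝒯.ε j)
      τ := 𝒯.τ
      D := 𝒯.D
      le_P := fun j q hq => Subgroup.subset_closure (Or.inl (Or.inr (by
        simp only [Set.mem_iUnion]; exact ⟨j, rfl, hq⟩)))
      conj_mem := fun j q hq => Subgroup.subset_closure (Or.inr (by
        simp only [Set.mem_iUnion]; exact ⟨j, rfl, q, hq, rfl⟩))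
      τ_eq_one := 𝒯.τ_eq_one
      tree := 𝒯.tree
      closure_eq := by
        rw [eq_top_iff, ← hS, Subgroup.closure_le]
        intro s hs
        refine Subgroup.closure_le _ |>.2 ?_ (hUs s)
        intro x hx
        refine Subgroup.subset_closure ?_
        rcases hU s hx with h | h
        · obtain ⟨i, hi⟩ := Set.mem_iUnion.1 h
          exact Or.inl (Set.mem_iUnion.2 ⟨i, Subgroup.subset_closure
            (Or.inl (Or.inl ⟨Set.mem_biUnion hs hx, hi⟩))⟩)
        · exact Or.inr h }
  obtain ⟨i, g, rfl⟩ := 𝒯.r_surj v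
  have h2 : MulAction.stabilizer G (𝒯.r i) = Subgroup.closure (X i) := by
    refine le_antisymm (fun g hg => ?_) (hle i)
    -- The subgroups generated by the `X i` and the letters form a splitting of `G` over the same
    -- edge groups, so comparison with `T` shows that they exhaust the stabilizers.
    exact S'.mem_of_fixed T (MonoidHom.id G) 𝒯.r 𝒯.ε 𝒯.h₀ 𝒯.h₁ (fun i p hp => hle i hp)
      (fun j q hq => hq) 𝒯.ε_inj (fun j p _ hp => hp) (fun j p _ hp => hp) hg
  rw [Group.fg_iff_subgroup_fg, MulAction.stabilizer_smul_eq_stabilizer_map_conj, h2,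
    MonoidHom.map_closure]
  exact ⟨((hX i).image (MulEquiv.toMonoidHom (MulAut.conj g))).toFinset, by
    rw [Set.Finite.coe_toFinset]⟩

/-- A cofinite invariant subtree through `v` has the same stabilizer of `v`. -/
theorem FiniteEdges.fg_stabilizer (hE : T.FiniteEdges) [Group.FG G] (v : T.V) :
    Group.FG (MulAction.stabilizer G v) := by
  obtain ⟨D, hD, hx, h⟩ := T.exists_component_cofinite v
  let v' : (T.component D hD v hx).V := ⟨v, Link.refl v⟩
  have := h.fg_stabilizer hE.component v'
  rwa [T.component_stab_V v'] at this

/-- A group is finitely generated if it acts on a tree with finitely many orbits and finitely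
generated vertex stabilizers. -/
theorem Cofinite.fg (hT : T.Cofinite) (h : ∀ v : T.V, Group.FG (MulAction.stabilizer G v)) :
    Group.FG G := by
  obtain ⟨𝒯, hI, hJ⟩ := hT.exists_transversal
  have h1 : (⨆ i, MulAction.stabilizer G (𝒯.r i)) ⊔ Subgroup.closure (Set.range 𝒯.τ) = ⊤ := by
    rw [← 𝒯.closure_eq, Subgroup.closure_union, Subgroup.closure_iUnion]
    simp
  rw [Group.fg_def, ← h1]
  exact (Subgroup.FG.iSup _ fun i => (Group.fg_iff_subgroup_fg _).1 (h _)).sup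
    ⟨(Set.finite_range 𝒯.τ).toFinset, by simp⟩

end GTree

end FiniteSplitting

namespace FiniteSplitting

/-! ### Signed crossings -/

namespace IsTree

variable {V E : Type*} {d₀ d₁ : E → V} (hT : IsTree d₀ d₁)

open Classical in
/-- The indicator function of the side of an edge. -/
noncomputable def sideInd (d₀ d₁ : E → V) (e : E) (x : V) : ℤ := if Side d₀ d₁ e x then 1 else 0

open Classical in
/-- The signed number of crossings of edges in `O` on the way from `x` to `y`. -/
noncomputable def cross (d₀ d₁ : E → V) (O : Set E) (x y : V) : ℤ :=
  ∑ᶠ e, if e ∈ O then sideInd d₀ d₁ e y - sideInd d₀ d₁ e x else 0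

open Classical in
theorem support_cross (O : Set E) (x y : V) :
    (Function.support fun e => if e ∈ O then sideInd d₀ d₁ e y - sideInd d₀ d₁ e x else 0) =
      O ∩ Sep d₀ d₁ x y := by
  ext e
  simp only [Function.mem_support, mem_sep, Set.mem_inter_iff, sideInd]
  by_cases h : e ∈ O <;> by_cases h1 : Side d₀ d₁ e x <;> by_cases h2 : Side d₀ d₁ e y <;>
    simp [h, h1, h2]

include hT

theorem cross_add (O : Set E) (x y z : V) :
    cross d₀ d₁ O x y + cross d₀ d₁ O y z = cross d₀ d₁ O x z := by
  classical
  rw [cross, cross, ← finsum_add_distrib]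
  · refine finsum_congr fun e => ?_
    split_ifs <;> ring
  · rw [Function.HasFiniteSupport, support_cross]; exact (hT.sep_finite _ _).inter_of_right _
  · rw [Function.HasFiniteSupport, support_cross]; exact (hT.sep_finite _ _).inter_of_right _

omit hT in
theorem cross_self (O : Set E) (x : V) : cross d₀ d₁ O x x = 0 := by
  simp [cross]

omit hT in
/-- If the number of crossings is even then there is not just one. -/
theorem exists_ne_of_even_cross {O : Set E} {x y : V} (h : Even (cross d₀ d₁ O x y)) {e : E}
    (he : e ∈ Sep d₀ d₁ x y) (heO : e ∈ O) : ∃ f ∈ Sep d₀ d₁ x y, f ∈ O ∧ f ≠ e := by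
  classical
  by_contra! hne
  rw [cross, finsum_eq_single _ e] at h
  · simp only [heO, if_true, sideInd] at h
    rw [mem_sep] at he
    by_cases h1 : Side d₀ d₁ e x <;> by_cases h2 : Side d₀ d₁ e y <;> simp_all
  · intro f hf
    by_contra h0
    have : f ∈ O ∩ Sep d₀ d₁ x y := by rw [← support_cross]; exact h0
    exact hf (hne f this.2 this.1)

end IsTree

open IsTree

namespace GTree

variable {G : Type u} [Group G] (T : GTree G)

theorem cross_smul {O : Set T.E} (g : G) (hO : ∀ e, g • e ∈ O ↔ e ∈ O) (x y : T.V) :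
    cross T.d₀ T.d₁ O (g • x) (g • y) = cross T.d₀ T.d₁ O x y := by
  classical
  rw [cross, ← finsum_comp_equiv (MulAction.toPerm g), cross]
  refine finsum_congr fun e => ?_
  simp only [MulAction.toPerm_apply, hO, sideInd, T.smul_side]

/-- The signed number of crossings of an invariant set of edges, as a homomorphism. -/
noncomputable def crossHom (H : Subgroup G) {O : Set T.E} (hO : ∀ g ∈ H, ∀ e, g • e ∈ O ↔ e ∈ O)
    (x : T.V) : H →* Multiplicative ℤ where
  toFun g := Multiplicative.ofAdd (cross T.d₀ T.d₁ O x (g • x))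
  map_one' := by rw [one_smul, cross_self]; rfl
  map_mul' g h := by
    rw [← ofAdd_add, ← T.isTree.cross_add O x (g • x), mul_smul]
    congr 2
    exact T.cross_smul (g : G) (hO g g.2) x (h • x)

/-- The crossings between `x` and `y` and those between `g • x` and `g • y` cancel, so the count
does not depend on the base point. -/
theorem cross_smul_self (H : Subgroup G) {O : Set T.E} (hO : ∀ g ∈ H, ∀ e, g • e ∈ O ↔ e ∈ O)
    (x y : T.V) {g : G} (hg : g ∈ H) :
    cross T.d₀ T.d₁ O x (g • x) = cross T.d₀ T.d₁ O y (g • y) := by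
  rw [← T.isTree.cross_add O x y, ← T.isTree.cross_add O y (g • y) (g • x), T.cross_smul g (hO g hg),
    add_comm, add_assoc, T.isTree.cross_add, cross_self, add_zero]

/-- The elements of `H` that cross every `H`-orbit of edges in `F` an even number of times. -/
theorem exists_even_subgroup (H : Subgroup G) [H.FiniteIndex] {F : Set T.E} (hF : F.Finite) :
    ∃ N ≤ H, N.FiniteIndex ∧ ∀ g ∈ N, ∀ f ∈ F, ∀ x,
      Even (cross T.d₀ T.d₁ {e | ∃ h ∈ H, h • f = e} x (g • x)) := by
  obtain ⟨o⟩ := T.isTree.nonempty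
  have hO (f : T.E) : ∀ g ∈ H, ∀ e, g • e ∈ {e | ∃ h ∈ H, h • f = e} ↔ e ∈ {e | ∃ h ∈ H, h • f = e} := by
    intro g hg e
    constructor
    · rintro ⟨h, hh, he⟩
      exact ⟨g⁻¹ * h, H.mul_mem (H.inv_mem hg) hh, by rw [mul_smul, he, inv_smul_smul]⟩
    · rintro ⟨h, hh, rfl⟩
      exact ⟨g * h, H.mul_mem hg hh, mul_smul _ _ _⟩
  -- Crossing numbers modulo 2 of the orbit of `f`. There are finitely many of these homomorphisms,
  -- and the subgroup is their common kernel.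
  let c (f : T.E) : H →* Multiplicative (ZMod 2) :=
    (AddMonoidHom.toMultiplicative (Int.castAddHom (ZMod 2))).comp (T.crossHom H (hO f) o)
  have := hF.to_subtype
  let K : Subgroup H := ⨅ f : F, (c f).ker
  have : K.FiniteIndex := Subgroup.finiteIndex_iInf fun f => Subgroup.finiteIndex_ker _
  refine ⟨K.map H.subtype, Subgroup.map_subtype_le K, ?_, ?_⟩
  · rw [Subgroup.finiteIndex_iff, Subgroup.index_map_subtype]
    exact mul_ne_zero (Subgroup.FiniteIndex.index_ne_zero) (Subgroup.FiniteIndex.index_ne_zero)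
  · rintro _ ⟨g, hg, rfl⟩ f hf x
    have h1 : c f g = 1 := (Subgroup.mem_iInf.1 hg ⟨f, hf⟩ : _)
    have h2 : ((cross T.d₀ T.d₁ {e | ∃ h ∈ H, h • f = e} o (g • o) : ℤ) : ZMod 2) = 0 := h1
    rw [Subgroup.subtype_apply, T.cross_smul_self H (hO f) x o g.2]
    exact (ZMod.intCast_eq_zero_iff_even).1 h2

/-- If `F` is finite and a subgroup of finite index contains no nontrivial elliptic element that maps
an edge in `F` into `F`, then a deeper subgroup contains only elements that fix `x` or move it so
that some edge outside of `F` is crossed. -/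
theorem exists_finiteIndex_of_elliptic {F : Set T.E} (hF : F.Finite) (N : Subgroup G) [hN : N.FiniteIndex]
    (h : ∀ n ∈ N, ∀ v : T.V, n • v = v → ∀ f ∈ F, n • f ∈ F → n = 1) (k : ℕ) :
    ∃ M ≤ N, M.FiniteIndex ∧ ∀ n ∈ M, ∀ x : T.V, Sep T.d₀ T.d₁ x (n • x) ⊆ F →
      (Sep T.d₀ T.d₁ x (n • x)).ncard ≤ k → n • x = x := by
  induction k with
  | zero =>
    refine ⟨N, le_rfl, hN, fun n _ x _ hk => ?_⟩
    rw [Nat.le_zero, ← tdist, T.isTree.tdist_eq_zero] at hk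
    exact hk.symm
  | succ k ih =>
    obtain ⟨M, hMN, hM, hk⟩ := ih
    -- Parity forces a nontrivial path from `x` to `n • x` with `n ∈ M'` to cross a second edge `m •
    -- f ≠ f` with `m ∈ M`.
    obtain ⟨M', hM', hM'fin, heven⟩ := T.exists_even_subgroup M hF
    refine ⟨M', hM'.trans hMN, hM'fin, fun n hn x hxF hcard => ?_⟩
    by_contra hne
    obtain ⟨f, hf⟩ : (Sep T.d₀ T.d₁ x (n • x)).Nonempty := by
      rw [Set.nonempty_iff_ne_empty]
      exact fun h => hne (T.isTree.eq_of_sep_eq_empty h).symm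
    obtain ⟨_, hf', ⟨m, hm, rfl⟩, hff'⟩ := exists_ne_of_even_cross (heven n hn f (hxF hf) x) hf
      ⟨1, M.one_mem, one_smul _ _⟩
    -- `z` is an end of `f` such that the path from `z` to `m • z` avoids `f`. This path lies in the
    -- original one and is shorter, so by induction `m` fixes `z`. Then `m` is elliptic and keeps an
    -- edge within `F`, hence trivial.
    obtain ⟨z, z', hz, hzs⟩ : ∃ z z', Inc T.d₀ T.d₁ f z z' ∧ f ∉ Sep T.d₀ T.d₁ z (m • z) := by
      have h1 := side_congr (d₀ := T.d₀) (d₁ := T.d₁) hff'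
      rw [T.smul_d₀, T.smul_d₁] at h1
      by_cases hs : Side T.d₀ T.d₁ f (m • T.d₁ f)
      · exact ⟨_, _, (inc_self f).symm, by simp [mem_sep, hs, side_d₁]⟩
      · exact ⟨_, _, inc_self f, by simp [mem_sep, h1, hs, T.isTree.not_side_d₀]⟩
    have hbt {e : T.E} (he : e ∈ Sep T.d₀ T.d₁ x (n • x)) {z z' : T.V} (hz : Inc T.d₀ T.d₁ e z z') :
        Sep T.d₀ T.d₁ x z ⊆ Sep T.d₀ T.d₁ x (n • x) := by
      by_cases hx : e ∈ Sep T.d₀ T.d₁ x z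
      · have h1 : e ∉ Sep T.d₀ T.d₁ x z' := by
          have h2 : e ∈ Sep T.d₀ T.d₁ z z' := by rw [T.isTree.sep_inc hz]; rfl
          rw [mem_sep] at *
          grind
        have h3 := T.isTree.sep_subset_of_mem he hz.symm h1
        refine (sep_subset_union x z' z).trans (Set.union_subset (h3.trans Set.sdiff_subset) ?_)
        rw [T.isTree.sep_inc hz.symm]
        exact Set.singleton_subset_iff.2 he
      · exact (T.isTree.sep_subset_of_mem he hz hx).trans Set.sdiff_subset
    have hsub : Sep T.d₀ T.d₁ z (m • z) ⊆ Sep T.d₀ T.d₁ x (n • x) := by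
      refine (sep_subset_union z x (m • z)).trans (Set.union_subset ?_ (hbt hf' (T.smul_inc m hz)))
      rw [sep_comm]
      exact hbt hf hz
    have hlt : (Sep T.d₀ T.d₁ z (m • z)).ncard < (Sep T.d₀ T.d₁ x (n • x)).ncard :=
      Set.ncard_lt_ncard ⟨hsub, fun h => hzs (h hf)⟩ (T.isTree.sep_finite _ _)
    have hmz := hk m hm z (hsub.trans hxF) (by omega)
    have := h m (hMN hm) z hmz f (hxF hf) (hxF hf')
    exact hff' (by rw [this, one_smul])

end GTree

/-! ### Residual finiteness -/

/-- Compatible homomorphisms on a splitting extend up to conjugation. -/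
theorem Splitting.Universal.exists_hom_conj {π : Type u} [Group π] {S : Splitting π}
    (hS : S.Universal) {M : Type u} [Group M] (f : ∀ i, S.P i →* M) (s : S.J → M)
    (h : ∀ j q (hq : q ∈ S.Q j), f (S.o j) ⟨q, S.le_P j hq⟩ * s j =
      s j * f (S.t j) ⟨_, S.conj_mem j q hq⟩) :
    ∃ (R : π →* M) (γ : S.I → M), ∀ i (p : S.P i), R p = γ i * f i p * (γ i)⁻¹ := by
  obtain ⟨γ, hγ⟩ := S.tree.exists_potential (fun e => s e)
  obtain ⟨R, hR, -⟩ := hS M (fun v => (MulAut.conj (γ v)).toMonoidHom.comp (f v))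
    (fun e => γ (S.o e) * s e * (γ (S.t e))⁻¹)
    (fun e he => by rw [hγ ⟨e, he⟩, mul_inv_cancel])
    (fun e q hq => by
      have := h e q hq
      change (γ (S.o e) * _ * (γ (S.o e))⁻¹) * _ = _ * (γ (S.t e) * _ * (γ (S.t e))⁻¹)
      calc _ = γ (S.o e) * (f (S.o e) ⟨q, S.le_P e hq⟩ * s e) * (γ (S.t e))⁻¹ := by group
        _ = _ := by rw [this]; group)
  exact ⟨R, γ, hR⟩

theorem exists_normal_avoiding {G : Type*} [Group G] [Group.ResiduallyFinite G] {F : Set G}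
    (hF : F.Finite) (h1 : 1 ∉ F) :
    ∃ N : Subgroup G, N.Normal ∧ N.FiniteIndex ∧ ∀ x ∈ F, x ∉ N := by
  have (x : F) : ∃ N : Subgroup G, N.Normal ∧ N.FiniteIndex ∧ x.1 ∉ N := by
    obtain ⟨N, hN⟩ := Group.exists_finiteIndexNormalSubgroup_notMem x.1 (fun h => h1 (h ▸ x.2))
    exact ⟨N.toSubgroup, inferInstance, inferInstance, hN⟩
  choose N hN hN' hx using this
  have := hF.to_subtype
  exact ⟨⨅ x, N x, Subgroup.normal_iInf_normal hN, Subgroup.finiteIndex_iInf hN',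
    fun x hxF h => hx ⟨x, hxF⟩ (Subgroup.mem_iInf.1 h _)⟩

/-- For a free action on a finite set, the number of orbits is determined by the orders of the set
and the group. -/
theorem exists_intertwiner_of_finite {A Ω : Type*} [Group A] [Finite Ω]
    (α β : A →* Equiv.Perm Ω) (hα : ∀ a x, α a x = x → a = 1)
    (hβ : ∀ a x, β a x = x → a = 1) : ∃ s : Equiv.Perm Ω, ∀ a, α a * s = s * β a := by
  refine exists_intertwiner α β hα hβ ?_
  cases isEmpty_or_nonempty Ω with
  | inl h =>
    have h1 : IsEmpty (Quotient (orbitSetoid β)) := ⟨fun q => h.elim q.out⟩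
    have h2 : IsEmpty (Quotient (orbitSetoid α)) := ⟨fun q => h.elim q.out⟩
    exact ⟨Equiv.equivOfIsEmpty _ _⟩
  | inr h =>
    obtain ⟨F, -⟩ := exists_equiv_of_free α hα
    obtain ⟨F', -⟩ := exists_equiv_of_free β hβ
    have : Finite A := by
      obtain ⟨x⟩ := h
      refine Finite.of_injective (fun a => α a x) fun a b hab => ?_
      have := hα (b⁻¹ * a) x (by
        change α a x = α b x at hab
        rw [map_mul, Equiv.Perm.mul_apply, hab, ← Equiv.Perm.mul_apply, ← map_mul, inv_mul_cancel,
          map_one, Equiv.Perm.one_apply])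
      exact (inv_mul_eq_one.1 this).symm
    have h1 := Nat.card_congr F
    have h2 := Nat.card_congr F'
    rw [← h1, Nat.card_prod, Nat.card_prod] at h2
    have := Finite.of_surjective _ (Quotient.mk_surjective (s := orbitSetoid α))
    have := Finite.of_surjective _ (Quotient.mk_surjective (s := orbitSetoid β))
    exact ⟨(Finite.equivFin _).trans ((finCongr (Nat.eq_of_mul_eq_mul_left Nat.card_pos h2)).trans
      (Finite.equivFin _).symm)⟩

namespace GTree

variable {G : Type u} [Group G] {T : GTree G}

/-- Nontrivial elements of residually finite vertex stabilizers survive in a finite quotient. -/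
theorem Cofinite.exists_finiteIndex_of_elliptic (hT : T.Cofinite) (hE : T.FiniteEdges)
    (hV : ∀ v : T.V, Group.ResiduallyFinite (MulAction.stabilizer G v)) {v : T.V} {a : G}
    (hav : a • v = v) (ha : a ≠ 1) : ∃ N : Subgroup G, N.FiniteIndex ∧ a ∉ N := by
  classical
  obtain ⟨𝒯, hI, hJ⟩ := hT.exists_transversal
  obtain ⟨i₀, g, rfl⟩ := 𝒯.r_surj v
  have hb : g⁻¹ * a * g ∈ MulAction.stabilizer G (𝒯.r i₀) := by
    rw [MulAction.mem_stabilizer_iff, mul_smul, mul_smul, hav, inv_smul_smul]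
  let P (i : 𝒯.I) := MulAction.stabilizer G (𝒯.r i)
  -- The elements to keep alive in a finite quotient of each vertex group: the given one, moved to a
  -- representative, and both images of all edge groups.
  let X (i : 𝒯.I) : Set G := {g⁻¹ * a * g} ∪
    (⋃ j : 𝒯.J, (MulAction.stabilizer G (𝒯.ε j) : Set G)) ∪
    (⋃ j : 𝒯.J, (fun q => (𝒯.τ j)⁻¹ * q * 𝒯.τ j) '' (MulAction.stabilizer G (𝒯.ε j) : Set G))
  have hX (i) : (X i).Finite := by
    have h (j : 𝒯.J) : (MulAction.stabilizer G (𝒯.ε j) : Set G).Finite := by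
      have := hE (𝒯.ε j)
      exact Set.toFinite _
    exact ((Set.finite_singleton _).union (Set.finite_iUnion h)).union
      (Set.finite_iUnion fun j => (h j).image _)
  have hN (i : 𝒯.I) : ∃ N : Subgroup (P i), N.Normal ∧ N.FiniteIndex ∧
      ∀ x : P i, x.1 ∈ X i → x ≠ 1 → x ∉ N := by
    have := hV (𝒯.r i)
    obtain ⟨N, h1, h2, h3⟩ := exists_normal_avoiding (G := P i) (F := {x | x.1 ∈ X i ∧ x ≠ 1})
      (((hX i).preimage Subtype.val_injective.injOn).subset fun x hx => hx.1) (by simp)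
    exact ⟨N, h1, h2, fun x hx hx1 => h3 x ⟨hx, hx1⟩⟩
  choose N hNn hNf hN using hN
  let K (i : 𝒯.I) := P i ⧸ N i
  have hK (i : 𝒯.I) : Finite (K i) := Subgroup.finite_quotient_of_finiteIndex
  -- Edge groups embed in the finite quotients `K i`, so they act freely on the finite set `Ω`;
  -- intertwiners then glue the vertex actions to a finite permutation representation of `G`.
  let Ω := (∀ i, K i) × Unit
  let f (i : 𝒯.I) : P i →* Equiv.Perm Ω :=
    (GraphOfGroups.factorAction Unit i).comp (QuotientGroup.mk' (N i))
  have hf (i) (x : P i) (hx : x.1 ∈ X i) (ω : Ω) (h : f i x ω = ω) : x = 1 := by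
    by_contra hx1
    exact hN i x hx hx1 ((QuotientGroup.eq_one_iff x).1
      (GraphOfGroups.factorAction_free Unit i _ ω h))
  have hs (j : 𝒯.J) : ∃ s : Equiv.Perm Ω, ∀ q : MulAction.stabilizer G (𝒯.ε j),
      f (𝒯.o j) ⟨q, 𝒯.stab_le j q.2⟩ * s = s * f (𝒯.t j) ⟨_, 𝒯.conj_mem j q q.2⟩ := by
    let q₀ : MulAction.stabilizer G (𝒯.ε j) →* P (𝒯.o j) := Subgroup.inclusion (𝒯.stab_le j)
    let q₁ : MulAction.stabilizer G (𝒯.ε j) →* P (𝒯.t j) :=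
      { toFun := fun q => ⟨_, 𝒯.conj_mem j q q.2⟩
        map_one' := Subtype.ext (by simp)
        map_mul' := fun a b => Subtype.ext (by simp [mul_assoc]) }
    refine exists_intertwiner_of_finite ((f _).comp q₀) ((f _).comp q₁) ?_ ?_
    · intro q ω h
      have := hf _ _ (Or.inl (Or.inr (Set.mem_iUnion.2 ⟨j, q.2⟩))) ω h
      exact Subtype.ext (congrArg (fun x : P (𝒯.o j) => x.1) this)
    · intro q ω h
      have := hf _ _ (Or.inr (Set.mem_iUnion.2 ⟨j, q, q.2, rfl⟩)) ω h
      have h1 : (𝒯.τ j)⁻¹ * q * 𝒯.τ j = 1 := congrArg Subtype.val this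
      refine Subtype.ext ?_
      rwa [mul_assoc, inv_mul_eq_one, eq_comm, mul_eq_right] at h1
  choose s hs using hs
  obtain ⟨R, γ, hR⟩ := 𝒯.universal.exists_hom_conj f s fun j q hq => hs j ⟨q, hq⟩
  refine ⟨R.ker, Subgroup.finiteIndex_ker R, fun h => ha ?_⟩
  have h1 : R (g⁻¹ * a * g) = 1 := by
    rw [map_mul, map_mul, MonoidHom.mem_ker.1 h, mul_one, ← map_mul, inv_mul_cancel, map_one]
  have h2 := (hR i₀ ⟨_, hb⟩).symm.trans h1
  rw [mul_inv_eq_one, mul_eq_left] at h2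
  have h3 := hf i₀ ⟨_, hb⟩ (Or.inl (Or.inl rfl)) (1, ()) (DFunLike.congr_fun h2 _)
  have h4 : g⁻¹ * a * g = 1 := congrArg Subtype.val h3
  rwa [mul_assoc, inv_mul_eq_one, eq_comm, mul_eq_right] at h4

/-- A group is residually finite if it acts on a tree with finitely many orbits, finite edge
stabilizers and residually finite vertex stabilizers. -/
theorem Cofinite.residuallyFinite (hT : T.Cofinite) (hE : T.FiniteEdges)
    (hV : ∀ v : T.V, Group.ResiduallyFinite (MulAction.stabilizer G v)) :
    Group.ResiduallyFinite G := by
  rw [Group.residuallyFinite_iff_exists_finiteIndex]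
  intro g hg
  obtain ⟨o⟩ := T.isTree.nonempty
  by_cases hgo : g • o = o
  · exact hT.exists_finiteIndex_of_elliptic hE hV hgo hg
  let F := Sep T.d₀ T.d₁ o (g • o)
  have hF : F.Finite := T.isTree.sep_finite _ _
  -- The nontrivial elliptic elements carrying an edge of the path back into the path. Finite edge
  -- stabilizers make this set finite, so a finite-index subgroup avoids it by the elliptic case.
  let Z : Set G := {n | (∃ f ∈ F, n • f ∈ F) ∧ n ≠ 1 ∧ ∃ v : T.V, n • v = v}
  have hZ : Z.Finite := by
    have h1 (p : T.E × T.E) : {n : G | n • p.1 = p.2}.Finite := by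
      by_cases h : ∃ m : G, m • p.1 = p.2
      · obtain ⟨m, hm⟩ := h
        have := hE p.1
        refine ((Set.toFinite (MulAction.stabilizer G p.1 : Set G)).image (m * ·)).subset ?_
        intro n hn
        refine ⟨m⁻¹ * n, ?_, mul_inv_cancel_left _ _⟩
        rw [SetLike.mem_coe, MulAction.mem_stabilizer_iff, mul_smul, hn, ← hm, inv_smul_smul]
      · convert Set.finite_empty (α := G)
        ext n
        exact ⟨fun hn => h ⟨n, hn⟩, fun hn => hn.elim⟩
    refine ((hF.prod hF).biUnion fun p _ => h1 p).subset ?_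
    rintro n ⟨⟨f, hf, hf'⟩, -⟩
    exact Set.mem_biUnion (show (f, n • f) ∈ F ×ˢ F from ⟨hf, hf'⟩) rfl
  have h2 (n : Z) : ∃ N : Subgroup G, N.FiniteIndex ∧ n.1 ∉ N := by
    obtain ⟨n, -, hn, v, hv⟩ := n
    exact hT.exists_finiteIndex_of_elliptic hE hV hv hn
  choose N hN hnN using h2
  have := hZ.to_subtype
  have : (⨅ n, N n).FiniteIndex := Subgroup.finiteIndex_iInf hN
  obtain ⟨M, -, hM, h⟩ := T.exists_finiteIndex_of_elliptic hF (⨅ n, N n)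
    (fun n hn v hv f hf hnf => by
      by_contra h1
      exact hnN ⟨n, ⟨f, hf, hnf⟩, h1, v, hv⟩ (Subgroup.mem_iInf.1 hn _)) F.ncard
  exact ⟨M, hM, fun hgM => hgo (h g hgM o subset_rfl le_rfl)⟩

end GTree

end FiniteSplitting

namespace FiniteSplitting

/-! ### Ends -/

section Ends

open SimpleGraph

/-- An ultrafilter that contains the complements of finite sets determines an end. -/
theorem exists_end_of_ultrafilter {V : Type u} (X : SimpleGraph V) [LocallyFinite X]
    (hX : X.Preconnected) (𝒰 : Ultrafilter V) (h𝒰 : ∀ K : Finset V, (K : Set V)ᶜ ∈ 𝒰) :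
    ∃ s ∈ X.end, ∀ K, (s K).supp ∈ 𝒰 := by
  have : Fact X.Preconnected := ⟨hX⟩
  -- The complement of a finite set has finitely many components and belongs to the ultrafilter, so
  -- one component does.
  have h1 (K : (Finset V)ᵒᵖ) : ∃ C : X.ComponentCompl (K.unop : Set V), C.supp ∈ 𝒰 := by
    have h2 : (⋃ C ∈ (Set.univ : Set (X.ComponentCompl (K.unop : Set V))), C.supp) ∈ 𝒰 := by
      refine Filter.mem_of_superset (h𝒰 K.unop) fun v hv => ?_
      exact Set.mem_biUnion (Set.mem_univ _) (X.componentComplMk_mem hv)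
    obtain ⟨C, -, hC⟩ := (Ultrafilter.finite_biUnion_mem_iff Set.finite_univ).1 h2
    exact ⟨C, hC⟩
  choose s hs using h1
  refine ⟨s, fun {j j'} f => ?_, hs⟩
  have h3 := 𝒰.nonempty_of_mem (Filter.inter_mem (hs j) (hs j'))
  change (s j).hom (CategoryTheory.le_of_op_hom f) = s j'
  rw [ComponentCompl.hom_eq_iff_not_disjoint, Set.not_disjoint_iff]
  exact h3

theorem exists_ultrafilter {V : Type u} {A : Set V} (hA : A.Infinite) :
    ∃ 𝒰 : Ultrafilter V, (∀ K : Finset V, (K : Set V)ᶜ ∈ 𝒰) ∧ A ∈ 𝒰 := by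
  have : (Filter.cofinite ⊓ Filter.principal A).NeBot := by
    rw [Filter.cofinite_inf_principal_neBot_iff]; exact hA
  obtain ⟨𝒰, h⟩ := Ultrafilter.exists_le (Filter.cofinite ⊓ Filter.principal A)
  exact ⟨𝒰, fun K => h (Filter.mem_inf_of_left (by simp)),
    h (Filter.mem_inf_of_right (Filter.mem_principal_self A))⟩

variable {G : Type u} [Group G]

theorem mulCayley_preconnected {S : Set G} (hS : Subgroup.closure S = ⊤) :
    (mulCayley S).Preconnected := by
  have h1 (a g : G) : (mulCayley S).Reachable a (a * g) := by
    have hg : g ∈ Subgroup.closure S := hS ▸ Subgroup.mem_top g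
    induction hg using Subgroup.closure_induction generalizing a with
    | mem s hs =>
      by_cases h : a = a * s
      · rw [← h]
      · exact Adj.reachable ((mulCayley_adj' S _ _).2 ⟨h, s, hs, Or.inl rfl⟩)
    | one => rw [mul_one]
    | mul x y _ _ hx hy => rw [← mul_assoc]; exact (hx a).trans (hy _)
    | inv x _ hx => simpa using (hx (a * x⁻¹)).symm
  intro a b
  simpa using h1 a (a⁻¹ * b)

theorem mulCayley_neighborSet_finite (S : Finset G) (v : G) :
    Finite ((mulCayley (S : Set G)).neighborSet v) := by
  refine ((S.finite_toSet.image (v * ·)).union (S.finite_toSet.image fun s => v * s⁻¹)).subset ?_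
  intro w hw
  obtain ⟨-, s, hs, h | h⟩ := (mulCayley_adj' _ _ _).1 hw
  · exact Or.inl ⟨s, hs, h⟩
  · exact Or.inr ⟨s, hs, by rw [h]; simp⟩

/-- A finitely generated group is one-ended if and only if it is infinite and every almost
invariant subset is finite or cofinite. -/
theorem oneEnded_iff : OneEnded G ↔ Group.FG G ∧ Infinite G ∧ ∀ A : Set G,
    (∀ s : G, {g | ¬ (g ∈ A ↔ g * s ∈ A)}.Finite) → A.Finite ∨ Aᶜ.Finite := by
  classical
  constructor
  · rintro ⟨S, hS, s, hs, huniq⟩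
    let X := mulCayley (S : Set G)
    have : LocallyFinite X := fun v => @Fintype.ofFinite _ (mulCayley_neighborSet_finite S v)
    have hX : X.Preconnected := mulCayley_preconnected hS
    refine ⟨⟨⟨S, hS⟩⟩, ?_, fun A hA => ?_⟩
    · by_contra hinf
      rw [not_infinite_iff_finite] at hinf
      have := Fintype.ofFinite G
      obtain ⟨v, hv⟩ := (s (Opposite.op Finset.univ)).nonempty
      exact hv.choose (by simp)
    · by_contra! hinf
      obtain ⟨𝒰, h𝒰, hA𝒰⟩ := exists_ultrafilter hinf.1
      obtain ⟨𝒰', h𝒰', hA𝒰'⟩ := exists_ultrafilter hinf.2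
      obtain ⟨s₁, h₁, h₁'⟩ := exists_end_of_ultrafilter X hX 𝒰 h𝒰
      obtain ⟨s₂, h₂, h₂'⟩ := exists_end_of_ultrafilter X hX 𝒰' h𝒰'
      obtain rfl : s₁ = s₂ := (huniq _ h₁).trans (huniq _ h₂).symm
      have hKfin : (⋃ s ∈ S, {g | ¬ (g ∈ A ↔ g * s ∈ A)}).Finite :=
        S.finite_toSet.biUnion fun s _ => hA s
      -- Along Cayley edges outside `K`, membership in `A` does not change, so the component chosen
      -- by the only end cannot meet both `A` and its complement.
      let K := Opposite.op hKfin.toFinset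
      obtain ⟨v, hv, hvA⟩ := 𝒰.nonempty_of_mem (Filter.inter_mem (h₁' K) hA𝒰)
      obtain ⟨w, hw, hwA⟩ := 𝒰'.nonempty_of_mem (Filter.inter_mem (h₂' K) hA𝒰')
      obtain ⟨hvK, hv⟩ := hv
      obtain ⟨hwK, hw⟩ := hw
      have key {a b : G} (ha : a ∉ K.unop) (s : G) (hs : s ∈ S) (hab : a * s = b) :
          a ∈ A ↔ b ∈ A := by
        rw [Set.Finite.mem_toFinset, Set.mem_iUnion₂] at ha
        by_contra h
        exact ha ⟨s, hs, by rw [← hab] at h; exact h⟩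
      have h3 : (v ∈ A) = (w ∈ A) := by
        have h4 : (X.componentComplMk hvK) = X.componentComplMk hwK := hv.trans hw.symm
        refine congrArg (ComponentCompl.lift (K := (K.unop : Set G)) (fun v _ => v ∈ A) ?_) h4
        intro a b ha hb hab
        obtain ⟨-, s, hs, h | h⟩ := (mulCayley_adj' _ _ _).1 hab
        · exact propext (key ha s hs h)
        · exact propext (key hb s hs h.symm).symm
      exact hwA (h3 ▸ hvA)
  · rintro ⟨hfg, hinf, hA⟩
    obtain ⟨S, hS⟩ := Group.fg_def.1 hfg
    let X := mulCayley (S : Set G)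
    have : LocallyFinite X := fun v => @Fintype.ofFinite _ (mulCayley_neighborSet_finite S v)
    have hX : X.Preconnected := mulCayley_preconnected hS
    obtain ⟨𝒰, h𝒰, -⟩ := exists_ultrafilter (V := G) Set.infinite_univ
    obtain ⟨s, hs, hs'⟩ := exists_end_of_ultrafilter X hX 𝒰 h𝒰
    refine ⟨S, hS, s, hs, fun t ht => ?_⟩
    have hinfinite {t : ∀ K, X.componentComplFunctor.obj K} (ht : t ∈ X.end) (K) :
        (t K).supp.Infinite :=
      (t K).infinite_iff_in_all_ranges.2 fun L h =>
        ⟨t (Opposite.op L), ht (CategoryTheory.opHomOfLE h)⟩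
    refine funext fun K => ?_
    by_contra hne
    -- If two ends differ at `K`, a component chosen by one is almost invariant, infinite, and
    -- disjoint from an infinite component.
    have h1 := hA (s K).supp ?_
    · rcases h1 with h1 | h1
      · exact hinfinite hs K h1
      · refine hinfinite ht K (h1.subset ?_)
        intro v hv hv'
        exact hne (hv.choose_spec.symm.trans hv'.choose_spec)
    · intro g
      have hg : g ∈ Subgroup.closure (S : Set G) := hS ▸ Subgroup.mem_top g
      have hmul (x : G) {F : Set G} (hF : F.Finite) : ((· * x) ⁻¹' F).Finite :=
        hF.preimage (mul_left_injective x).injOn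
      induction hg using Subgroup.closure_induction with
      | mem x hx =>
        refine (K.unop.finite_toSet.union (hmul x K.unop.finite_toSet)).subset fun g hg => ?_
        by_contra hK
        rw [Set.mem_union, not_or] at hK
        by_cases h : g = g * x
        · exact hg (by rw [← h])
        · have hadj : X.Adj g (g * x) := (mulCayley_adj' _ _ _).2 ⟨h, x, hx, Or.inl rfl⟩
          exact hg ⟨fun h => ComponentCompl.mem_of_adj _ _ h hK.2 hadj,
            fun h => ComponentCompl.mem_of_adj _ _ h hK.1 hadj.symm⟩
      | one => simp
      | mul x y _ _ hx hy =>
        refine (hx.union (hmul x hy)).subset fun g hg => ?_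
        simp only [Set.mem_union, Set.mem_preimage, Set.mem_ofPred_eq, mul_assoc] at *
        grind
      | inv x _ hx =>
        refine (hmul x⁻¹ hx).subset fun g hg => ?_
        simp only [Set.mem_preimage, Set.mem_ofPred_eq, inv_mul_cancel_right] at *
        grind

theorem OneEnded.of_mulEquiv {G' : Type u} [Group G'] (e : G ≃* G') (h : OneEnded G) :
    OneEnded G' := by
  rw [oneEnded_iff] at *
  obtain ⟨h1, h2, h3⟩ := h
  refine ⟨Group.fg_of_surjective (f := e.toMonoidHom) e.surjective, e.toEquiv.infinite_iff.1 h2,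
    fun A hA => ?_⟩
  have h4 : ∀ B : Set G', (e ⁻¹' B).Finite → B.Finite := fun B hB => by
    rw [← Set.image_preimage_eq B e.surjective]; exact hB.image e
  refine (h3 (e ⁻¹' A) fun s => ?_).imp (h4 _) (h4 _)
  refine ((hA (e s)).preimage e.injective.injOn).subset fun g hg => ?_
  simpa using hg

end Ends

/-! ### Actions of one-ended groups -/

namespace IsTree

variable {V E : Type*} {d₀ d₁ : E → V} (hT : IsTree d₀ d₁)
include hT

/-- A path between two vertices on one side of `e` stays on that side, so it cannot cross `f`, whose
initial vertex is on the other side. -/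
theorem side_iff_of_side {e f : E} {x y : V}
    (h : Side d₀ d₁ e x ↔ Side d₀ d₁ e y) (hf : ¬ (Side d₀ d₁ e x ↔ Side d₀ d₁ e (d₀ f))) :
    Side d₀ d₁ f x ↔ Side d₀ d₁ f y := by
  by_contra hne
  have h1 := (link_side (hT.link_of_side_iff h)).sep_subset hne
  exact hf h1.2.symm

/-- The sides of two edges are nested in one of four ways. -/
theorem side_cases {e f : E} (h : e ≠ f) :
    (∀ x, Side d₀ d₁ e x → Side d₀ d₁ f x) ∨ (∀ x, Side d₀ d₁ f x → Side d₀ d₁ e x) ∨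
    (∀ x, ¬ (Side d₀ d₁ e x ∧ Side d₀ d₁ f x)) ∨ (∀ x, Side d₀ d₁ e x ∨ Side d₀ d₁ f x) := by
  have h1 := hT.not_side_d₀ e
  have h2 := side_d₁ (d₀ := d₀) (d₁ := d₁) e
  have h5 := side_congr (d₀ := d₀) (d₁ := d₁) h
  have h7 (x) := hT.side_iff_of_side (e := e) (f := f) (x := d₀ e) (y := x)
  have h8 (x) := hT.side_iff_of_side (e := e) (f := f) (x := d₁ e) (y := x)
  by_cases ha : Side d₀ d₁ e (d₀ f) <;> by_cases hb : Side d₀ d₁ f (d₀ e)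
  · refine Or.inr (Or.inr (Or.inr fun x => ?_))
    have := h7 x
    grind
  · refine Or.inr (Or.inl fun x hx => ?_)
    have := h7 x
    grind
  · refine Or.inl fun x hx => ?_
    have := h8 x
    grind
  · refine Or.inr (Or.inr (Or.inl fun x => ?_))
    have := h8 x
    grind

end IsTree

namespace GTree

variable {G : Type u} [Group G] (T : GTree G)

/-- An element that maps a side of an edge properly into itself contradicts one-endedness. -/
theorem not_oneEnded_of_nested (hE : T.FiniteEdges) {e : T.E} {h : G} (hne : h • e ≠ e)
    (hs : ∀ x, Side T.d₀ T.d₁ (h • e) x → Side T.d₀ T.d₁ e x) : ¬ OneEnded G := by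
  rw [oneEnded_iff]
  rintro ⟨-, -, hA⟩
  -- This set is almost invariant because edge stabilizers are finite. It contains the powers `h ^
  -- n`, and its complement contains the inverses of the positive powers, so neither is finite.
  let A : Set G := {g | Side T.d₀ T.d₁ e (g • T.d₁ e)}
  have h0 : ¬ Side T.d₀ T.d₁ (h • e) (T.d₁ e) := fun h1 =>
    T.isTree.not_side_d₀ e (hs _ ((side_congr hne.symm).2 h1))
  have hstep (x : T.V) : Side T.d₀ T.d₁ e x → Side T.d₀ T.d₁ e (h • x) := fun hx =>
    hs _ ((T.smul_side h).2 hx)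
  have hpow (n : ℕ) : ∀ x, Side T.d₀ T.d₁ e x → Side T.d₀ T.d₁ e (h ^ n • x) := by
    induction n with
    | zero => intro x hx; simpa using hx
    | succ n ih => intro x hx; rw [pow_succ', mul_smul]; exact hstep _ (ih x hx)
  have hneg (n : ℕ) : ¬ Side T.d₀ T.d₁ e ((h ^ (n + 1))⁻¹ • T.d₁ e) := fun hx => by
    have h1 := hpow n _ hx
    rw [smul_smul, pow_succ', mul_inv_rev, mul_inv_cancel_left, ← T.smul_side h,
      smul_inv_smul] at h1
    exact h0 h1
  have hinj : Function.Injective fun n : ℕ => h ^ n := by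
    rw [injective_pow_iff_not_isOfFinOrder, isOfFinOrder_iff_pow_eq_one]
    rintro ⟨n, hn, h1⟩
    obtain ⟨n, rfl⟩ := Nat.exists_eq_succ_of_ne_zero hn.ne'
    refine hneg n ?_
    rw [h1, inv_one, one_smul]
    exact side_d₁ e
  have hAfin (s : G) : {g | ¬ (g ∈ A ↔ g * s ∈ A)}.Finite := by
    have hfin : (Sep T.d₀ T.d₁ (T.d₁ e) (s • T.d₁ e)).Finite := T.isTree.sep_finite _ _
    have hst := hE e
    have h2 (f : T.E) : {g : G | g • f = e}.Finite := by
      by_cases h : ∃ m : G, m • f = e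
      · obtain ⟨m, hm⟩ := h
        refine ((Set.toFinite (MulAction.stabilizer G e : Set G)).image (· * m)).subset ?_
        intro n hn
        refine ⟨n * m⁻¹, ?_, inv_mul_cancel_right _ _⟩
        rw [SetLike.mem_coe, MulAction.mem_stabilizer_iff, mul_smul, ← hm, inv_smul_smul, hm]
        exact hn
      · convert Set.finite_empty (α := G)
        ext n
        exact ⟨fun hn => h ⟨n, hn⟩, fun hn => hn.elim⟩
    refine (hfin.biUnion fun f _ => h2 f).subset fun g hg => ?_
    refine Set.mem_biUnion (x := g⁻¹ • e) ?_ (smul_inv_smul _ _)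
    have h3 : e ∈ Sep T.d₀ T.d₁ (g • T.d₁ e) (g • s • T.d₁ e) := by
      rw [smul_smul]; exact hg
    rw [← T.smul_mem_sep g, smul_inv_smul]
    exact h3
  rcases hA A hAfin with h1 | h1
  · refine Set.infinite_of_injective_forall_mem hinj (fun n => ?_) h1
    exact hpow n _ (side_d₁ e)
  · refine Set.infinite_of_injective_forall_mem (f := fun n : ℕ => (h ^ (n + 1))⁻¹) ?_ (fun n => ?_) h1
    · intro a b hab
      exact Nat.succ_injective (hinj (inv_injective hab))
    · exact hneg n

/-- A group that acts without a fixed vertex on a tree with finitely many orbits and finite edge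
stabilizers is not one-ended. -/
theorem Cofinite.not_oneEnded (hT : T.Cofinite) (hE : T.FiniteEdges)
    (hfix : ¬ ∃ v : T.V, ∀ g : G, g • v = v) : ¬ OneEnded G := by
  obtain ⟨n, hn⟩ : ∃ n, Nat.card (MulAction.orbitRel.Quotient G T.E) = n := ⟨_, rfl⟩
  induction n using Nat.strong_induction_on generalizing T with
  | _ n ih =>
  obtain ⟨o⟩ := T.isTree.nonempty
  obtain ⟨g₀, hg₀⟩ : ∃ g : G, g • o ≠ o := by
    by_contra! h
    exact hfix ⟨o, h⟩
  obtain ⟨e, -, -⟩ := T.exists_inc hg₀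
  by_cases hnest : ∃ (h : G), h • e ≠ e ∧ ((∀ x, Side T.d₀ T.d₁ (h • e) x → Side T.d₀ T.d₁ e x) ∨
      (∀ x, Side T.d₀ T.d₁ e x → Side T.d₀ T.d₁ (h • e) x))
  · obtain ⟨h, hne, hs | hs⟩ := hnest
    · exact T.not_oneEnded_of_nested hE hne hs
    · refine T.not_oneEnded_of_nested hE (e := e) (h := h⁻¹)
        (fun h' => hne (inv_smul_eq_iff.1 h').symm) fun x hx => ?_
      rw [← T.smul_side h, smul_inv_smul] at hx
      rw [← T.smul_side h]
      exact hs _ hx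
  -- From here on, by `side_cases`, the sides of `e` and a different translate are disjoint or cover
  -- the tree.
  push Not at hnest
  let D : Set T.E := {f | ∃ g : G, g • e = f}
  have hD : ∀ (g : G), ∀ f ∈ Dᶜ, g • f ∈ Dᶜ := by
    rintro g f hf ⟨h, hh⟩
    exact hf ⟨g⁻¹ * h, by rw [mul_smul, hh, inv_smul_smul]⟩
  -- If no translate of `e` separates points of the orbit of `x`, the component of `x` outside the
  -- orbit of `e` is an invariant subtree with fewer edge orbits, and induction applies.
  have finish (x : T.V) (hx : ∀ g : G, ∀ f ∈ D, (Side T.d₀ T.d₁ f x ↔ Side T.d₀ T.d₁ f (g • x))) :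
      ¬ OneEnded G := by
    have hl (g : G) : Link T.d₀ T.d₁ Dᶜ x (g • x) :=
      (T.isTree.link_sep x (g • x)).mono fun f hf hfD =>
        mem_sep.1 hf (hx g f hfD)
    let T' := T.component Dᶜ hD x hl
    have : Finite (MulAction.orbitRel.Quotient G T.E) := hT
    have hfin : T'.Cofinite := Finite.of_injective _ T.componentOrbit_injective
    refine ih _ ?_ T' hfin hE.component ?_ rfl
    · rw [← hn]
      refine lt_of_le_of_ne (Nat.card_le_card_of_injective _ T.componentOrbit_injective) fun h => ?_
      have hsurj := (Nat.bijective_iff_injective_and_card _).2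
        ⟨T.componentOrbit_injective (hD := hD) (hx := hl), h⟩ |>.2
      obtain ⟨q, hq⟩ := hsurj (Quotient.mk _ e)
      induction q using Quotient.inductionOn with
      | h f =>
        obtain ⟨g, hg⟩ := Quotient.exact hq
        exact f.2.1 ⟨g, hg⟩
    · rintro ⟨v, hv⟩
      exact hfix ⟨v.1, fun g => congrArg Subtype.val (hv g)⟩
  by_cases h1 : ∃ a : G, a • e ≠ e ∧ ∀ x, ¬ (Side T.d₀ T.d₁ e x ∧ Side T.d₀ T.d₁ (a • e) x)
  -- The two patterns exclude each other: if `a • e` has side disjoint from that of `e` and `b • e`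
  -- has side covering with it, then the side of `e` lies in that of `(a * b) • e`.
  · by_cases h2 : ∃ b : G, b • e ≠ e ∧ ∀ x, Side T.d₀ T.d₁ e x ∨ Side T.d₀ T.d₁ (b • e) x
    · obtain ⟨a, ha, ha'⟩ := h1
      obtain ⟨b, hb, hb'⟩ := h2
      have hab : (a * b) • e ≠ e := by
        intro h
        have h3 (x) : Side T.d₀ T.d₁ (b • e) (a⁻¹ • x) ↔ Side T.d₀ T.d₁ e x := by
          rw [← T.smul_side a, smul_inv_smul, smul_smul, h]
        have h4 (x) : Side T.d₀ T.d₁ (a • e) x ↔ ¬ Side T.d₀ T.d₁ e x := by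
          have h5 := ha' x
          have h6 := hb' (a⁻¹ • x)
          rw [h3] at h6
          rw [← smul_inv_smul a x, T.smul_side, smul_inv_smul] at h5 ⊢
          grind
        have h5 := side_congr (d₀ := T.d₀) (d₁ := T.d₁) (Ne.symm ha)
        rw [h4, h4] at h5
        exact h5.1 (T.isTree.not_side_d₀ e) (side_d₁ e)
      obtain ⟨x, hx, hx'⟩ := (hnest _ hab).2
      exfalso
      have h3 := ha' x
      have h4 := hb' (a⁻¹ • x)
      rw [mul_smul, ← smul_inv_smul a x, T.smul_side] at hx'
      rw [← smul_inv_smul a x, T.smul_side, smul_inv_smul] at h3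
      grind
    · push Not at h2
      -- With disjoint sides only, the initial vertex of `e` lies on the initial side of every
      -- translate, and so does its whole orbit. In the covering case the terminal vertex plays this
      -- role.
      have key (a : G) : ¬ Side T.d₀ T.d₁ (a • e) (T.d₀ e) := by
        intro h
        by_cases ha : a • e = e
        · rw [ha] at h
          exact T.isTree.not_side_d₀ e h
        · obtain ⟨⟨x, hx⟩, ⟨y, hy⟩⟩ := hnest a ha
          obtain ⟨z, hz⟩ := h2 a ha
          rcases T.isTree.side_cases ha with h3 | h3 | h3 | h3
          · exact hx.2 (h3 x hx.1)
          · exact hy.2 (h3 y hy.1)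
          · exact h3 (T.d₁ e) ⟨(side_congr (Ne.symm ha)).1 h, side_d₁ e⟩
          · exact (h3 z).elim hz.2 hz.1
      refine finish (T.d₀ e) fun g f hf => ?_
      obtain ⟨a, rfl⟩ := hf
      have h4 : ¬ Side T.d₀ T.d₁ (a • e) (g • T.d₀ e) := by
        rw [← smul_inv_smul g (a • e), T.smul_side, smul_smul]
        exact key _
      exact iff_of_false (key a) h4
  · push Not at h1
    have key (a : G) : Side T.d₀ T.d₁ (a • e) (T.d₁ e) := by
      by_cases ha : a • e = e
      · rw [ha]
        exact side_d₁ e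
      · obtain ⟨⟨x, hx⟩, ⟨y, hy⟩⟩ := hnest a ha
        obtain ⟨z, hz⟩ := h1 a ha
        rcases T.isTree.side_cases ha with h3 | h3 | h3 | h3
        · exact (hx.2 (h3 x hx.1)).elim
        · exact (hy.2 (h3 y hy.1)).elim
        · exact (h3 z ⟨hz.2, hz.1⟩).elim
        · exact (side_congr (Ne.symm ha)).1 ((h3 (T.d₀ e)).resolve_right (T.isTree.not_side_d₀ e))
    refine finish (T.d₁ e) fun g f hf => ?_
    obtain ⟨a, rfl⟩ := hf
    have h4 : Side T.d₀ T.d₁ (a • e) (g • T.d₁ e) := by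
      rw [← smul_inv_smul g (a • e), T.smul_side, smul_smul]
      exact key _
    exact iff_of_true (key a) h4

end GTree

end FiniteSplitting

namespace FiniteSplitting

namespace GTree

variable {G : Type u} [Group G]

/-! ### Blowing up the vertices of a tree -/

/-- The tree that arises from the tree `A` by replacing every vertex by a copy of the tree `B`. -/
def blow (A B : GTree G) (f : A.E → B.V) (hf : ∀ (g : G) e, f (g • e) = g • f e) : GTree G where
  V := A.V × B.V
  E := A.E ⊕ (A.V × B.E)
  d₀ := Sum.elim (fun a => (A.d₀ a, f a)) fun p => (p.1, B.d₀ p.2)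
  d₁ := Sum.elim (fun a => (A.d₁ a, f a)) fun p => (p.1, B.d₁ p.2)
  smul_d₀ g := by
    rintro (a | ⟨v, e⟩)
    · exact Prod.ext (A.smul_d₀ g a) (hf g a)
    · exact Prod.ext rfl (B.smul_d₀ g e)
  smul_d₁ g := by
    rintro (a | ⟨v, e⟩)
    · exact Prod.ext (A.smul_d₁ g a) (hf g a)
    · exact Prod.ext rfl (B.smul_d₁ g e)
  isTree := by
    classical
    obtain ⟨o⟩ := A.isTree.nonempty
    obtain ⟨o'⟩ := B.isTree.nonempty
    have : Nonempty (A.V × B.V) := ⟨(o, o')⟩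
    set d₀ : A.E ⊕ (A.V × B.E) → A.V × B.V :=
      Sum.elim (fun a => (A.d₀ a, f a)) fun p => (p.1, B.d₀ p.2) with hd₀
    set d₁ : A.E ⊕ (A.V × B.E) → A.V × B.V :=
      Sum.elim (fun a => (A.d₁ a, f a)) fun p => (p.1, B.d₁ p.2) with hd₁
    have hfib (v : A.V) (x y : B.V) : Link d₀ d₁ Set.univ (v, x) (v, y) :=
      (B.isTree.connected x y).map (fun x => (v, x)) fun e _ =>
        Link.edge (e := Sum.inr (v, e)) trivial
    refine isTree_of_height (A := ℤ) ?_ ?_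
    · rintro ⟨v, x⟩ ⟨w, y⟩
      refine ((A.isTree.connected v w).map (fun v => (v, y)) fun a _ => ?_) |> (hfib v x y).trans
      have h1 : Link d₀ d₁ Set.univ (A.d₀ a, f a) (A.d₁ a, f a) := Link.edge (e := Sum.inl a) trivial
      exact (hfib _ _ _).trans (h1.trans (hfib _ _ _))
    · rintro (a | ⟨v, e⟩)
      · refine ⟨fun p => IsTree.sideInd A.d₀ A.d₁ a p.1, ?_, ?_⟩
        · have h1 := A.isTree.not_side_d₀ a
          have h2 := side_d₁ (d₀ := A.d₀) (d₁ := A.d₁) a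
          simp [hd₀, hd₁, IsTree.sideInd, h1, h2]
        · rintro (b | ⟨w, e⟩) hb
          · have h1 := side_congr (d₀ := A.d₀) (d₁ := A.d₁) (e := a) (f := b) (fun h => hb (h ▸ rfl))
            simp [hd₀, hd₁, IsTree.sideInd, h1]
          · rfl
      -- For an edge of the copy of `B` over `v`, take its side on that copy and `0` on the others,
      -- then remove the jumps along edges of `A` with a potential `φ`.
      · let χ : B.V → ℤ := IsTree.sideInd B.d₀ B.d₁ e
        let δ : A.V → ℤ := fun w => if w = v then 1 else 0
        obtain ⟨φ, hφ⟩ := A.isTree.exists_potential fun a =>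
          Multiplicative.ofAdd (- (χ (f a) * (δ (A.d₁ a) - δ (A.d₀ a))))
        have hφ' (a) : (φ (A.d₁ a)).toAdd = (φ (A.d₀ a)).toAdd +
            (- (χ (f a) * (δ (A.d₁ a) - δ (A.d₀ a)))) := congrArg Multiplicative.toAdd (hφ a)
        refine ⟨fun p => χ p.2 * δ p.1 + (φ p.1).toAdd, ?_, ?_⟩
        · have h1 := B.isTree.not_side_d₀ e
          have h2 := side_d₁ (d₀ := B.d₀) (d₁ := B.d₁) e
          simp [hd₀, hd₁, χ, δ, IsTree.sideInd, h1, h2]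
        · rintro (a | ⟨w, e'⟩) hb
          · simp only [hd₀, hd₁, Sum.elim_inl, hφ']
            ring
          · simp only [hd₀, hd₁, Sum.elim_inr]
            by_cases hw : w = v
            · have h1 := side_congr (d₀ := B.d₀) (d₁ := B.d₁) (e := e) (f := e')
                (fun h => hb (by rw [h, hw]))
              simp [χ, IsTree.sideInd, h1]
            · simp [δ, hw]

theorem FiniteEdges.blow {A B : GTree G} (hA : A.FiniteEdges) (hB : B.FiniteEdges) {f : A.E → B.V}
    {hf : ∀ (g : G) e, f (g • e) = g • f e} : (A.blow B f hf).FiniteEdges := by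
  rintro (a | ⟨v, e⟩)
  · have := hA a
    refine (Set.toFinite (MulAction.stabilizer G a : Set G)).subset fun g hg => ?_
    exact Sum.inl_injective hg
  · have := hB e
    refine (Set.toFinite (MulAction.stabilizer G e : Set G)).subset fun g hg => ?_
    exact congrArg Prod.snd (Sum.inr_injective hg)

/-- There is an equivariant map `f` between two sets with group actions if all the stabilizers have
fixed points. -/
theorem exists_equivariant {X Y : Type*} [MulAction G X] [MulAction G Y]
    (h : ∀ x : X, ∃ y : Y, ∀ g : G, g • x = x → g • y = y) :
    ∃ f : X → Y, ∀ (g : G) x, f (g • x) = g • f x := by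
  choose y hy using h
  let m : X → MulAction.orbitRel.Quotient G X := Quotient.mk _
  have hm (x : X) : ∃ g : G, g • (m x).out = x := by
    obtain ⟨g, hg⟩ := Quotient.exact (Quotient.out_eq (m x))
    exact ⟨g⁻¹, by rw [← hg, inv_smul_smul]⟩
  choose k hk using hm
  refine ⟨fun x => k x • y (m x).out, fun g x => ?_⟩
  have h1 : m (g • x) = m x := Quotient.sound ⟨g, rfl⟩
  have h2 := hk (g • x)
  change k (g • x) • y (m (g • x)).out = g • k x • y (m x).out
  rw [h1] at h2 ⊢
  have h3 : ((k x)⁻¹ * g⁻¹ * k (g • x)) • (m x).out = (m x).out := by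
    rw [mul_smul, mul_smul, h2, inv_smul_smul, inv_smul_eq_iff, hk]
  have h4 := hy _ _ h3
  rw [mul_smul, mul_smul, inv_smul_eq_iff, inv_smul_eq_iff] at h4
  exact h4

theorem FiniteEdges.exists_equivariant {A : GTree G} (hA : A.FiniteEdges) (B : GTree G) :
    ∃ f : A.E → B.V, ∀ (g : G) e, f (g • e) = g • f e := by
  refine GTree.exists_equivariant fun e => ?_
  have := hA e
  obtain ⟨x, hx⟩ := B.exists_fixed_of_finite_subgroup (MulAction.stabilizer G e)
  exact ⟨x, fun g hg => hx g hg⟩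

/-- A map of vertices whose fibres are subtrees. -/
structure Resolves (R A : GTree G) (p : R.V → A.V) : Prop where
  equivariant : ∀ (g : G) x, p (g • x) = g • p x
  fibre : ∀ x y, p x = p y → Link R.d₀ R.d₁ {e | p (R.d₀ e) = p x ∧ p (R.d₁ e) = p x} x y
  edge : ∀ e, p (R.d₀ e) = p (R.d₁ e) ∨ ∃ a, Inc A.d₀ A.d₁ a (p (R.d₀ e)) (p (R.d₁ e))

theorem resolves_blow (A B : GTree G) (f : A.E → B.V) (hf : ∀ (g : G) e, f (g • e) = g • f e) :
    Resolves (A.blow B f hf) A Prod.fst where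
  equivariant g x := rfl
  fibre := by
    rintro ⟨v, x⟩ ⟨w, y⟩ (rfl : v = w)
    refine (B.isTree.connected x y).map (fun x => (v, x)) fun e _ => ?_
    exact Link.edge (d₀ := (A.blow B f hf).d₀) (d₁ := (A.blow B f hf).d₁) (e := Sum.inr (v, e))
      ⟨rfl, rfl⟩
  edge := by
    rintro (a | ⟨v, e⟩)
    · exact Or.inr ⟨a, Or.inl ⟨rfl, rfl⟩⟩
    · exact Or.inl rfl

theorem link_component (T : GTree G) {D hD x hx} {S : Set T.E} {y z : (T.component D hD x hx).V}
    (h : Link T.d₀ T.d₁ (D ∩ S) y.1 z.1) :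
    Link (T.component D hD x hx).d₀ (T.component D hD x hx).d₁ {e | e.1 ∈ S} y z := by
  obtain ⟨y, hy⟩ := y
  obtain ⟨z, hz⟩ := z
  have key : ∀ w, Link T.d₀ T.d₁ (D ∩ S) y w → ∃ hw, Link (T.component D hD x hx).d₀
      (T.component D hD x hx).d₁ {e | e.1 ∈ S} ⟨y, hy⟩ ⟨w, hw⟩ := by
    intro w hw
    refine (hw.propagate (P := fun w => ∃ hw, Link (T.component D hD x hx).d₀
      (T.component D hD x hx).d₁ {e | e.1 ∈ S} ⟨y, hy⟩ ⟨w, hw⟩) fun e he => ⟨?_, ?_⟩).1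
        ⟨hy, Link.refl _⟩
    · rintro ⟨h, h'⟩
      exact ⟨Link.trans h (Link.edge he.1), h'.trans
        (Link.edge (e := (⟨e, he.1, h⟩ : (T.component D hD x hx).E)) he.2)⟩
    · rintro ⟨h, h'⟩
      have h2 := Link.trans h (Link.edge he.1).symm
      exact ⟨h2, h'.trans
        (Link.edge (e := (⟨e, he.1, h2⟩ : (T.component D hD x hx).E)) he.2).symm⟩
  exact (key z h).2

theorem Resolves.component {R A : GTree G} {p : R.V → A.V} (h : Resolves R A p) {D hD x hx} :
    Resolves (R.component D hD x hx) A (fun y => p y.1) where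
  equivariant g y := h.equivariant g y.1
  fibre y z hyz := by
    refine R.link_component (S := {e | p (R.d₀ e) = p y.1 ∧ p (R.d₁ e) = p y.1}) ?_
    refine (R.isTree.link_sep y.1 z.1).mono fun e he => ⟨?_, (h.fibre _ _ hyz).sep_subset he⟩
    have h1 : Link R.d₀ R.d₁ D y.1 z.1 := Link.trans (Link.symm y.2) z.2
    exact h1.sep_subset he
  edge e := h.edge e.1

/-- A finitely generated group that acts on a tree has an invariant subtree with finitely many
orbits of edges that contains given finitely many vertices. -/
theorem exists_component_cofinite_of_finite [Group.FG G] (T : GTree G) {X : Set T.V}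
    (hX : X.Finite) : ∃ D hD x hx, (T.component D hD x hx).Cofinite ∧
      ∀ y ∈ X, Link T.d₀ T.d₁ D x y := by
  obtain ⟨x⟩ := T.isTree.nonempty
  obtain ⟨S, hS⟩ := Group.fg_def.1 ‹Group.FG G›
  let F : Set T.E := (⋃ s ∈ S, Sep T.d₀ T.d₁ x (s • x)) ∪ ⋃ y ∈ X, Sep T.d₀ T.d₁ x y
  have hF : F.Finite := (S.finite_toSet.biUnion fun s _ => T.isTree.sep_finite _ _).union
    (hX.biUnion fun y _ => T.isTree.sep_finite _ _)
  let D : Set T.E := {e | ∃ (g : G), ∃ f ∈ F, g • f = e}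
  have hD : ∀ (g : G), ∀ e ∈ D, g • e ∈ D := by
    rintro g _ ⟨h, f, hf, rfl⟩
    exact ⟨g * h, f, hf, mul_smul _ _ _⟩
  have hx (g : G) : Link T.d₀ T.d₁ D x (g • x) := by
    have hg : g ∈ Subgroup.closure (S : Set G) := hS ▸ Subgroup.mem_top g
    induction hg using Subgroup.closure_induction with
    | mem s hs =>
      refine (T.isTree.link_sep x (s • x)).mono fun e he => ⟨1, e, ?_, one_smul _ _⟩
      exact Or.inl (Set.mem_biUnion (show s ∈ S from hs) he)
    | one => rw [one_smul]; exact Link.refl x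
    | mul a b _ _ ha hb => rw [mul_smul]; exact ha.trans (T.smul_link a (hD a) hb)
    | inv a _ ha => simpa using (T.smul_link a⁻¹ (hD a⁻¹) ha).symm
  refine ⟨D, hD, x, hx, ?_, fun y hy => ?_⟩
  · have hfin : Finite ((Quotient.mk (MulAction.orbitRel G T.E)) '' F) := (hF.image _).to_subtype
    refine Finite.of_injective (β := (Quotient.mk (MulAction.orbitRel G T.E)) '' F)
      (fun q => ⟨T.componentOrbit q, ?_⟩) fun a b h =>
        T.componentOrbit_injective (congrArg Subtype.val h)
    induction q using Quotient.inductionOn with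
    | h e =>
      obtain ⟨e, ⟨g, f, hf, rfl⟩, _⟩ := e
      exact ⟨f, hf, Quotient.sound ⟨g⁻¹, by simp⟩⟩
  · refine (T.isTree.link_sep x y).mono fun e he => ⟨1, e, ?_, one_smul _ _⟩
    exact Or.inr (Set.mem_biUnion hy he)

/-! ### Reduction -/

/-- The stabilizers of the components of the complement of `K` fix a vertex in the component. -/
def Contractible (T : GTree G) (K : Set T.E) : Prop :=
  ∀ x, ∃ y, Link T.d₀ T.d₁ Kᶜ x y ∧ ∀ g : G, Link T.d₀ T.d₁ Kᶜ x (g • x) → g • y = y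

/-- If the stabilizer of the component of `u` fixes the edge `e` from `u` to `v`, and the components
of `u` and `v` are inequivalent, that stabilizer also fixes `v`. Absorbing the first component into
the second therefore creates no new stabilizer. -/
theorem Contractible.sdiff {T : GTree G} {K : Set T.E} (hK : ∀ (g : G), ∀ e ∈ K, g • e ∈ K)
    (h : T.Contractible K) {e : T.E} {u v : T.V} (hi : Inc T.d₀ T.d₁ e u v)
    (huv : ∀ g : G, ¬ Link T.d₀ T.d₁ Kᶜ (g • u) v)
    (hu : ∀ g : G, Link T.d₀ T.d₁ Kᶜ u (g • u) → g • e = e) :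
    T.Contractible (K \ {f | ∃ g : G, g • e = f}) := by
  classical
  set L := Link T.d₀ T.d₁ Kᶜ
  set K' := K \ {f | ∃ g : G, g • e = f}
  have hsub : Kᶜ ⊆ K'ᶜ := Set.compl_subset_compl.2 Set.sdiff_subset
  have hL (g : G) {x y : T.V} (h : L x y) : L (g • x) (g • y) :=
    T.smul_link g (T.smul_mem_compl hK g) h
  have hwd {g g' : G} {x : T.V} (h1 : L x (g • u)) (h2 : L x (g' • u)) : g • v = g' • v := by
    have h3 := hL g⁻¹ (h1.symm.trans h2)
    rw [inv_smul_smul, smul_smul] at h3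
    have h4 := T.smul_of_inc hi.symm (hu _ h3)
    rw [mul_smul, inv_smul_eq_iff] at h4
    exact h4.symm
  -- The equivariant retraction that sends each translate `g • u`, with its whole component, to `g •
  -- v`. It turns links in the larger collapsed set into links in the old one.
  let ρ : T.V → T.V := fun x => if h : ∃ g : G, L x (g • u) then h.choose • v else x
  have hρ {g : G} {x : T.V} (h1 : L x (g • u)) : ρ x = g • v := by
    have h2 : ∃ g : G, L x (g • u) := ⟨g, h1⟩
    simp only [ρ, dif_pos h2]
    exact hwd h2.choose_spec h1
  have hρ' {x : T.V} (h1 : ¬ ∃ g : G, L x (g • u)) : ρ x = x := dif_neg h1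
  have hv (g : G) : ρ (g • v) = g • v := by
    refine hρ' ?_
    rintro ⟨g', h1⟩
    have := hL g⁻¹ h1
    rw [inv_smul_smul, smul_smul] at this
    exact huv _ this.symm
  have hρg (g : G) (x : T.V) : ρ (g • x) = g • ρ x := by
    by_cases h1 : ∃ g : G, L x (g • u)
    · obtain ⟨k, hk⟩ := h1
      have h2 := hL g hk
      rw [smul_smul] at h2
      rw [hρ h2, hρ hk, mul_smul]
    · rw [hρ' h1, hρ']
      rintro ⟨k, hk⟩
      have := hL g⁻¹ hk
      rw [inv_smul_smul, smul_smul] at this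
      exact h1 ⟨_, this⟩
  have hρL {x y : T.V} (hxy : L x y) : L (ρ x) (ρ y) := by
    by_cases h1 : ∃ g : G, L y (g • u)
    · obtain ⟨k, hk⟩ := h1
      rw [hρ hk, hρ (hxy.trans hk)]
      exact Link.refl _
    · rw [hρ' h1, hρ']
      · exact hxy
      · rintro ⟨k, hk⟩
        exact h1 ⟨k, hxy.symm.trans hk⟩
  have hρL' {x y : T.V} (hxy : Link T.d₀ T.d₁ K'ᶜ x y) : L (ρ x) (ρ y) := by
    refine hxy.map ρ fun f hf => ?_
    by_cases hfK : f ∈ K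
    · have : f ∈ {f | ∃ g : G, g • e = f} := by
        by_contra h
        exact hf ⟨hfK, h⟩
      obtain ⟨g, rfl⟩ := this
      have h1 : ρ (g • u) = ρ (g • v) := by rw [hv, hρ (Link.refl _)]
      rcases T.smul_inc g hi with ⟨h2, h3⟩ | ⟨h2, h3⟩
      · rw [h2, h3, h1]; exact Link.refl _
      · rw [h2, h3, h1]; exact Link.refl _
    · exact hρL (Link.edge hfK)
  have hself (x : T.V) : Link T.d₀ T.d₁ K'ᶜ x (ρ x) := by
    by_cases h1 : ∃ g : G, L x (g • u)
    · obtain ⟨g, hg⟩ := h1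
      rw [hρ hg]
      refine (hg.mono hsub).trans (Link.of_inc (e := g • e) ?_ (T.smul_inc g hi))
      exact fun h => h.2 ⟨g, rfl⟩
    · rw [hρ' h1]; exact Link.refl _
  intro x
  obtain ⟨y, hy, hy'⟩ := h (ρ x)
  refine ⟨y, (hself x).trans (hy.mono hsub), fun g hg => hy' g ?_⟩
  rw [← hρg]
  exact hρL' hg

/-- Edges in `D` can be collapsed, without new vertex stabilizers, so that the remaining ones are
reduced. -/
theorem Cofinite.exists_reduction {T : GTree G} (hT : T.Cofinite) {D : Set T.E}
    (hD : ∀ (g : G), ∀ e ∈ D, g • e ∈ D) :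
    ∃ K, (∀ (g : G), ∀ e ∈ K, g • e ∈ K) ∧ Dᶜ ⊆ K ∧ T.Contractible K ∧
      ∀ e ∈ K, e ∈ D → ∀ u v, Inc T.d₀ T.d₁ e u v → (∀ g : G, ¬ Link T.d₀ T.d₁ Kᶜ (g • u) v) →
        ¬ ∀ g : G, Link T.d₀ T.d₁ Kᶜ u (g • u) → g • e = e := by
  have : Finite (MulAction.orbitRel.Quotient G T.E) := hT
  let m : T.E → MulAction.orbitRel.Quotient G T.E := Quotient.mk _
  -- `K` has the least number of edge orbits among the admissible sets; `Set.univ` is admissible. An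
  -- edge violating the last clause could be removed from `K` by `Contractible.sdiff`.
  obtain ⟨K, ⟨hK, hDK, hc⟩, hmin⟩ := WellFounded.has_min
    (measure fun K : Set T.E => (m '' K).ncard).wf
    {K | (∀ (g : G), ∀ e ∈ K, g • e ∈ K) ∧ Dᶜ ⊆ K ∧ T.Contractible K}
    ⟨Set.univ, fun _ _ _ => trivial, Set.subset_univ _, fun x => ⟨x, Link.refl x, fun g hg => by
      rw [Set.compl_univ] at hg
      exact (hg.lift (r := (· = ·)) ⟨fun _ => rfl, Eq.symm, Eq.trans⟩ fun e he => he.elim).symm⟩⟩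
  refine ⟨K, hK, hDK, hc, fun e he heD u v hi huv hu => ?_⟩
  refine hmin (K \ {f | ∃ g : G, g • e = f}) ⟨?_, ?_, hc.sdiff hK hi huv hu⟩ ?_
  · rintro g f ⟨hf, hfe⟩
    refine ⟨hK g f hf, ?_⟩
    rintro ⟨k, hk⟩
    exact hfe ⟨g⁻¹ * k, by rw [mul_smul, hk, inv_smul_smul]⟩
  · intro f hf
    refine ⟨hDK hf, ?_⟩
    rintro ⟨k, rfl⟩
    exact hf (hD k e heD)
  · refine Set.ncard_lt_ncard ⟨Set.image_mono Set.sdiff_subset, fun h => ?_⟩ (Set.toFinite _)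
    obtain ⟨f, ⟨-, hf⟩, hfe⟩ := h ⟨e, he, rfl⟩
    obtain ⟨g, hg⟩ := Quotient.exact hfe
    exact hf ⟨g, hg⟩

end GTree

end FiniteSplitting

namespace FiniteSplitting

/-! ### Counting orbits -/

/-- The number of edges of a finite tree is at most the number of vertices. -/
theorem IsTree.card_edges_le {V E : Type*} {d₀ d₁ : E → V} (hT : IsTree d₀ d₁) [Finite V] :
    Finite E ∧ Nat.card E ≤ Nat.card V := by
  obtain ⟨o⟩ := hT.nonempty
  -- Each edge is assigned its end farther from `o`; `step_unique` makes this injective.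
  have h (e : E) : ∃ x y, Inc d₀ d₁ e x y ∧ e ∈ Sep d₀ d₁ o x := by
    have h1 := side_d₁ (d₀ := d₀) (d₁ := d₁) e
    have h2 := hT.not_side_d₀ e
    by_cases h3 : Side d₀ d₁ e o
    · exact ⟨_, _, inc_self e, by rw [mem_sep]; tauto⟩
    · exact ⟨_, _, (inc_self e).symm, by rw [mem_sep]; tauto⟩
  choose f g hf hs using h
  have hinj : Function.Injective f := fun e e' hee => by
    have h1 := hf e
    have h2 := hs e
    rw [hee] at h1 h2
    exact hT.step_unique h1 (hf e') h2 (hs e')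
  exact ⟨Finite.of_injective f hinj, Nat.card_le_card_of_injective f hinj⟩

namespace GTree

variable {G : Type u} [Group G]

/-- The orbits of vertices. -/
abbrev VertexOrbits (T : GTree G) : Type u := MulAction.orbitRel.Quotient G T.V

/-- The orbits of edges. -/
abbrev EdgeOrbits (T : GTree G) : Type u := MulAction.orbitRel.Quotient G T.E

end GTree

namespace Transversal

variable {G : Type u} [Group G] {T : GTree G} (𝒯 : Transversal T)

theorem card_vertexOrbits : Nat.card 𝒯.I = Nat.card T.VertexOrbits := by
  refine Nat.card_congr (Equiv.ofBijective (fun i => Quotient.mk _ (𝒯.r i)) ⟨fun i i' h => ?_, ?_⟩)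
  · obtain ⟨g, hg⟩ := Quotient.exact h
    exact (𝒯.r_inj _ _ g hg).symm
  · intro q
    induction q using Quotient.inductionOn with
    | h x =>
      obtain ⟨i, g, rfl⟩ := 𝒯.r_surj x
      exact ⟨i, Quotient.sound ⟨g⁻¹, by simp⟩⟩

/-- The representatives of edges as orbits of edges. -/
noncomputable def edgeEquiv : 𝒯.J ≃ T.EdgeOrbits := by
  refine Equiv.ofBijective (fun i => Quotient.mk _ (𝒯.ε i)) ⟨fun i i' h => ?_, ?_⟩
  · obtain ⟨g, hg⟩ := Quotient.exact h
    exact (𝒯.ε_inj _ _ g hg).symm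
  · intro q
    induction q using Quotient.inductionOn with
    | h x =>
      obtain ⟨i, g, rfl⟩ := 𝒯.ε_surj x
      exact ⟨i, Quotient.sound ⟨g⁻¹, by simp⟩⟩

/-- The number of representatives of edges outside the maximal subtree is bounded by the number of
generators. -/
theorem card_compl_le [Finite 𝒯.J] {S : Finset G} (hS : Subgroup.closure (S : Set G) = ⊤) :
    Nat.card ↥(𝒯.Dᶜ) ≤ S.card := by
  classical
  -- Values in a group of order two may be prescribed freely on the letters outside the subtree,
  -- whereas a homomorphism is determined on `S`; compare the powers of two.
  let M : Type u := ULift.{u} (Multiplicative (ZMod 2))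
  have hex (a : ↥(𝒯.Dᶜ) → M) : ∃ R : G →* M, ∀ j : ↥(𝒯.Dᶜ), R (𝒯.τ j) = a j := by
    obtain ⟨R, -, hR⟩ := 𝒯.universal M (fun i => 1)
      (fun j => if h : j ∈ 𝒯.Dᶜ then a ⟨j, h⟩ else 1)
      (fun j hj => dif_neg (fun h => h hj)) (fun j q hq => by
        simp only [MonoidHom.one_apply, one_mul, mul_one])
    exact ⟨R, fun j => (hR j.1).trans (dif_pos j.2)⟩
  choose R hR using hex
  have hinj : Function.Injective fun (a : ↥(𝒯.Dᶜ) → M) (s : S) => R a s := by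
    intro a b h
    have h1 : R a = R b := MonoidHom.eq_of_eqOn_dense hS fun s hs => congrFun h ⟨s, hs⟩
    funext j
    rw [← hR a, h1, hR]
  have hM : Nat.card M = 2 := by
    rw [Nat.card_congr Equiv.ulift, Nat.card_congr Multiplicative.toAdd, Nat.card_zmod]
  have : Finite M := Nat.finite_of_card_ne_zero (by omega)
  have h1 := Nat.card_le_card_of_injective _ hinj
  rw [Nat.card_fun, Nat.card_fun, hM, Nat.card_eq_fintype_card (α := S), Fintype.card_coe] at h1
  exact (Nat.pow_le_pow_iff_right one_lt_two).1 h1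

end Transversal

namespace GTree

variable {G : Type u} [Group G] {T : GTree G}

/-- The number of edge orbits is bounded by the number of vertex orbits and the number of
generators. -/
theorem Cofinite.card_edgeOrbits_le (hT : T.Cofinite) {S : Finset G}
    (hS : Subgroup.closure (S : Set G) = ⊤) :
    Nat.card T.EdgeOrbits ≤ Nat.card T.VertexOrbits + S.card := by
  obtain ⟨𝒯, hI, hJ⟩ := hT.exists_transversal
  rw [← Nat.card_congr 𝒯.edgeEquiv, ← 𝒯.card_vertexOrbits]
  have h1 := 𝒯.card_compl_le hS
  have h2 := 𝒯.tree.card_edges_le.2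
  have h3 := Set.ncard_add_ncard_compl 𝒯.D
  rw [← Nat.card_coe_set_eq, ← Nat.card_coe_set_eq] at h3
  omega

/-- The number of orbits of edges with equivalent end points is bounded by the number of
generators. -/
theorem Cofinite.card_loops_le (hT : T.Cofinite) {S : Finset G}
    (hS : Subgroup.closure (S : Set G) = ⊤) :
    {q : T.EdgeOrbits | ∃ e, Quotient.mk _ e = q ∧ ∃ g : G, g • T.d₀ e = T.d₁ e}.ncard ≤ S.card := by
  obtain ⟨𝒯, hI, hJ⟩ := hT.exists_transversal
  refine le_trans ?_ (𝒯.card_compl_le hS)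
  rw [Nat.card_coe_set_eq, ← Set.ncard_image_of_injective _ 𝒯.edgeEquiv.injective]
  have := (Set.toFinite (𝒯.Dᶜ)).image 𝒯.edgeEquiv
  refine Set.ncard_le_ncard ?_ this
  rintro _ ⟨e, rfl, g, hg⟩
  obtain ⟨j, k, rfl⟩ := 𝒯.ε_surj e
  refine ⟨j, fun hj => ?_, Quotient.sound ⟨k⁻¹, by simp⟩⟩
  have h1 : 𝒯.o j = 𝒯.t j := by
    refine 𝒯.r_inj _ _ (k⁻¹ * g * k) ?_
    rw [T.smul_d₀, T.smul_d₁, 𝒯.h₀, 𝒯.h₁, 𝒯.τ_eq_one j hj, one_smul] at hg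
    rw [mul_smul, mul_smul, hg, inv_smul_smul]
  exact 𝒯.tree.inc_ne (inc_self (⟨j, hj⟩ : 𝒯.D)) h1

/-- The edges whose end points are not equivalent have a smaller group than both end points. -/
def Reduced (T : GTree G) : Prop :=
  ∀ e u v, Inc T.d₀ T.d₁ e u v → (∀ g : G, g • u ≠ v) → ¬ ∀ g : G, g • u = u → g • e = e

variable (G) in
/-- The reduced trees with finite edge stabilizers and finitely many orbits have at most `n`
orbits of vertices. -/
def TreeAccessible (n : ℕ) : Prop :=
  ∀ T : GTree G, T.Cofinite → T.FiniteEdges → T.Reduced → Nat.card T.VertexOrbits ≤ n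

/-- The stabilizer of `v` fixes `o`, hence the first edge from `v` toward `o`. By reducedness that
edge must lead to a translate of `v`, but translates of `v` are equally far from the fixed vertex
`o`. -/
theorem Reduced.eq_of_fixed (hT : T.Reduced) {o : T.V} (ho : ∀ g : G, g • o = o) (v : T.V) :
    v = o := by
  by_contra hv
  obtain ⟨e, z, hz, he, hg⟩ := T.exists_edge_fixed (P := MulAction.stabilizer G v) hv
    (fun g hg => hg) fun g _ => ho g
  by_cases h : ∃ g : G, g • v = z
  · obtain ⟨g, rfl⟩ := h
    have h1 := T.isTree.tdist_step hz he
    have h2 := T.dist_smul g v o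
    rw [ho] at h2
    omega
  · push Not at h
    exact hT e v z hz h hg

theorem treeAccessible_of_finite [Finite G] : TreeAccessible G 1 := by
  intro T _ _ hT
  obtain ⟨o, ho⟩ := T.exists_fixed_of_finite
  have : Subsingleton T.VertexOrbits := ⟨fun a b => by
    induction a using Quotient.inductionOn with | h a => ?_
    induction b using Quotient.inductionOn with | h b => ?_
    rw [hT.eq_of_fixed ho a, hT.eq_of_fixed ho b]⟩
  exact Finite.card_le_one_iff_subsingleton.2 this

/-- The vertices of a tree over a set with finitely many orbits are counted along the fibres. -/
theorem Cofinite.card_vertexOrbits_le {A : GTree G} (hT : T.Cofinite) (hE : T.FiniteEdges)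
    {p : T.V → A.V} (hp : ∀ (g : G) x, p (g • x) = g • p x)
    (hf : ∀ x y, p x = p y → Link T.d₀ T.d₁ {e | p (T.d₀ e) = p x ∧ p (T.d₁ e) = p x} x y)
    (hr : ∀ e u v, Inc T.d₀ T.d₁ e u v → p u = p v → (∀ g : G, g • u ≠ v) →
      ¬ ∀ g : G, g • u = u → g • e = e)
    [Fintype A.VertexOrbits] {n : A.VertexOrbits → ℕ}
    (hn : ∀ q, TreeAccessible (MulAction.stabilizer G q.out) (n q)) :
    Nat.card T.VertexOrbits ≤ ∑ q, n q := by
  classical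
  have := hT.vertices
  have := Fintype.ofFinite T.VertexOrbits
  let π : T.VertexOrbits → A.VertexOrbits := Quotient.map p (by
    rintro _ b ⟨g, rfl⟩
    exact ⟨g, (hp g b).symm⟩)
  rw [Nat.card_eq_fintype_card, ← Finset.card_univ,
    Finset.card_eq_sum_card_fiberwise (f := π) (t := Finset.univ) (fun _ _ => Finset.mem_coe.2 (Finset.mem_univ _))]
  refine Finset.sum_le_sum fun q _ => ?_
  -- The fibre over `w` is a reduced cofinite tree for the stabilizer of `w`, and its vertex orbits
  -- account for all the orbits of `T` over `q`.
  set w : A.V := q.out with hw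
  by_cases hx : ∃ x, p x = w
  · obtain ⟨x, hx⟩ := hx
    set H := MulAction.stabilizer G w
    let D : Set T.E := {e | p (T.d₀ e) = p x ∧ p (T.d₁ e) = p x}
    have hD : ∀ (g : H), ∀ e ∈ D, g • (e : (T.res H).E) ∈ D := by
      rintro g e ⟨h1, h2⟩
      have hg : g.1 • w = w := g.2
      constructor
      · change p (T.d₀ (g.1 • e)) = p x
        rw [T.smul_d₀, hp, h1, hx, hg]
      · change p (T.d₁ (g.1 • e)) = p x
        rw [T.smul_d₁, hp, h2, hx, hg]
    have hxH (g : H) : Link (T.res H).d₀ (T.res H).d₁ D x (g • (x : (T.res H).V)) := by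
      refine hf x (g.1 • x) ?_
      have hg : g.1 • w = w := g.2
      rw [hp, hx, hg]
    let F := (T.res H).component D hD x hxH
    let ι : F.V → T.V := fun y => y.1
    let κ : F.E → T.E := fun e => e.1
    have hpF (y : F.V) : p (ι y) = w := by
      have h1 : Link T.d₀ T.d₁ D x y.1 := y.2
      rw [← hx]
      exact (h1.lift (r := fun a b : T.V => p a = p b) ⟨fun _ => rfl, Eq.symm, Eq.trans⟩ fun e he =>
        he.1.trans he.2.symm).symm
    have hF : F.Cofinite := by
      have : Finite T.EdgeOrbits := hT
      refine Finite.of_injective (β := T.EdgeOrbits) (Quotient.map κ ?_) ?_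
      · rintro _ b ⟨g, rfl⟩
        exact ⟨g.1, rfl⟩
      · intro a b
        induction a using Quotient.inductionOn with | h a => ?_
        induction b using Quotient.inductionOn with | h b => ?_
        intro h
        obtain ⟨g, hg⟩ := Quotient.exact h
        have h1 : p (T.d₀ (κ a)) = w := a.2.1.1.trans hx
        have h2 : p (T.d₀ (κ b)) = w := b.2.1.1.trans hx
        have hg' : g • κ b = κ a := hg
        have h3 : g • w = w := by
          rw [← h2, ← hp, ← T.smul_d₀, hg', h1, h2]
        exact Quotient.sound ⟨⟨g, h3⟩, Subtype.ext hg'⟩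
    have hFE : F.FiniteEdges := (hE.res H).component
    have hFr : F.Reduced := by
      intro e u v hi huv hu
      refine hr (κ e) (ι u) (ι v) ?_ ?_ ?_ ?_
      · rcases hi with ⟨h1, h2⟩ | ⟨h1, h2⟩
        · exact Or.inl ⟨congrArg Subtype.val h1, congrArg Subtype.val h2⟩
        · exact Or.inr ⟨congrArg Subtype.val h1, congrArg Subtype.val h2⟩
      · rw [hpF, hpF]
      · intro g hg
        have h3 : g • w = w := by rw [← hpF u, ← hp, hg, hpF, hpF]
        exact huv ⟨g, h3⟩ (Subtype.ext hg)
      · intro g hg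
        have h3 : g • w = w := by rw [← hpF u, ← hp, hg]
        exact congrArg Subtype.val (hu ⟨g, h3⟩ (Subtype.ext hg))
    refine le_trans ?_ (hn q F hF hFE hFr)
    have := hF.vertices
    let j : F.VertexOrbits → T.VertexOrbits := Quotient.map ι (by
      rintro _ b ⟨g, rfl⟩
      exact ⟨g.1, rfl⟩)
    rw [← Set.ncard_coe_finset, ← Set.ncard_univ]
    refine le_trans (Set.ncard_le_ncard (t := j '' Set.univ) ?_ (Set.toFinite _))
      (Set.ncard_image_le (Set.toFinite _))
    intro o ho
    have ho : π o = q := (Finset.mem_filter.1 ho).2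
    induction o using Quotient.inductionOn with
    | h y =>
      have h1 : Quotient.mk _ (p y) = Quotient.mk _ w := ho.trans (Quotient.out_eq q).symm
      obtain ⟨g, hg⟩ := Quotient.exact h1.symm
      have hg' : g • p y = w := hg
      rw [← hp, ← hx] at hg'
      exact ⟨Quotient.mk _ ⟨g • y, hf _ _ hg'.symm⟩, trivial, Quotient.sound ⟨g, rfl⟩⟩
  · rw [Finset.card_eq_zero.2]
    · exact Nat.zero_le _
    · refine Finset.filter_eq_empty_iff.2 fun o _ ho => hx ?_
      induction o using Quotient.inductionOn with
      | h y =>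
        have h1 : Quotient.mk _ (p y) = Quotient.mk _ w := ho.trans (Quotient.out_eq q).symm
        obtain ⟨g, hg⟩ := Quotient.exact h1.symm
        exact ⟨g • y, (hp g y).trans hg⟩

end GTree

end FiniteSplitting

namespace FiniteSplitting

/-! ### Bounds for reduced trees -/

namespace GTree

variable {G : Type u} [Group G]

theorem collapse_inc {T : GTree G} {D : Set T.E} {hD : ∀ (g : G), ∀ e ∈ D, g • e ∈ D}
    {e : (T.collapse D hD).E} {x y : (T.collapse D hD).V}
    (h : Inc (T.collapse D hD).d₀ (T.collapse D hD).d₁ e x y) :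
    ∃ u v, Inc T.d₀ T.d₁ e.1 u v ∧ T.toCollapse D hD u = x ∧ T.toCollapse D hD v = y := by
  rcases h with ⟨rfl, rfl⟩ | ⟨rfl, rfl⟩
  · exact ⟨_, _, inc_self e.1, rfl, rfl⟩
  · exact ⟨_, _, (inc_self e.1).symm, rfl, rfl⟩

theorem Contractible.exists_fixed {T : GTree G} {D : Set T.E} (h : T.Contractible D)
    {hD : ∀ (g : G), ∀ e ∈ D, g • e ∈ D} (y : (T.collapse D hD).V) :
    ∃ x, T.toCollapse D hD x = y ∧ ∀ g : G, g • y = y → g • x = x := by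
  obtain ⟨x, rfl⟩ := T.toCollapse_surjective y
  obtain ⟨z, hz, hg⟩ := h x
  refine ⟨z, T.toCollapse_eq.2 hz.symm, fun g h => hg g ?_⟩
  rw [smul_toCollapse] at h
  exact T.toCollapse_eq.1 h.symm

theorem Cofinite.collapse {T : GTree G} (h : T.Cofinite) {D : Set T.E}
    {hD : ∀ (g : G), ∀ e ∈ D, g • e ∈ D} : (T.collapse D hD).Cofinite := by
  have : Finite (MulAction.orbitRel.Quotient G T.E) := h
  exact Finite.of_injective _ T.collapseOrbit_injective

theorem Resolves.eq_of_link {R A : GTree G} {p : R.V → A.V} {S : Set R.E} {x y : R.V}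
    (h : Link R.d₀ R.d₁ S x y) (hS : ∀ e ∈ S, p (R.d₀ e) = p (R.d₁ e)) : p x = p y :=
  h.lift (r := fun a b : R.V => p a = p b) ⟨fun _ => rfl, Eq.symm, Eq.trans⟩ hS

/-- For a given tree `A` whose vertex groups are accessible, every tree `T` is dominated by a tree
with a bounded number of vertex orbits. -/
theorem exists_dominating [Group.FG G] {A : GTree G} (hA : A.FiniteEdges) [Fintype A.VertexOrbits]
    {n : A.VertexOrbits → ℕ} (hn : ∀ q, TreeAccessible (MulAction.stabilizer G q.out) (n q))
    (T : GTree G) (hT : T.FiniteEdges) :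
    ∃ B : GTree G, B.Cofinite ∧ B.FiniteEdges ∧ Nat.card B.VertexOrbits ≤ ∑ q, n q ∧
      ∀ w : B.V, ∃ v : T.V, ∀ g : G, g • w = w → g • v = v := by
  -- In the blow-up of `A` by `T`, the first coordinate maps to `A` with subtrees as fibres, and the
  -- second is an equivariant map to `T`.
  obtain ⟨f, hf⟩ := hA.exists_equivariant T
  obtain ⟨D, hD, x, hx, hc, -⟩ := (A.blow T f hf).exists_component_cofinite_of_finite Set.finite_empty
  set R := (A.blow T f hf).component D hD x hx with hR
  have hRE : R.FiniteEdges := (hA.blow hT).component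
  have hres := (resolves_blow A T f hf).component (hD := hD) (hx := hx)
  set p : R.V → A.V := fun y => y.1.1 with hp
  -- Only edges inside the fibres over `A` may be collapsed, so the reduced tree still maps to `A`.
  let W : Set R.E := {e | p (R.d₀ e) = p (R.d₁ e)}
  have hW : ∀ (g : G), ∀ e ∈ W, g • e ∈ W := by
    intro g e he
    change p (R.d₀ (g • e)) = p (R.d₁ (g • e))
    rw [R.smul_d₀, R.smul_d₁]
    exact congrArg (g • ·) he
  obtain ⟨K, hK, hWK, hcon, hred⟩ := hc.exists_reduction hW
  have hKp {y z : R.V} (h : Link R.d₀ R.d₁ Kᶜ y z) : p y = p z :=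
    Resolves.eq_of_link h fun e he => by
      by_contra h
      exact he (hWK h)
  let B := R.collapse K hK
  let q : B.V → A.V := Quotient.lift p fun _ _ h => hKp h
  have hq (y : R.V) : q (R.toCollapse K hK y) = p y := rfl
  refine ⟨B, hc.collapse, hRE.collapse, ?_, fun w => ?_⟩
  · refine (hc.collapse (hD := hK)).card_vertexOrbits_le hRE.collapse (p := q) ?_ ?_ ?_ hn
    · intro g y
      obtain ⟨y, rfl⟩ := R.toCollapse_surjective y
      exact hres.equivariant g y
    · intro y z hyz
      obtain ⟨y, rfl⟩ := R.toCollapse_surjective y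
      obtain ⟨z, rfl⟩ := R.toCollapse_surjective z
      refine (hres.fibre y z hyz).map (R.toCollapse K hK) fun e he => ?_
      by_cases heK : e ∈ K
      · exact Link.edge (d₀ := B.d₀) (d₁ := B.d₁) (e := ⟨e, heK⟩) he
      · have h0 : R.toCollapse K hK (R.d₀ e) = R.toCollapse K hK (R.d₁ e) :=
          R.toCollapse_eq.2 (Link.edge (d₀ := R.d₀) (d₁ := R.d₁) (D := Kᶜ) heK)
        change Link B.d₀ B.d₁ _ (R.toCollapse K hK (R.d₀ e)) (R.toCollapse K hK (R.d₁ e))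
        rw [h0]
        exact Link.refl _
    · intro e u v hi huv hne hu
      obtain ⟨u, v, hi', rfl, rfl⟩ := collapse_inc hi
      refine hred e.1 e.2 ?_ u v hi' ?_ ?_
      · rcases hi' with ⟨h1, h2⟩ | ⟨h1, h2⟩
        · exact (congrArg p h1).trans (huv.trans (congrArg p h2.symm))
        · exact (congrArg p h1).trans (huv.symm.trans (congrArg p h2.symm))
      · intro g hg
        exact hne g (R.toCollapse_eq.2 hg)
      · intro g hg
        exact congrArg Subtype.val (hu g (R.toCollapse_eq.2 hg.symm))
  -- Contractibility gives a vertex of `R` fixed by the stabilizer of `w`; its second coordinate is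
  -- the fixed vertex of `T`.
  · obtain ⟨y, -, hy⟩ := hcon.exists_fixed w
    exact ⟨y.1.2, fun g hg => congrArg (fun z : R.V => z.1.2) (hy g hg)⟩

/-- A resolution of a tree that is reduced and has a bounded number of vertex orbits. -/
theorem Cofinite.exists_resolution [Group.FG G] {S : Finset G}
    (hS : Subgroup.closure (S : Set G) = ⊤) {T B : GTree G} (hT : T.Cofinite) (hB : B.Cofinite)
    (hTE : T.FiniteEdges)
    (hBT : ∀ w : B.V, ∃ v : T.V, ∀ g : G, g • w = w → g • v = v) :
    ∃ (R : GTree G) (p : R.V → T.V) (K : Set R.E) (hK : ∀ (g : G), ∀ e ∈ K, g • e ∈ K),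
      Resolves R T p ∧ (∀ v, ∃ (g : G) (x : R.V), p x = g • v) ∧ R.Contractible K ∧
      (R.collapse K hK).Cofinite ∧
      Nat.card (R.collapse K hK).VertexOrbits ≤ Nat.card B.VertexOrbits + S.card := by
  classical
  obtain ⟨f, hf⟩ := hTE.exists_equivariant B
  choose v hv using hBT
  have := hB.vertices
  have := hT.vertices
  obtain ⟨b₀⟩ := B.isTree.nonempty
  -- Keeping these vertices in the subtree gives every vertex group of `B` a fixed vertex in `R`;
  -- the vertices `b` make `p` meet every orbit of `T`.
  let a : B.VertexOrbits → (T.blow B f hf).V := fun q => (v q.out, q.out)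
  let b : T.VertexOrbits → (T.blow B f hf).V := fun q => (q.out, b₀)
  obtain ⟨D, hD, x, hx, hc, hX⟩ := (T.blow B f hf).exists_component_cofinite_of_finite
    ((Set.finite_range a).union (Set.finite_range b))
  set R := (T.blow B f hf).component D hD x hx with hR
  have hres := (resolves_blow T B f hf).component (hD := hD) (hx := hx)
  set p : R.V → T.V := fun y => y.1.1 with hp
  let a' : B.VertexOrbits → R.V := fun q => ⟨a q, hX _ (Or.inl ⟨q, rfl⟩)⟩
  obtain ⟨K, hK, -, hcon, hred⟩ := hc.exists_reduction (D := Set.univ) fun _ _ _ => trivial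
  set C := R.collapse K hK
  have hC : C.Cofinite := hc.collapse
  have := hC.vertices
  have : Finite C.EdgeOrbits := hC
  have ha' (q : B.VertexOrbits) (g : G) (h : g • q.out = q.out) : g • a' q = a' q :=
    Subtype.ext (Prod.ext (hv _ g h) h)
  let loops : Set C.EdgeOrbits :=
    {q | ∃ e, Quotient.mk _ e = q ∧ ∃ g : G, g • C.d₀ e = C.d₁ e}
  let o : C.EdgeOrbits → C.VertexOrbits := Quotient.map C.d₀ (by
    rintro _ b ⟨g, rfl⟩
    exact ⟨g, (C.smul_d₀ g b).symm⟩)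
  -- The stabilizer of a vertex `y` of `C` fixes a vertex of `B`, hence a translate of some `a' q`.
  -- Unless `y` is the image of this translate, that stabilizer fixes the first edge toward it, and
  -- reducedness forces the edge to be a loop in the quotient.
  have hcover : (Set.univ : Set C.VertexOrbits) ⊆
      Set.range (fun q => Quotient.mk _ (R.toCollapse K hK (a' q))) ∪ o '' loops := by
    rintro y -
    induction y using Quotient.inductionOn with | h y => ?_
    obtain ⟨z, hz, hyz⟩ := hcon.exists_fixed y
    obtain ⟨g, hg⟩ := Quotient.exact (Quotient.out_eq (Quotient.mk (MulAction.orbitRel G B.V) z.1.2)).symm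
    set q : B.VertexOrbits := Quotient.mk (MulAction.orbitRel G B.V) z.1.2
    have hg' : g • q.out = z.1.2 := hg
    have hfix (k : G) (hk : k • y = y) :
        k • R.toCollapse K hK (g • a' q) = R.toCollapse K hK (g • a' q) := by
      have h1 : k • z.1.2 = z.1.2 := congrArg (fun z : R.V => z.1.2) (hyz k hk)
      have h2 : (g⁻¹ * k * g) • q.out = q.out := by
        rw [mul_smul, mul_smul, hg', h1, ← hg', inv_smul_smul]
      have h3 := ha' q _ h2
      rw [mul_smul, mul_smul, inv_smul_eq_iff] at h3
      rw [smul_toCollapse, h3]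
    by_cases hy : y = R.toCollapse K hK (g • a' q)
    · exact Or.inl ⟨q, Quotient.sound ⟨g⁻¹, by
        rw [hy, ← smul_toCollapse]
        exact inv_smul_smul g (R.toCollapse K hK (a' q))⟩⟩
    · right
      obtain ⟨e, z', hz', -, he⟩ := C.exists_edge_fixed (P := MulAction.stabilizer G y) hy
        (fun k hk => hk) hfix
      have hloop : ∃ k : G, k • y = z' := by
        by_contra hno
        push Not at hno
        obtain ⟨u, w, hi, rfl, rfl⟩ := collapse_inc hz'
        refine hred e.1 e.2 trivial u w hi (fun k hk => hno k (R.toCollapse_eq.2 hk))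
          fun k hk => congrArg Subtype.val (he k (R.toCollapse_eq.2 hk.symm))
      obtain ⟨k, rfl⟩ := hloop
      rcases hz' with ⟨h1, h2⟩ | ⟨h1, h2⟩
      · exact ⟨Quotient.mk _ e, ⟨e, rfl, k, by rw [h1, h2]⟩, congrArg (Quotient.mk _) h1⟩
      · refine ⟨Quotient.mk _ e, ⟨e, rfl, k⁻¹, by rw [h1, h2, inv_smul_smul]⟩, ?_⟩
        exact Quotient.sound ⟨k, h1.symm⟩
  refine ⟨R, p, K, hK, hres, fun t => ?_, hcon, hC, ?_⟩
  · let q : T.VertexOrbits := Quotient.mk _ t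
    obtain ⟨g, hg⟩ := Quotient.exact (Quotient.out_eq q)
    exact ⟨g, ⟨b q, hX _ (Or.inr ⟨q, rfl⟩)⟩, hg.symm⟩
  · rw [← Set.ncard_univ]
    refine (Set.ncard_le_ncard hcover (Set.toFinite _)).trans ((Set.ncard_union_le _ _).trans ?_)
    refine add_le_add ?_ ((Set.ncard_image_le (Set.toFinite _)).trans (hC.card_loops_le hS))
    rw [← Set.image_univ, ← Set.ncard_univ]
    exact Set.ncard_image_le (Set.toFinite _)

/-- The number of vertex orbits of a reduced tree is bounded by the size of a contraction of a
resolution. -/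
theorem Reduced.card_vertexOrbits_le {T R : GTree G} (hT : T.Reduced) {p : R.V → T.V}
    (hres : Resolves R T p) (hsurj : ∀ v, ∃ (g : G) (x : R.V), p x = g • v) {K : Set R.E}
    {hK : ∀ (g : G), ∀ e ∈ K, g • e ∈ K} (hcon : R.Contractible K)
    (hc : (R.collapse K hK).Cofinite) :
    Nat.card T.VertexOrbits ≤
      Nat.card (R.collapse K hK).VertexOrbits + Nat.card (R.collapse K hK).EdgeOrbits := by
  set C := R.collapse K hK
  have := hc.vertices
  have : Finite C.EdgeOrbits := hc
  choose ρ hρ hρ' using fun y : C.V => hcon.exists_fixed y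
  -- Every vertex orbit of `T` is met by the image of a fixed vertex of a collapsed component or of
  -- the initial vertex of an uncollapsed edge.
  let F : C.VertexOrbits ⊕ C.EdgeOrbits → T.VertexOrbits :=
    Sum.elim (fun c => Quotient.mk _ (p (ρ c.out))) (Quotient.map (fun e => p (R.d₀ e.1)) (by
      rintro _ b ⟨g, rfl⟩
      refine ⟨g, ?_⟩
      change g • p (R.d₀ b.1) = p (R.d₀ (g • b.1))
      rw [R.smul_d₀, hres.equivariant]))
  have hF : Function.Surjective F := by
    intro v
    induction v using Quotient.inductionOn with | h v => ?_
    obtain ⟨k, x, hx⟩ := hsurj v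
    rw [show (Quotient.mk _ v : T.VertexOrbits) = Quotient.mk _ (p x) from
      Quotient.sound ⟨k⁻¹, by simp [hx]⟩]
    clear hx k v
    by_contra hno
    push Not at hno
    have hnoE : ∀ e ∈ K, ∀ g : G, p (R.d₀ e) ≠ g • p x := fun e he g h =>
      hno (Sum.inr (Quotient.mk _ ⟨e, he⟩)) (Quotient.sound ⟨g, h.symm⟩)
    let c : C.VertexOrbits := Quotient.mk _ (R.toCollapse K hK x)
    obtain ⟨k, hk⟩ := Quotient.exact (Quotient.out_eq c).symm
    have hk : k • c.out = R.toCollapse K hK x := hk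
    set r : R.V := k • ρ c.out with hr
    have hxr : Link R.d₀ R.d₁ Kᶜ x r := by
      refine (R.toCollapse_eq (hD := hK)).1 ?_
      rw [← hk, hr, ← smul_toCollapse, hρ]
    have hpr : p x ≠ p r := by
      intro h
      refine hno (Sum.inl c) (Quotient.sound ⟨k⁻¹, ?_⟩)
      change k⁻¹ • p x = p (ρ c.out)
      rw [h, hr, hres.equivariant, inv_smul_smul]
    -- If the orbit of `p x` is missed by uncollapsed edges, every fibre over it lies in a single
    -- collapsed component.
    have hfib (g : G) {y z : R.V} (hy : p y = g • p x) (hz : p z = g • p x) :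
        Link R.d₀ R.d₁ Kᶜ y z := by
      refine (hres.fibre y z (hy.trans hz.symm)).mono fun e he heK => ?_
      exact hnoE e heK g (he.1.trans hy)
    have hgr (g : G) (h : Link R.d₀ R.d₁ Kᶜ x (g • x)) : g • p r = p r := by
      have h1 : g • k • c.out = k • c.out := by
        rw [hk, smul_toCollapse]
        exact (R.toCollapse_eq.2 h).symm
      have h2 : (k⁻¹ * g * k) • c.out = c.out := by
        rw [mul_smul, mul_smul, h1, inv_smul_smul]
      have h3 := hρ' _ _ h2
      rw [mul_smul, mul_smul, inv_smul_eq_iff] at h3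
      rw [← hres.equivariant, hr, h3]
    have hst (g : G) (hg : g • p x = p x) : g • p r = p r := by
      refine hgr g (hfib 1 (one_smul _ _).symm ?_)
      rw [hres.equivariant, hg, one_smul]
    obtain ⟨e, z, hz, he, hge⟩ := T.exists_edge_fixed (P := MulAction.stabilizer G (p x)) hpr
      (fun g hg => hg) fun g hg => hst g hg
    have hloop : ∃ g : G, g • p x = z := by
      by_contra h
      push Not at h
      exact hT e _ z hz h hge
    obtain ⟨g, rfl⟩ := hloop
    -- The path from `x` to `r` crosses a collapsed edge lying over `e`. It joins the fibres over `p
    -- x` and `g • p x`, so `g` preserves the component and fixes `p r`, although it moves `p x` one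
    -- step closer to `p r`.
    obtain ⟨f, hf, hfs⟩ : ∃ f ∈ Sep R.d₀ R.d₁ x r,
        ¬ (Side T.d₀ T.d₁ e (p (R.d₀ f)) ↔ Side T.d₀ T.d₁ e (p (R.d₁ f))) := by
      by_contra! h
      exact mem_sep.1 he ((R.isTree.link_sep x r).propagate
        (P := fun y => Side T.d₀ T.d₁ e (p y)) h)
    have hfK : f ∈ Kᶜ := hxr.sep_subset hf
    have hfe : Inc T.d₀ T.d₁ e (p (R.d₀ f)) (p (R.d₁ f)) := by
      rcases hres.edge f with h | ⟨a, ha⟩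
      · rw [h] at hfs
        exact (hfs Iff.rfl).elim
      · have h1 := T.isTree.sep_inc ha
        have h2 : e ∈ Sep T.d₀ T.d₁ (p (R.d₀ f)) (p (R.d₁ f)) := mem_sep.2 hfs
        rw [h1] at h2
        rwa [Set.mem_singleton_iff.1 h2]
    have hxg : Link R.d₀ R.d₁ Kᶜ x (g • x) := by
      have hgx : p (g • x) = g • p x := hres.equivariant g x
      have h1 : p x = (1 : G) • p x := (one_smul _ _).symm
      have hends : (p (R.d₀ f) = p x ∧ p (R.d₁ f) = g • p x) ∨
          (p (R.d₁ f) = p x ∧ p (R.d₀ f) = g • p x) := by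
        rcases hz with ⟨h1, h2⟩ | ⟨h1, h2⟩ <;> rcases hfe with ⟨h3, h4⟩ | ⟨h3, h4⟩
        · exact Or.inl ⟨h3.symm.trans h1, h4.symm.trans h2⟩
        · exact Or.inr ⟨h3.symm.trans h1, h4.symm.trans h2⟩
        · exact Or.inr ⟨h4.symm.trans h2, h3.symm.trans h1⟩
        · exact Or.inl ⟨h4.symm.trans h2, h3.symm.trans h1⟩
      rcases hends with ⟨h2, h3⟩ | ⟨h2, h3⟩
      · exact (hfib 1 h1 (h2.trans h1)).trans ((Link.edge hfK).trans (hfib g h3 hgx))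
      · exact (hfib 1 h1 (h2.trans h1)).trans ((Link.edge hfK).symm.trans (hfib g h3 hgx))
    have h1 := T.isTree.tdist_step hz he
    have h2 := T.dist_smul g (p x) (p r)
    rw [hgr g hxg] at h2
    omega
  rw [← Nat.card_sum]
  exact Nat.card_le_card_of_surjective F hF

/-- The size of the reduced trees is bounded if there is a tree with finite edge stabilizers and
accessible vertex stabilizers. -/
theorem Cofinite.exists_bound [hG : Group.FG G] {A : GTree G} (hA : A.Cofinite) (hAE : A.FiniteEdges)
    (h : ∀ w : A.V, ∃ n, TreeAccessible (MulAction.stabilizer G w) n) :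
    ∃ n : ℕ, ∀ T : GTree G, T.Cofinite → T.FiniteEdges → T.Reduced →
      Nat.card T.VertexOrbits + Nat.card T.EdgeOrbits ≤ n := by
  have := hA.vertices
  have := Fintype.ofFinite A.VertexOrbits
  choose n hn using h
  obtain ⟨S, hS⟩ := Group.fg_def.1 hG
  -- With `N` the sum and `s` the number of generators: the auxiliary tree has at most `N + s`
  -- vertex orbits and `N + 2s` edge orbits, so `T` has at most `2N + 3s` and `2N + 4s`.
  refine ⟨4 * (∑ q : A.VertexOrbits, n q.out) + 7 * S.card, fun T hT hTE hTr => ?_⟩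
  obtain ⟨B, hB, -, hBn, hBT⟩ := exists_dominating hAE (n := fun q => n q.out) (fun q => hn q.out) T hTE
  obtain ⟨R, p, K, hK, hres, hsurj, hcon, hc, hcard⟩ := hT.exists_resolution hS hB hTE hBT
  have h1 := hTr.card_vertexOrbits_le hres hsurj hcon hc
  have h2 := hc.card_edgeOrbits_le hS
  have h3 := hT.card_edgeOrbits_le hS
  omega

end GTree

end FiniteSplitting

/-! ### Accessibility in terms of reduced trees -/

namespace FiniteSplitting

namespace Splitting

variable {π : Type u} [Group π] (S : Splitting π)

theorem smul_vtx_iff {h g : π} {i : S.I} : h • S.vtx i g = S.vtx i g ↔ g⁻¹ * h * g ∈ S.P i := by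
  rw [smul_vtx, vtx_eq, ← inv_mem_iff]
  simp [mul_assoc]

theorem smul_edg_iff {h g : π} {j : S.J} : h • S.edg j g = S.edg j g ↔ g⁻¹ * h * g ∈ S.Q j := by
  rw [smul_edg, edg_eq, ← inv_mem_iff]
  simp [mul_assoc]

/-- The vertex stabilizers of the tree of a splitting are isomorphic to the vertex groups. -/
theorem exists_stabilizer_equiv (hS : S.Universal) (v : (S.toGTree hS).V) :
    ∃ i, Nonempty (MulAction.stabilizer π v ≃* S.P i) := by
  obtain ⟨i, g, rfl⟩ := S.exists_vtx v
  have h1 : MulAction.stabilizer π (S.vtx i 1) = S.P i := Subgroup.ext fun h => S.smul_vtx_one i h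
  refine ⟨i, ⟨(MulAction.stabilizerEquivStabilizer (g := g⁻¹) (b := S.vtx i 1) ?_).trans
    (MulEquiv.subgroupCongr h1)⟩⟩
  exact (congrArg (S.vtx i) (inv_mul_cancel g)).symm

theorem cofinite_toGTree (hS : S.Universal) [Finite S.J] : (S.toGTree hS).Cofinite := by
  refine Finite.of_surjective (fun j => Quotient.mk (MulAction.orbitRel π (S.toGTree hS).E)
    (S.edg j 1)) fun q => ?_
  induction q using Quotient.inductionOn with | h e => ?_
  obtain ⟨j, g, rfl⟩ := S.exists_edg e
  exact ⟨j, Quotient.sound ⟨g⁻¹, congrArg (S.edg j) (inv_mul_cancel g)⟩⟩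

theorem finiteEdges_toGTree (hS : S.Universal) (h : ∀ j, Finite (S.Q j)) :
    (S.toGTree hS).FiniteEdges := by
  intro e
  obtain ⟨j, g, rfl⟩ := S.exists_edg e
  have := h j
  refine Finite.of_injective (β := S.Q j) (fun a => ⟨g⁻¹ * a.1 * g, S.smul_edg_iff.1 a.2⟩)
    fun a b hab => ?_
  have h1 : g⁻¹ * a.1 * g = g⁻¹ * b.1 * g := congrArg Subtype.val hab
  exact Subtype.ext (by simpa using h1)

end Splitting

namespace GTree

variable {G H : Type u} [Group G] [Group H] {T : GTree G}

theorem Cofinite.comap (hT : T.Cofinite) (e : H ≃* G) : (T.comap e.toMonoidHom).Cofinite := by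
  have : Finite (MulAction.orbitRel.Quotient G T.E) := hT
  let f : MulAction.orbitRel.Quotient G T.E →
    MulAction.orbitRel.Quotient H (T.comap e.toMonoidHom).E := Quotient.map id (by
      rintro _ b ⟨g, rfl⟩
      refine ⟨e.symm g, ?_⟩
      change e (e.symm g) • b = g • b
      rw [e.apply_symm_apply])
  refine Finite.of_surjective f fun q => ?_
  induction q using Quotient.inductionOn with | h x => ?_
  exact ⟨Quotient.mk _ x, rfl⟩

/-- The stabilizers of the restriction of the action along an isomorphism. -/
def stabilizerComapEquiv (T : GTree G) (e : H ≃* G) (v : T.V) :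
    MulAction.stabilizer H (show (T.comap e.toMonoidHom).V from v) ≃* MulAction.stabilizer G v where
  toFun h := ⟨e h.1, h.2⟩
  invFun g := ⟨e.symm g.1, by
    change e (e.symm g.1) • v = v
    rw [e.apply_symm_apply]; exact g.2⟩
  left_inv h := Subtype.ext (e.symm_apply_apply _)
  right_inv h := Subtype.ext (e.apply_symm_apply _)
  map_mul' a b := Subtype.ext (map_mul e _ _)

theorem FiniteEdges.comap (hT : T.FiniteEdges) (e : H ≃* G) :
    (T.comap e.toMonoidHom).FiniteEdges := by
  intro x
  have := hT x
  refine Finite.of_injective (β := MulAction.stabilizer G (show T.E from x))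
    (fun h => ⟨e h.1, h.2⟩) fun a b hab => ?_
  exact Subtype.ext (e.injective (congrArg Subtype.val hab))

theorem Reduced.comap (hT : T.Reduced) (e : H ≃* G) : (T.comap e.toMonoidHom).Reduced := by
  intro x (u : T.V) (v : T.V) hi huv hu
  refine hT x u v hi (fun g hg => huv (e.symm g) ?_) fun g hg => ?_
  · change e (e.symm g) • u = v
    rw [e.apply_symm_apply]; exact hg
  · have h1 : ∀ h : H, e h • u = u → e h • (show T.E from x) = x := hu
    simpa using h1 (e.symm g) (by simpa using hg)

theorem Cofinite.card_comap_le (hT : T.Cofinite) (e : H ≃* G) :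
    Nat.card T.VertexOrbits ≤ Nat.card (T.comap e.toMonoidHom).VertexOrbits := by
  have := (hT.comap e).vertices
  refine Nat.card_le_card_of_injective (β := (T.comap e.toMonoidHom).VertexOrbits)
    (Quotient.map id ?_) fun a b => ?_
  · rintro _ b ⟨g, rfl⟩
    refine ⟨e.symm g, ?_⟩
    change e (e.symm g) • b = g • b
    rw [e.apply_symm_apply]
  · induction a using Quotient.inductionOn with | h a => ?_
    induction b using Quotient.inductionOn with | h b => ?_
    intro h
    obtain ⟨g, hg⟩ := Quotient.exact h
    exact Quotient.sound ⟨e g, hg⟩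

theorem TreeAccessible.of_mulEquiv {n : ℕ} (h : TreeAccessible H n) (e : H ≃* G) :
    TreeAccessible G n := fun _ hT hE hr =>
  (hT.card_comap_le e).trans (h _ (hT.comap e) (hE.comap e) (hr.comap e))

end GTree

/-- The trees of an accessible group have boundedly many orbits of vertices. -/
theorem Accessible.exists_treeAccessible {G : Type u} [Group G] (h : Accessible G) :
    ∃ n, GTree.TreeAccessible G n := by
  obtain ⟨n, hn⟩ := h
  refine ⟨n, fun T hT hE hr => ?_⟩
  obtain ⟨𝒯, hI, hJ⟩ := hT.exists_transversal
  have hne {j : 𝒯.J} (hj : 𝒯.o j ≠ 𝒯.t j) (g : G) : g • T.d₀ (𝒯.ε j) ≠ T.d₁ (𝒯.ε j) := by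
    rw [𝒯.h₀, 𝒯.h₁]
    intro h
    refine hj (𝒯.r_inj _ _ ((𝒯.τ j)⁻¹ * g) ?_)
    rw [mul_smul, h, inv_smul_smul]
  have h1 := hn 𝒯.toSplitting.graphOfGroups 𝒯.D hI hJ
    (GraphOfGroups.isMaximalSubtree_of_isTree 𝒯.tree) (fun (j : 𝒯.J) hj => ⟨fun hs => ?_, fun hs => ?_⟩)
    (fun (j : 𝒯.J) => hE (𝒯.ε j)) (𝒯.toSplitting.nonempty_mulEquiv 𝒯.universal)
  · rw [← 𝒯.card_vertexOrbits]
    exact le_trans (Nat.le_add_right _ _) h1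
  · refine hr (𝒯.ε j) _ _ (inc_self _) (hne hj) fun g hg => ?_
    rw [𝒯.h₀] at hg
    obtain ⟨q, hq⟩ := hs ⟨g, hg⟩
    have h2 : q.1 = g := congrArg Subtype.val hq
    rw [← h2]
    exact q.2
  · refine hr (𝒯.ε j) _ _ (inc_self _).symm (fun g hg => ?_) fun g hg => ?_
    · exact hne hj g⁻¹ (by rw [← hg, inv_smul_smul])
    · rw [𝒯.h₁] at hg
      obtain ⟨q, hq⟩ := hs ⟨(𝒯.τ j)⁻¹ * g * 𝒯.τ j, by
        change ((𝒯.τ j)⁻¹ * g * 𝒯.τ j) • 𝒯.r (𝒯.t j) = 𝒯.r (𝒯.t j)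
        rw [mul_smul, mul_smul, hg, inv_smul_smul]⟩
      have h2 : (𝒯.τ j)⁻¹ * q.1 * 𝒯.τ j = (𝒯.τ j)⁻¹ * g * 𝒯.τ j := congrArg Subtype.val hq
      have h3 : q.1 = g := by simpa using h2
      rw [← h3]
      exact q.2

/-- A group is accessible if the size of its reduced trees is bounded. -/
theorem accessible_of_bound {G : Type u} [Group G] {n : ℕ}
    (hn : ∀ T : GTree G, T.Cofinite → T.FiniteEdges → T.Reduced →
      Nat.card T.VertexOrbits + Nat.card T.EdgeOrbits ≤ n) : Accessible G := by
  refine ⟨n, fun 𝒢 D hV hE hD hr hfin ⟨e⟩ => ?_⟩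
  set S := 𝒢.splitting D hD
  have hS : S.Universal := 𝒢.splitting_universal D hD
  have hEJ : Finite S.J := hE
  let T := S.toGTree hS
  have hT : T.Cofinite := S.cofinite_toGTree hS
  have hTE : T.FiniteEdges := S.finiteEdges_toGTree hS fun j => by
    have := hfin j
    exact Set.finite_range _
  have conj (a b : 𝒢.FundamentalGroup D) : a⁻¹ * (a * b * a⁻¹) * a = b := by group
  have hTr : T.Reduced := by
    intro f u v hi huv hu
    obtain ⟨j, g, rfl⟩ := S.exists_edg f
    -- A loop in the graph of groups would make the two ends equivalent. For other edges, a vertex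
    -- stabilizer fixing the edge makes a boundary map surjective, since the vertex groups embed.
    have hends : 𝒢.d₀ j ≠ 𝒢.d₁ j := by
      intro h
      have h1 : S.vtx (S.t j) (g * S.τ j) = (g * S.τ j * g⁻¹) • S.vtx (S.o j) g := by
        rw [S.smul_vtx, inv_mul_cancel_right]
        exact congrArg (fun i => S.vtx i (g * S.τ j)) h.symm
      rcases hi with ⟨h2, h3⟩ | ⟨h2, h3⟩
      · refine huv (g * S.τ j * g⁻¹) ?_
        rw [← h2, ← h3]
        exact h1.symm
      · refine huv (g * S.τ j * g⁻¹)⁻¹ ?_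
        rw [← h2, ← h3]
        exact inv_smul_eq_iff.2 h1
    rcases hi with ⟨h2, -⟩ | ⟨-, h2⟩
    · refine (hr j hends).1 fun p => ?_
      have h3 := hu (g * 𝒢.ofVert D _ p * g⁻¹) (by
        rw [← h2]
        exact S.smul_vtx_iff.2 ⟨p, (conj g _).symm⟩)
      obtain ⟨q, hq⟩ := S.smul_edg_iff.1 h3
      exact ⟨q, 𝒢.ofVert_injective D hD _ (hq.trans (conj g _))⟩
    · refine (hr j hends).2 fun p => ?_
      have h3 := hu ((g * S.τ j) * 𝒢.ofVert D _ p * (g * S.τ j)⁻¹) (by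
        rw [← h2]
        exact S.smul_vtx_iff.2 ⟨p, (conj (g * S.τ j) _).symm⟩)
      obtain ⟨q, hq⟩ := S.smul_edg_iff.1 h3
      refine ⟨q, 𝒢.ofVert_injective D hD _ ?_⟩
      have h4 := 𝒢.ofVert_mul_ofEdge D j q
      have h5 : 𝒢.ofVert D _ (𝒢.bd₀ j q) = S.τ j * 𝒢.ofVert D _ p * (S.τ j)⁻¹ := by
        refine hq.trans ?_
        group
      rw [h5] at h4
      have h6 : S.τ j * 𝒢.ofVert D _ p = S.τ j * 𝒢.ofVert D _ (𝒢.bd₁ j q) :=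
        (inv_mul_cancel_right (S.τ j * 𝒢.ofVert D _ p) (S.τ j)).symm.trans h4
      exact (mul_left_cancel h6).symm
  have h1 := hn _ (hT.comap e) (hTE.comap e) (hTr.comap e)
  have := (hT.comap e).vertices
  have : Finite (T.comap e.toMonoidHom).EdgeOrbits := hT.comap e
  refine le_trans (add_le_add ?_ ?_) h1
  · refine Nat.card_le_card_of_injective (β := (T.comap e.toMonoidHom).VertexOrbits)
      (fun v : 𝒢.V => Quotient.mk _ (S.vtx v 1)) fun v w h => ?_
    obtain ⟨g, hg⟩ := Quotient.exact h
    exact (congrArg Sigma.fst hg).symm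
  · refine Nat.card_le_card_of_injective (β := (T.comap e.toMonoidHom).EdgeOrbits)
      (fun v : 𝒢.E => Quotient.mk _ (S.edg v 1)) fun v w h => ?_
    obtain ⟨g, hg⟩ := Quotient.exact h
    exact (congrArg Sigma.fst hg).symm

end FiniteSplitting

namespace FiniteSplitting

/-! ### Invariance under isomorphisms -/

theorem ProfiniteOE.of_bijective {P P' : Type u} [Group P] [TopologicalSpace P] [Group P']
    [TopologicalSpace P'] (h : ProfiniteOE P) (f : P →* P') (hc : Continuous f)
    (hf : Function.Bijective f) : ProfiniteOE P' := by
  intro T _ _ _ _ _ _ Γ hΓ h₀ h₁ hE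
  let _ : MulAction P T := MulAction.compHom T f
  have : ContinuousSMul P T :=
    ⟨(continuous_smul (M := P') (X := T)).comp (hc.prodMap continuous_id)⟩
  obtain ⟨v, hv, hfix⟩ := h T Γ hΓ (fun g x => h₀ (f g) x) (fun g x => h₁ (f g) x) fun e he => by
    have := hE e he
    refine Finite.of_injective (β := MulAction.stabilizer P' e) (fun g => ⟨f g.1, g.2⟩)
      fun a b hab => Subtype.ext (hf.1 (congrArg Subtype.val hab))
  refine ⟨v, hv, fun g => ?_⟩
  obtain ⟨g, rfl⟩ := hf.2 g
  exact hfix g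

theorem ProfiniteOE.of_mulEquiv {G G' : Type u} [Group G] [Group G'] (e : G ≃* G')
    (h : ProfiniteOE (ProfiniteGrp.ProfiniteCompletion.completion (GrpCat.of G))) :
    ProfiniteOE (ProfiniteGrp.ProfiniteCompletion.completion (GrpCat.of G')) := by
  let F := ProfiniteGrp.profiniteCompletion.mapIso
    (MulEquiv.toGrpIso (X := GrpCat.of G) (Y := GrpCat.of G') e)
  refine h.of_bijective F.hom.hom.toMonoidHom F.hom.hom.continuous_toFun ?_
  exact CategoryTheory.ConcreteCategory.bijective_of_isIso F.hom

theorem residuallyFinite_of_injective {G G' : Type*} [Group G] [Group G'] [Group.ResiduallyFinite G']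
    (f : G →* G') (hf : Function.Injective f) : Group.ResiduallyFinite G := by
  rw [Group.residuallyFinite_iff_forall_finiteIndexNormalSubgroup]
  intro g hg
  refine hf (Eq.trans ?_ f.map_one.symm)
  exact Group.eq_one_iff_forall_finiteIndexNormalSubroup _ fun K => hg (K.comap f)

/-! ### Groups in the class and finite groups -/

/-- A group that is isomorphic to a group in the class `𝒜` or to a finite group. -/
def FiniteOrA (G : Type u) [Group G] : Prop :=
  ∃ (K : Type u) (_ : Group K), (ClassA K ∨ Finite K) ∧ Nonempty (G ≃* K)

namespace FiniteOrA

variable {G G' : Type u} [Group G] [Group G']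

theorem of_classA (h : ClassA G) : FiniteOrA G := ⟨G, _, Or.inl h, ⟨MulEquiv.refl G⟩⟩

theorem of_finite [h : Finite G] : FiniteOrA G := ⟨G, _, Or.inr h, ⟨MulEquiv.refl G⟩⟩

theorem of_mulEquiv (e : G ≃* G') (h : FiniteOrA G) : FiniteOrA G' := by
  obtain ⟨K, _, hK, ⟨f⟩⟩ := h
  exact ⟨K, _, hK, ⟨e.symm.trans f⟩⟩

theorem fg (h : FiniteOrA G) : Group.FG G := by
  obtain ⟨K, _, hK, ⟨f⟩⟩ := h
  have : Group.FG K := by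
    rcases hK with hK | hK
    · exact ((classA_iff K).1 hK).fg
    · infer_instance
  exact Group.fg_of_surjective (f := f.symm.toMonoidHom) f.symm.surjective

theorem residuallyFinite (h : FiniteOrA G) : Group.ResiduallyFinite G := by
  obtain ⟨K, _, hK, ⟨f⟩⟩ := h
  have : Group.ResiduallyFinite K := by
    rcases hK with hK | hK
    · exact ((classA_iff K).1 hK).residuallyFinite
    · infer_instance
  exact residuallyFinite_of_injective f.toMonoidHom f.injective

theorem exists_treeAccessible (h : FiniteOrA G) : ∃ n, GTree.TreeAccessible G n := by
  obtain ⟨K, _, hK, ⟨f⟩⟩ := h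
  have : ∃ n, GTree.TreeAccessible K n := by
    rcases hK with hK | hK
    · exact ((classA_iff K).1 hK).accessible.exists_treeAccessible
    · exact ⟨1, GTree.treeAccessible_of_finite⟩
  obtain ⟨n, hn⟩ := this
  exact ⟨n, hn.of_mulEquiv f.symm⟩

theorem oneEnded (h : FiniteOrA G) (hG : OneEnded G) :
    ProfiniteOE (ProfiniteGrp.ProfiniteCompletion.completion (GrpCat.of G)) := by
  obtain ⟨K, _, hK, ⟨f⟩⟩ := h
  have h1 : OneEnded K := hG.of_mulEquiv f
  rcases hK with hK | hK
  · exact (((classA_iff K).1 hK).oneEnded h1).of_mulEquiv f.symm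
  · exact ((not_finite_iff_infinite.2 (oneEnded_iff.1 h1).2.1) hK).elim

/-- The defining condition covers only non-fictitious amalgams. If some `φ j` is surjective, then `K
j` is finite and the other factor is the whole group. -/
theorem amalgam (h : FiniteOrA G) {K : Fin 2 → Type u} [∀ i, Group (K i)] {H : Type u} [Group H]
    [Finite H] {φ : ∀ i, H →* K i} (hφ : ∀ i, Function.Injective (φ i))
    (e : G ≃* Monoid.PushoutI φ) (i : Fin 2) : FiniteOrA (K i) := by
  by_cases hs : ∀ i, ¬ Function.Surjective (φ i)
  · obtain ⟨L, _, hL, ⟨f⟩⟩ := h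
    rcases hL with hL | hL
    · exact of_classA (((classA_iff L).1 hL).amalgam K H φ hφ hs ⟨f.symm.trans e⟩ i)
    · have : Finite (K i) := Finite.of_injective (fun k => f (e.symm (Monoid.PushoutI.of i k)))
        (f.injective.comp (e.symm.injective.comp (Monoid.PushoutI.of_injective hφ i)))
      exact of_finite
  · push Not at hs
    obtain ⟨j, hj⟩ := hs
    by_cases hij : i = j
    · subst hij
      have : Finite (K i) := Finite.of_surjective _ hj
      exact of_finite
    · refine h.of_mulEquiv (e.trans (MulEquiv.ofBijective (Monoid.PushoutI.of i)
        ⟨Monoid.PushoutI.of_injective hφ i, ?_⟩).symm)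
      rw [← MonoidHom.range_eq_top, eq_top_iff]
      rintro x -
      induction x using Monoid.PushoutI.induction_on with
      | of k g =>
        by_cases hk : k = i
        · subst hk
          exact ⟨g, rfl⟩
        · obtain rfl : k = j := by omega
          obtain ⟨h, rfl⟩ := hj g
          exact ⟨φ i h, by
            rw [Monoid.PushoutI.of_apply_eq_base, Monoid.PushoutI.of_apply_eq_base]⟩
      | base h => exact ⟨φ i h, Monoid.PushoutI.of_apply_eq_base φ i h⟩
      | mul x y hx hy => exact mul_mem hx hy

theorem hnn (h : FiniteOrA G) {K : Type u} [Group K] {A B : Subgroup K} {φ : A ≃* B} (hA : Finite A)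
    (e : G ≃* HNNExtension K A B φ) : FiniteOrA K := by
  obtain ⟨L, _, hL, ⟨f⟩⟩ := h
  rcases hL with hL | hL
  · exact of_classA (((classA_iff L).1 hL).hnn K A B φ hA ⟨f.symm.trans e⟩)
  · have : Finite K := Finite.of_injective (fun k => f (e.symm (HNNExtension.of (φ := φ) k)))
      (f.injective.comp (e.symm.injective.comp (HNNExtension.of_injective _)))
    exact of_finite

/-- The vertex stabilizers of a tree with one orbit of edges. -/
theorem stabilizer_of_transitive (h : FiniteOrA G) {T : GTree G} (hE : T.FiniteEdges) {e : T.E}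
    (he : ∀ e', ∃ g : G, g • e = e') (v : T.V) : FiniteOrA (MulAction.stabilizer G v) := by
  have key : FiniteOrA (MulAction.stabilizer G (T.d₀ e)) ∧
      FiniteOrA (MulAction.stabilizer G (T.d₁ e)) := by
    have := hE e
    -- The quotient graph is a loop or a segment, giving an HNN-extension or an amalgam over the
    -- finite edge stabilizer.
    by_cases hl : ∃ g : G, g • T.d₀ e = T.d₁ e
    · obtain ⟨τ, hτ⟩ := hl
      obtain ⟨A, B, φ, hA, ⟨f⟩⟩ := T.nonempty_mulEquiv_hnn e he τ hτ.symm this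
      have h1 := h.hnn hA f
      exact ⟨h1, h1.of_mulEquiv (MulAction.stabilizerEquivStabilizer hτ.symm)⟩
    · push Not at hl
      obtain ⟨f⟩ := T.nonempty_mulEquiv_pushout e he hl
      have h1 := h.amalgam (fun i => Subgroup.inclusion_injective _) f
      exact ⟨h1 0, h1 1⟩
  have hne : ∃ y, v ≠ y := by
    by_contra! hv
    exact T.isTree.inc_ne (inc_self e) ((hv _).symm.trans (hv _))
  obtain ⟨y, hy⟩ := hne
  obtain ⟨f, z, hz⟩ := T.exists_inc hy
  obtain ⟨g, rfl⟩ := he f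
  rw [Inc, T.smul_d₀, T.smul_d₁] at hz
  rcases hz with ⟨rfl, -⟩ | ⟨-, rfl⟩
  · exact key.1.of_mulEquiv (MulAction.stabilizerEquivStabilizer rfl)
  · exact key.2.of_mulEquiv (MulAction.stabilizerEquivStabilizer rfl)

/-- Collapsing all edge orbits but one leaves a tree with a single edge orbit, whose stabilizers are
covered. The stabilizer of the class of `v` acts on the collapsed subtree through `v` with fewer
edge orbits and contains the full stabilizer of `v`. -/
theorem stabilizer_of_cofinite (h : FiniteOrA G) {T : GTree G} (hT : T.Cofinite)
    (hE : T.FiniteEdges) (v : T.V) : FiniteOrA (MulAction.stabilizer G v) := by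
  have hfin : Finite T.EdgeOrbits := hT
  obtain ⟨n, hn⟩ : ∃ n, Nat.card T.EdgeOrbits = n := ⟨_, rfl⟩
  induction n using Nat.strong_induction_on generalizing G T with
  | _ n ih =>
  by_cases hempty : IsEmpty T.EdgeOrbits
  · have htop : MulAction.stabilizer G v = ⊤ := by
      rw [eq_top_iff]
      rintro g -
      exact ((T.isTree.connected v (g • v)).lift (r := (· = ·)) ⟨fun _ => rfl, Eq.symm, Eq.trans⟩
        fun e _ => (hempty.false (Quotient.mk _ e)).elim).symm
    exact h.of_mulEquiv ((MulEquiv.subgroupCongr htop).trans Subgroup.topEquiv).symm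
  · obtain ⟨q₀⟩ := not_isEmpty_iff.1 hempty
    induction q₀ using Quotient.inductionOn with | h e₀ => ?_
    let D : Set T.E := {f | ∃ g : G, g • e₀ = f}
    have hD : ∀ (g : G), ∀ e ∈ D, g • e ∈ D := by
      rintro g _ ⟨k, rfl⟩
      exact ⟨g * k, mul_smul _ _ _⟩
    let x := T.toCollapse D hD v
    set P := MulAction.stabilizer G x with hP
    have hPA : FiniteOrA P := h.stabilizer_of_transitive (T := T.collapse D hD) hE.collapse
      (e := ⟨e₀, 1, one_smul _ _⟩) (fun e' => by
        obtain ⟨_, g, rfl⟩ := e'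
        exact ⟨g, Subtype.ext rfl⟩) x
    have hPmem (g : G) : g ∈ P ↔ Link T.d₀ T.d₁ Dᶜ v (g • v) :=
      ⟨fun hg => T.toCollapse_eq.1 (Eq.symm hg), fun hg => Eq.symm (T.toCollapse_eq.2 hg)⟩
    have hDP : ∀ (g : P), ∀ e ∈ Dᶜ, g • (e : (T.res P).E) ∈ Dᶜ := fun g e he =>
      T.smul_mem_compl hD g.1 e he
    let F := (T.res P).component Dᶜ hDP v fun g => (hPmem g.1).1 g.2
    let κ : F.E → T.E := fun e => e.1
    have hκ (e : F.E) : κ e ∈ Dᶜ ∧ Link T.d₀ T.d₁ Dᶜ v (T.d₀ (κ e)) := e.2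
    let m : F.EdgeOrbits → T.EdgeOrbits := Quotient.map κ (by
      rintro _ b ⟨g, rfl⟩
      exact ⟨g.1, rfl⟩)
    have hm : Function.Injective m := by
      intro a b
      induction a using Quotient.inductionOn with | h a => ?_
      induction b using Quotient.inductionOn with | h b => ?_
      intro hab
      obtain ⟨g, hg⟩ := Quotient.exact hab
      have hg' : g • κ b = κ a := hg
      have h1 := (hκ a).2
      rw [← hg', T.smul_d₀] at h1
      have h2 := T.smul_link g (T.smul_mem_compl hD g) (hκ b).2
      exact Quotient.sound ⟨⟨g, (hPmem g).2 (h1.trans h2.symm)⟩, Subtype.ext hg'⟩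
    have hFfin : Finite F.EdgeOrbits := Finite.of_injective m hm
    have hcard : Nat.card F.EdgeOrbits < Nat.card T.EdgeOrbits := by
      have := Fintype.ofFinite F.EdgeOrbits
      have := Fintype.ofFinite T.EdgeOrbits
      rw [Nat.card_eq_fintype_card, Nat.card_eq_fintype_card]
      refine Fintype.card_lt_of_injective_of_notMem m hm (b := Quotient.mk _ e₀) ?_
      rintro ⟨q, hq⟩
      induction q using Quotient.inductionOn with | h e => ?_
      obtain ⟨g, hg⟩ := Quotient.exact hq.symm
      refine (hκ e).1 ⟨g⁻¹, ?_⟩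
      have hg' : g • κ e = e₀ := hg
      rw [← hg', inv_smul_smul]
    let v' : F.V := ⟨v, Link.refl _⟩
    refine (ih _ (hn ▸ hcard) hPA hFfin (hE.res P).component v' hFfin rfl).of_mulEquiv
      { toFun := fun a => ⟨a.1.1, congrArg Subtype.val a.2⟩
        invFun := fun g => ⟨⟨g.1, (hPmem g.1).2 (by rw [g.2]; exact Link.refl v)⟩, Subtype.ext g.2⟩
        left_inv := fun _ => rfl
        right_inv := fun _ => rfl
        map_mul' := fun _ _ => rfl }

/-- The class is closed under vertex stabilizers of trees with finite edge stabilizers. -/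
theorem stabilizer (h : FiniteOrA G) {T : GTree G} (hE : T.FiniteEdges) (v : T.V) :
    FiniteOrA (MulAction.stabilizer G v) := by
  have := h.fg
  obtain ⟨D, hD, hx, hc⟩ := T.exists_component_cofinite v
  let v' : (T.component D hD v hx).V := ⟨v, Link.refl v⟩
  have h1 := h.stabilizer_of_cofinite hc hE.component v'
  exact h1.of_mulEquiv (MulEquiv.subgroupCongr (T.component_stab_V v'))

end FiniteOrA

/-! ### Groups that act on trees -/

/-- A group that acts on a tree with finitely many orbits, with finite edge stabilizers, and with
vertex stabilizers that are finite or in the class `𝒜`. -/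
def ActsOnTree (G : Type u) [Group G] : Prop :=
  ∃ T : GTree G, T.Cofinite ∧ T.FiniteEdges ∧ ∀ v : T.V, FiniteOrA (MulAction.stabilizer G v)

namespace ActsOnTree

variable {G G' : Type u} [Group G] [Group G']

theorem of_mulEquiv (e : G ≃* G') (h : ActsOnTree G) : ActsOnTree G' := by
  obtain ⟨T, hT, hE, hV⟩ := h
  exact ⟨T.comap e.symm.toMonoidHom, hT.comap e.symm, hE.comap e.symm, fun v =>
    (hV v).of_mulEquiv (T.stabilizerComapEquiv e.symm v).symm⟩

theorem fg (h : ActsOnTree G) : Group.FG G := by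
  obtain ⟨T, hT, -, hV⟩ := h
  exact hT.fg fun v => (hV v).fg

/-- The stabilizer of `w` in the stabilizer of `v` is the stabilizer of `v` in that of `w`, and the
latter group is already known to be finite or in the class. -/
theorem stabilizer (h : ActsOnTree G) {T : GTree G} (hE : T.FiniteEdges) (v : T.V) :
    ActsOnTree (MulAction.stabilizer G v) := by
  have := h.fg
  obtain ⟨A, -, hAE, hAV⟩ := h
  set H := MulAction.stabilizer G v
  have : Group.FG H := hE.fg_stabilizer v
  obtain ⟨x⟩ := A.isTree.nonempty
  obtain ⟨D, hD, hx, hc⟩ := (A.res H).exists_component_cofinite x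
  refine ⟨_, hc, (hAE.res H).component, fun w => ?_⟩
  let w' : A.V := w.1
  have h1 : FiniteOrA (MulAction.stabilizer (MulAction.stabilizer G w')
      (show (T.res (MulAction.stabilizer G w')).V from v)) :=
    (hAV w').stabilizer (hE.res _) _
  exact h1.of_mulEquiv
    { toFun := fun a => ⟨⟨a.1.1, a.2⟩, Subtype.ext a.1.2⟩
      invFun := fun g => ⟨⟨g.1.1, congrArg Subtype.val g.2⟩, g.1.2⟩
      left_inv := fun _ => rfl
      right_inv := fun _ => rfl
      map_mul' := fun _ _ => rfl }

theorem of_pushout {K : Fin 2 → Type u} [∀ i, Group (K i)] {H : Type u} [Group H] [Finite H]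
    {φ : ∀ i, H →* K i} (hφ : ∀ i, Function.Injective (φ i)) (h : ∀ i, FiniteOrA (K i)) :
    ActsOnTree (Monoid.PushoutI φ) := by
  have hS := pushoutSplitting_universal φ
  have : Finite (pushoutSplitting φ).J := inferInstanceAs (Finite Unit)
  refine ⟨(pushoutSplitting φ).toGTree hS, (pushoutSplitting φ).cofinite_toGTree hS,
    (pushoutSplitting φ).finiteEdges_toGTree hS fun _ => Set.finite_range _, fun v => ?_⟩
  obtain ⟨(i : Fin 2), ⟨e⟩⟩ := (pushoutSplitting φ).exists_stabilizer_equiv hS v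
  exact (h i).of_mulEquiv
    ((MonoidHom.ofInjective (Monoid.PushoutI.of_injective hφ i)).trans e.symm)

theorem of_hnn {K : Type u} [Group K] {A B : Subgroup K} {φ : A ≃* B} (hA : Finite A)
    (h : FiniteOrA K) : ActsOnTree (HNNExtension K A B φ) := by
  have hS := hnnSplitting_universal φ
  have : Finite (hnnSplitting φ).J := inferInstanceAs (Finite Unit)
  have : Finite B := Finite.of_equiv A φ.toEquiv
  refine ⟨(hnnSplitting φ).toGTree hS, (hnnSplitting φ).cofinite_toGTree hS,
    (hnnSplitting φ).finiteEdges_toGTree hS fun _ => (Set.toFinite (B : Set K)).image _,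
    fun v => ?_⟩
  obtain ⟨i, ⟨e⟩⟩ := (hnnSplitting φ).exists_stabilizer_equiv hS v
  exact h.of_mulEquiv ((MonoidHom.ofInjective (HNNExtension.of_injective φ)).trans e.symm)

theorem factor (h : ActsOnTree G) {K : Fin 2 → Type u} [∀ i, Group (K i)] {H : Type u} [Group H]
    [Finite H] {φ : ∀ i, H →* K i} (hφ : ∀ i, Function.Injective (φ i))
    (e : G ≃* Monoid.PushoutI φ) (i : Fin 2) : ActsOnTree (K i) := by
  have hS := pushoutSplitting_universal φ
  have h1 : MulAction.stabilizer _ ((pushoutSplitting φ).vtx i 1) = (Monoid.PushoutI.of (φ := φ) i).range :=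
    Subgroup.ext fun h => (pushoutSplitting φ).smul_vtx_one i h
  have h2 := (h.of_mulEquiv e).stabilizer (T := (pushoutSplitting φ).toGTree hS)
    ((pushoutSplitting φ).finiteEdges_toGTree hS fun _ => Set.finite_range _)
    ((pushoutSplitting φ).vtx i 1)
  exact h2.of_mulEquiv ((MulEquiv.subgroupCongr h1).trans
    (MonoidHom.ofInjective (Monoid.PushoutI.of_injective hφ i)).symm)

theorem base (h : ActsOnTree G) {K : Type u} [Group K] {A B : Subgroup K} {φ : A ≃* B}
    (hA : Finite A) (e : G ≃* HNNExtension K A B φ) : ActsOnTree K := by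
  have hS := hnnSplitting_universal φ
  have : Finite B := Finite.of_equiv A φ.toEquiv
  have h1 : MulAction.stabilizer _ ((hnnSplitting φ).vtx () 1) = HNNExtension.of.range :=
    Subgroup.ext fun h => (hnnSplitting φ).smul_vtx_one () h
  have h2 := (h.of_mulEquiv e).stabilizer (T := (hnnSplitting φ).toGTree hS)
    ((hnnSplitting φ).finiteEdges_toGTree hS fun _ => (Set.toFinite (B : Set K)).image _)
    ((hnnSplitting φ).vtx () 1)
  exact h2.of_mulEquiv ((MulEquiv.subgroupCongr h1).trans
    (MonoidHom.ofInjective (HNNExtension.of_injective φ)).symm)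

theorem condition (h : ActsOnTree G) : Condition ActsOnTree G := by
  have hfg := h.fg
  have ⟨T, hT, hE, hV⟩ := h
  refine ⟨hfg, hT.residuallyFinite hE fun v => (hV v).residuallyFinite, ?_, ?_, ?_, fun hG => ?_⟩
  · obtain ⟨n, hn⟩ := hT.exists_bound hE fun v => (hV v).exists_treeAccessible
    exact accessible_of_bound hn
  · exact fun K _ H _ _ φ hφ _ ⟨e⟩ i => h.factor hφ e i
  · exact fun K _ A B φ hA ⟨e⟩ => h.base hA e
  -- With a fixed vertex, `G` is itself a vertex stabilizer; without one it is not one-ended.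
  · by_cases hfix : ∃ v : T.V, ∀ g : G, g • v = v
    · obtain ⟨v, hv⟩ := hfix
      have htop : MulAction.stabilizer G v = ⊤ := eq_top_iff.2 fun g _ => hv g
      exact ((hV v).of_mulEquiv ((MulEquiv.subgroupCongr htop).trans Subgroup.topEquiv)).oneEnded hG
    · exact (GTree.Cofinite.not_oneEnded T hT hE hfix hG).elim

theorem classA (h : ActsOnTree G) : ClassA G := ⟨ActsOnTree, fun _ _ h => h.condition, h⟩

end ActsOnTree

end FiniteSplitting

open FiniteSplitting in
/-- The class `𝒜` is closed under amalgamated free products over a finite group and under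
HNN-extensions with finite associated subgroups. -/
theorem mainTheorem6 :
    (∀ (K : Fin 2 → Type u) [∀ i, Group (K i)] (H : Type u) [Group H] [Finite H]
      (φ : ∀ i, H →* K i), (∀ i, Function.Injective (φ i)) → (∀ i, ClassA (K i)) →
        ClassA (Monoid.PushoutI φ)) ∧
    (∀ (K : Type u) [Group K] (H H' : Subgroup K) [Finite H] (φ : H ≃* H'), ClassA K →
        ClassA (HNNExtension K H H' φ)) := by
  refine ⟨fun K _ H _ _ φ hφ hK => ?_, fun K _ H H' hH φ hK => ?_⟩
  · exact (ActsOnTree.of_pushout hφ fun i => FiniteOrA.of_classA (hK i)).classA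
  · exact (ActsOnTree.of_hnn hH (FiniteOrA.of_classA hK)).classA
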